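/- **Conventions.** $\dot\Delta$ is the category of finite ordinals $\mathsf 0,\mathsf 1,\mathsf 2,\dots$ and monotone maps, $j:\Delta\to\dot\Delta$ is the inclusion of the nonempty ones, $d:\mathsf 0\to\mathsf 1$ is the unique map, and $\mathrm{Suc}=1+(-):\dot\Delta\to\dot\Delta$. For a pseudofunctor $\mathcal A:\dot\Delta\to\mathfrak H$ into a $2$-category (or bicategory) $\mathfrak H$, $\mathrm{Suc}^{\mathcal A}:\mathcal A\to\mathcal A\circ\mathrm{Suc}$ is the pseudonatural transformation with components $\mathcal A(d^0:\mathsf n\to\mathsf{n+1})$, where $d^0$ omits the least element. A right pseudo-Kan extension of $\mathcal F$ along $t$ is a pair $(\mathcal R,\varepsilon:\mathcal R\circ t\to\mathcal F)$ such that for every pseudofunctor $\mathcal S$ the functor $\alpha\mapsto\varepsilon\cdot(\alpha t)$ from pseudonatural transformations $\mathcal S\to\mathcal R$ to pseudonatural transformations $\mathcal S\circ t\to\mathcal F$ (with modifications as morphisms) is an equivalence of categories; it is pointwise if it is preserved by all representables $\mathfrak H(X,-)$. All right pseudo-Kan extensions considered are pointwise. The universal property, applied to the identity of $\mathcal A\circ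 j$, gives the comparison $\eta:\mathcal A\to\mathrm{Ran}_j(\mathcal A\circ j)$. A $1$-cell $f$ is faithful / fully faithful if all functors $\mathfrak H(X,f)$ are. $\mathcal A$ is of *effective $j$-descent* if $\eta$ is an equivalence, of *$j$-descent* if $\eta_{\mathsf 0}$ is fully faithful, of *almost $j$-descent* if $\eta_{\mathsf 0}$ is faithful. The *$j$-descent factorization* of $\mathcal A(d)$ is $$\mathcal A(\mathsf 0)\xrightarrow{\ \eta_{\mathsf 0}\ }\mathrm{Ran}_j(\mathcal A\circ j)(\mathsf 0)\xrightarrow{\ \varepsilon_{\mathsf 1}\circ\mathrm{Ran}_j(\mathcal A\circ j)(d)\ }\mathcal A(\mathsf 1)$$ with its canonical invertible $2$-cell to $\mathcal A(d)$. $\mathcal A$ has the *shift property* if $\mathcal A\circ\mathrm{Suc}$ is of effective $j$-descent. A pseudonatural transformation $\alpha:\mathcal F\to\mathcal G$ satisfies the *Beck–Chevalley condition* if every component $\alpha_w$ has a left adjoint $\hat\alpha_w$ and, for every $1$-cell $f:w\to c$, the mate $\hat\alpha_c\,\mathcal G(f)\Rightarrow\mathcal F(f)\,\hat\alpha_w$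 of the structure $2$-cell of $\alpha$ at $f$ is invertible. An *Eilenberg–Moore object* of the monad induced by an adjunction $l\dashv u$, $u:x\to y$, is an object $E$ with a universal algebra, i.e. such that for every $X$ restriction of that algebra is an equivalence from $\mathfrak H(X,E)$ to the category of algebras of the induced monad on $\mathfrak H(X,y)$. The *Eilenberg–Moore factorization* of $u$ is $x\xrightarrow{k}E\to y$, with $k$ the comparison $1$-cell. The $1$-cell $u$ is *monadic* / *premonadic* / *almost monadic* if it has a left adjoint, the Eilenberg–Moore object exists, and $k$ is an equivalence / fully faithful / faithful. Two factorizations of a $1$-cell (up to invertible $2$-cells) are *equivalent* if there is an equivalence between the middle objects, with invertible $2$-cells comparing the respective factors and compatible with the $2$-cells of the factorizations. **Theorem.** (1) Let $\mathcal A:\dot\Delta\to\mathfrak H$ be a pseudofunctor with the shift property such that $\mathrm{Suc}^{\mathcal A}$ satisfies the Beck–Chevalley condition. Assume that the pointwise right pseudo-Kan extension of $\mathcal A\circ j$ along $j$ and the Eilenberg–Moore object of the monad of $\mathcal A(d)$ exist. Then the Eilenberg–Moore factorization of $\mathcal A(d)$ is equivalent to the $j$-descent factorization of $\mathcal A(d)$.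 In particular, $\mathcal A$ is of effective $j$-descent iff $\mathcal A(d)$ is monadic; $\mathcal A$ is of $j$-descent iff $\mathcal A(d)$ is premonadic; and $\mathcal A$ is of almost $j$-descent iff $\mathcal A(d)$ is almost monadic. (2) (Bénabou–Roubaud) Let $\mathcal C$ be a category with pullbacks and $\mathcal A:\mathcal C^{\mathrm{op}}\to\mathsf{CAT}$ a pseudofunctor such that, for every morphism $p:E\to B$ of $\mathcal C$, the functor $\mathcal A(p)$ has a left adjoint, and for every $p$, with kernel pair $\pi_1,\pi_2:E\times_BE\to E$, the invertible $2$-cell $\mathcal A(\pi_1)\mathcal A(p)\cong\mathcal A(\pi_2)\mathcal A(p)$ induced by $\mathcal A$ satisfies the Beck–Chevalley condition (its mate $\mathcal A(\pi_2)!\,\mathcal A(\pi_1)\Rightarrow\mathcal A(p)\,\mathcal A(p)!$ is invertible). Let $\mathrm{Desc}_{\mathcal A}(p)$ be the classical category of descent data: objects $x$ of $\mathcal A(E)$ with a morphism $\mathcal A(\pi_1)x\to\mathcal A(\pi_2)x$ satisfying the unit and cocycle conditions (it is then invertible). Then for every $p$ the descent factorization $\mathcal A(B)\to\mathrm{Desc}_{\mathcal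 A}(p)\to\mathcal A(E)$ of $\mathcal A(p)$ is equivalent to its Eilenberg–Moore factorization. In particular, the comparison functor $\mathcal A(B)\to\mathrm{Desc}_{\mathcal A}(p)$ is an equivalence / fully faithful / faithful iff the Eilenberg–Moore comparison functor of $\mathcal A(p)$ is. -/

import Mathlib

open CategoryTheory Bicategory
open scoped Pseudofunctor.StrongTrans

universe w v u w₁ v₁ u₁ w₂ v₂ u₂ w₃ v₃ u₃

/-- The category `Δ̇` of finite ordinals (including the empty one) and monotone maps. -/
structure FinOrd : Type where
  /-- The number of elements of the ordinal. -/
  card : ℕ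

namespace FinOrd
instance : Category FinOrd where
  Hom a b := Fin a.card →o Fin b.card
  id _ := OrderHom.id
  comp f g := OrderHom.comp g f

/-- The inclusion `j : Δ → Δ̇` of the nonempty finite ordinals. -/
def j : SimplexCategory ⥤ FinOrd where
  obj n := ⟨n.len + 1⟩
  map f := f.toOrderHom

/-- The ordinal sum `1 + f`, which keeps the new bottom element fixed. -/
def sucMap {m n : ℕ} (f : Fin m →o Fin n) : Fin (m + 1) →o Fin (n + 1) where
  toFun := Fin.cases 0 fun i => (f i).succ
  monotone' a b h := by
    induction a using Fin.cases with
    | zero => simp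
    | succ a =>
      induction b using Fin.cases with
      | zero => simp at h
      | succ b => simpa using f.monotone (by simpa using h)

/-- The endofunctor `Suc = 1 + (-)` of `Δ̇`. -/
def suc : FinOrd ⥤ FinOrd where
  obj n := ⟨n.card + 1⟩
  map f := sucMap f
  map_id n := by
    apply OrderHom.ext
    funext i
    induction i using Fin.cases <;> rfl
  map_comp f g := by
    apply OrderHom.ext
    funext i
    induction i using Fin.cases <;> rfl

/-- The coface `d⁰ : n → n + 1` omitting the bottom element, natural in `n`. -/
def d0 : 𝟭 FinOrd ⟶ suc where
  app n := (⟨Fin.succ, fun _ _ h => Fin.succ_le_succ_iff.2 h⟩ : Fin n.card →o Fin (n.card + 1))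
  naturality _ _ f := by
    apply OrderHom.ext
    funext i
    rfl

/-- The empty ordinal. -/
abbrev zero : FinOrd := ⟨0⟩

/-- The one-element ordinal. -/
abbrev one : FinOrd := ⟨1⟩

/-- The unique map `d : 0 → 1`. -/
def d : zero ⟶ one := d0.app zero

end FinOrd

namespace FormalDescent
variable {B : Type u₁} [Bicategory.{w₁, v₁} B] {C : Type u₂} [Bicategory.{w₂, v₂} C]
  {D : Type u₃} [Bicategory.{w₃, v₃} D]

/-- Whiskering `α * t` of a pseudonatural transformation with a pseudofunctor `t` on the source side. -/
def precompTrans (t : B ⥤ᵖ C) {F G : C ⥤ᵖ D} (α : F ⟶ G) : t.comp F ⟶ t.comp G where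
  app a := α.app (t.obj a)
  naturality f := α.naturality (t.map f)
  naturality_naturality η := α.naturality_naturality (t.map₂ η)
  naturality_id a := by
    have h := α.naturality_naturality (t.mapId a).hom
    have h2 := α.naturality_id (t.obj a)
    change (α.naturality (t.map (𝟙 a))).hom ≫
      α.app (t.obj a) ◁ (G.map₂ (t.mapId a).hom ≫ (G.mapId (t.obj a)).hom) =
      (F.map₂ (t.mapId a).hom ≫ (F.mapId (t.obj a)).hom) ▷ α.app (t.obj a) ≫
        (λ_ (α.app (t.obj a))).hom ≫ (ρ_ (α.app (t.obj a))).inv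
    rw [Bicategory.whiskerLeft_comp, ← Category.assoc, ← h, Category.assoc, h2,
      comp_whiskerRight, Category.assoc]
  naturality_comp {a b c} f g := by
    have h := α.naturality_naturality (t.mapComp f g).hom
    have h2 := α.naturality_comp (t.map f) (t.map g)
    change (α.naturality (t.map (f ≫ g))).hom ≫
      α.app (t.obj a) ◁ (G.map₂ (t.mapComp f g).hom ≫ (G.mapComp (t.map f) (t.map g)).hom) =
      (F.map₂ (t.mapComp f g).hom ≫ (F.mapComp (t.map f) (t.map g)).hom) ▷ α.app (t.obj c) ≫ _
    rw [Bicategory.whiskerLeft_comp, ← Category.assoc, ← h, Category.assoc, h2,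
      comp_whiskerRight]
    exact (Category.assoc _ _ _).symm

/-- The functor `α ↦ α * t` between categories of pseudonatural transformations and
modifications. -/
def precompFunctor (t : B ⥤ᵖ C) (F G : C ⥤ᵖ D) : (F ⟶ G) ⥤ (t.comp F ⟶ t.comp G) where
  obj α := precompTrans t α
  map Γ := ⟨{
    app := fun a => Γ.as.app (t.obj a)
    naturality := fun f => Γ.as.naturality (t.map f) }⟩
  map_id _ := rfl
  map_comp _ _ := rfl

theorem map₂_pasting (U : C ⥤ᵖ D) {x₀ x₁ x₂ y₀ y₁ y₂ : C} {f : x₀ ⟶ x₁} {g : x₁ ⟶ x₂}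
    {k : x₀ ⟶ x₂} (c : k ⟶ f ≫ g) {f' : y₀ ⟶ y₁} {g' : y₁ ⟶ y₂} {k' : y₀ ⟶ y₂}
    (c' : k' ⟶ f' ≫ g') (a₀ : x₀ ⟶ y₀) (a₁ : x₁ ⟶ y₁) (a₂ : x₂ ⟶ y₂)
    (p : f ≫ a₁ ⟶ a₀ ≫ f') (q : g ≫ a₂ ⟶ a₁ ≫ g') (r : k ≫ a₂ ⟶ a₀ ≫ k')
    (h : r ≫ a₀ ◁ c' = c ▷ a₂ ≫ (α_ _ _ _).hom ≫ f ◁ q ≫ (α_ _ _ _).inv ≫ p ▷ g' ≫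
      (α_ _ _ _).hom) :
    ((U.mapComp _ _).inv ≫ U.map₂ r ≫ (U.mapComp _ _).hom) ≫
        U.map a₀ ◁ (U.map₂ c' ≫ (U.mapComp f' g').hom) =
      (U.map₂ c ≫ (U.mapComp f g).hom) ▷ U.map a₂ ≫ (α_ _ _ _).hom ≫
        U.map f ◁ ((U.mapComp _ _).inv ≫ U.map₂ q ≫ (U.mapComp _ _).hom) ≫ (α_ _ _ _).inv ≫
        ((U.mapComp _ _).inv ≫ U.map₂ p ≫ (U.mapComp _ _).hom) ▷ U.map g' ≫
        (α_ _ _ _).hom := by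
  have h' := congrArg (fun t => (U.mapComp _ _).inv ≫ U.map₂ t ≫
    (U.mapComp a₀ (f' ≫ g')).hom ≫ U.map a₀ ◁ (U.mapComp f' g').hom) h
  have ai : ∀ {w x y z : C} (f : w ⟶ x) (g : x ⟶ y) (k : y ⟶ z), U.map₂ (α_ f g k).inv =
      (U.mapComp f (g ≫ k)).hom ≫ U.map f ◁ (U.mapComp g k).hom ≫ (α_ _ _ _).inv ≫
      (U.mapComp f g).inv ▷ U.map k ≫ (U.mapComp (f ≫ g) k).inv := by
    intro w x y z f g k
    rw [← cancel_epi (U.map₂ (α_ f g k).hom), ← U.map₂_comp, Iso.hom_inv_id, U.map₂_id,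
      U.map₂_associator]
    simp
  simp only [U.map₂_comp, U.map₂_whisker_left, U.map₂_whisker_right, ai, U.map₂_associator,
    Category.assoc, Iso.inv_hom_id_assoc] at h'
  simp only [Category.assoc, Bicategory.whiskerLeft_comp, comp_whiskerRight]
  refine h'.trans ?_
  simp

/-- Whiskering `U * α` of a pseudonatural transformation with a pseudofunctor `U` on the target
side. -/
def whiskerRightTrans {F G : B ⥤ᵖ C} (α : F ⟶ G) (U : C ⥤ᵖ D) : F.comp U ⟶ G.comp U where
  app a := U.map (α.app a)
  naturality f := (U.mapComp _ _).symm ≪≫ U.map₂Iso (α.naturality f) ≪≫ U.mapComp _ _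
  naturality_naturality {a b f g} η := by
    have h := congrArg U.map₂ (α.naturality_naturality η)
    rw [U.map₂_comp, U.map₂_comp, U.map₂_whisker_left, U.map₂_whisker_right] at h
    change U.map₂ (F.map₂ η) ▷ U.map (α.app b) ≫ (U.mapComp _ _).inv ≫
      U.map₂ (α.naturality g).hom ≫ (U.mapComp _ _).hom =
      ((U.mapComp _ _).inv ≫ U.map₂ (α.naturality f).hom ≫ (U.mapComp _ _).hom) ≫
        U.map (α.app a) ◁ U.map₂ (G.map₂ η)
    rw [← cancel_epi (U.mapComp (F.map f) (α.app b)).hom,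
      ← cancel_mono (U.mapComp (α.app a) (G.map g)).inv]
    simpa using h
  naturality_id a := by
    have h := congrArg U.map₂ (α.naturality_id a)
    simp only [U.map₂_comp, U.map₂_whisker_left, U.map₂_whisker_right] at h
    change ((U.mapComp _ _).inv ≫ U.map₂ (α.naturality (𝟙 a)).hom ≫ (U.mapComp _ _).hom) ≫
        U.map (α.app a) ◁ (U.map₂ (G.mapId a).hom ≫ (U.mapId (G.obj a)).hom) =
        (U.map₂ (F.mapId a).hom ≫ (U.mapId (F.obj a)).hom) ▷ U.map (α.app a) ≫
          (λ_ (U.map (α.app a))).hom ≫ (ρ_ (U.map (α.app a))).inv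
    rw [← cancel_epi (U.mapComp (F.map (𝟙 a)) (α.app a)).hom]
    have h' := congrArg (fun t => t ≫ (U.mapComp (α.app a) (𝟙 (G.obj a))).hom ≫
      U.map (α.app a) ◁ (U.mapId (G.obj a)).hom) h
    simp only [Category.assoc, Iso.inv_hom_id_assoc] at h'
    simp only [Category.assoc, Iso.hom_inv_id_assoc, Bicategory.whiskerLeft_comp]
    erw [h']
    have e1 := U.map₂_left_unitor (α.app a)
    have e2 := U.map₂_right_unitor (α.app a)
    have e3 : U.map₂ (ρ_ (α.app a)).inv ≫ (U.mapComp (α.app a) (𝟙 (G.obj a))).hom ≫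
      U.map (α.app a) ◁ (U.mapId (G.obj a)).hom = (ρ_ (U.map (α.app a))).inv := by
      rw [← cancel_mono (ρ_ (U.map (α.app a))).hom, Category.assoc, Category.assoc, ← e2,
        ← U.map₂_comp, Iso.inv_hom_id, Iso.inv_hom_id, U.map₂_id]
    rw [e3, e1]
    simp
  naturality_comp {a b c} f g := by
    exact map₂_pasting U (F.mapComp f g).hom (G.mapComp f g).hom (α.app a) (α.app b) (α.app c)
      (α.naturality f).hom (α.naturality g).hom (α.naturality (f ≫ g)).hom (α.naturality_comp f g)
section Transformation
variable {J : Type u₁} [Category.{v₁} J] {H : Type u} [Bicategory.{w, v} H]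

theorem isoMapOfCommSq_id (A : LocallyDiscrete J ⥤ᵖ H) {x y : LocallyDiscrete J} (l : x ⟶ y)
    (k : y ⟶ y) (e : k ⟶ 𝟙 y) (sq : CommSq (𝟙 x) l l k) :
    (A.isoMapOfCommSq sq).hom ≫ A.map l ◁ (A.map₂ e ≫ (A.mapId y).hom) =
      (A.mapId x).hom ▷ A.map l ≫ (λ_ (A.map l)).hom ≫ (ρ_ (A.map l)).inv := by
  obtain rfl := LocallyDiscrete.eq_of_hom e
  obtain rfl : e = 𝟙 _ := Subsingleton.elim _ _
  rw [A.isoMapOfCommSq_horiz_id l]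
  simp

theorem isoMapOfCommSq_comp (A : LocallyDiscrete J ⥤ᵖ H) {x₀ x₁ x₂ y₀ y₁ y₂ : LocallyDiscrete J}
    (f : x₀ ⟶ x₁) (g : x₁ ⟶ x₂) (f' : y₀ ⟶ y₁) (g' : y₁ ⟶ y₂) (k' : y₀ ⟶ y₂)
    (c : k' ⟶ f' ≫ g') (a₀ : x₀ ⟶ y₀) (a₁ : x₁ ⟶ y₁) (a₂ : x₂ ⟶ y₂)
    (sf : CommSq f a₀ a₁ f') (sg : CommSq g a₁ a₂ g') (sk : CommSq (f ≫ g) a₀ a₂ k') :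
    (A.isoMapOfCommSq sk).hom ≫ A.map a₀ ◁ (A.map₂ c ≫ (A.mapComp f' g').hom) =
      (A.mapComp f g).hom ▷ A.map a₂ ≫ (α_ _ _ _).hom ≫
        A.map f ◁ (A.isoMapOfCommSq sg).hom ≫ (α_ _ _ _).inv ≫
        (A.isoMapOfCommSq sf).hom ▷ A.map g' ≫ (α_ _ _ _).hom := by
  obtain rfl := LocallyDiscrete.eq_of_hom c
  obtain rfl : c = 𝟙 _ := Subsingleton.elim _ _
  rw [A.isoMapOfCommSq_eq sk ((f ≫ g) ≫ a₂) rfl, A.isoMapOfCommSq_eq sg (g ≫ a₂) rfl,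
    A.isoMapOfCommSq_eq sf (f ≫ a₁) rfl]
  have h1 := A.mapComp'₀₁₃_hom_comp_whiskerLeft_mapComp'_hom f g a₂ (f ≫ g) (g ≫ a₂)
    ((f ≫ g) ≫ a₂) rfl rfl (Category.assoc _ _ _).symm
  have h2 := A.mapComp'₀₁₃_hom_comp_whiskerLeft_mapComp'_hom f a₁ g' (f ≫ a₁) (g ≫ a₂)
    ((f ≫ g) ≫ a₂) rfl sg.w.symm (Category.assoc _ _ _).symm
  have h3 := A.mapComp'₀₁₃_hom_comp_whiskerLeft_mapComp'_hom a₀ f' g' (f ≫ a₁) (f' ≫ g')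
    ((f ≫ g) ≫ a₂) sf.w.symm rfl sk.w.symm
  rw [← A.mapComp'_eq_mapComp f g, ← A.mapComp'_eq_mapComp f' g',
    ← cancel_epi (A.mapComp' (f ≫ g) a₂ ((f ≫ g) ≫ a₂) rfl).hom, ← Category.assoc _ _ (_ ≫ _)]
  simp only [PrelaxFunctor.map₂_id, Category.id_comp, Iso.trans_hom, Iso.symm_hom, Category.assoc,
    Iso.hom_inv_id_assoc, comp_whiskerRight, Bicategory.whiskerLeft_comp]
  rw [h3, ← reassoc_of% h1, whiskerLeft_hom_inv_assoc, reassoc_of% h2]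
  simp

/-- A natural transformation `τ : id ⟶ T` induces a pseudonatural transformation `A ⟶ A ∘ T` with
components `A(τ_n)`. -/
def unitTrans {T : J ⥤ J} (τ : 𝟭 J ⟶ T) (A : LocallyDiscrete J ⥤ᵖ H) :
    A ⟶ T.toPseudofunctor.comp A where
  app n := A.map (τ.app n.as).toLoc
  naturality {m n} f := A.isoMapOfCommSq
    (t := f) (l := (τ.app m.as).toLoc) (r := (τ.app n.as).toLoc) (b := (T.map f.as).toLoc)
    ⟨congrArg Quiver.Hom.toLoc (τ.naturality f.as)⟩
  naturality_naturality {m n f g} η := by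
    obtain rfl := LocallyDiscrete.eq_of_hom η
    obtain rfl : η = 𝟙 _ := Subsingleton.elim _ _
    rw [PrelaxFunctor.map₂_id, PrelaxFunctor.map₂_id]
    exact (congrArg (· ≫ _) (id_whiskerRight _ _)).trans ((Category.id_comp _).trans
      ((Category.comp_id _).symm.trans (congrArg (_ ≫ ·) (whiskerLeft_id _ _).symm)))
  naturality_id n := isoMapOfCommSq_id A (τ.app n.as).toLoc (T.map (𝟙 n.as)).toLoc
    (T.toPseudofunctor.mapId n).hom _
  naturality_comp {m n k} f g := isoMapOfCommSq_comp A f g (T.map f.as).toLoc (T.map g.as).toLoc _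
    (T.toPseudofunctor.mapComp f g).hom (τ.app m.as).toLoc (τ.app n.as).toLoc (τ.app k.as).toLoc
    _ _ _
end Transformation

section Kan
variable {B : Type u₁} [Bicategory.{w₁, v₁} B] {C : Type u₂} [Bicategory.{w₂, v₂} C]
  {D : Type u₃} [Bicategory.{w₃, v₃} D] {H : Type u} [Bicategory.{w, v} H]

/-- The functor `α ↦ κ · (α * t)` from transformations `S ⟶ R` to transformations `S ∘ t ⟶ F`. -/
def kanFunctor {t : B ⥤ᵖ C} {R : C ⥤ᵖ D} {F : B ⥤ᵖ D} (κ : t.comp R ⟶ F) (S : C ⥤ᵖ D) :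
    (S ⟶ R) ⥤ (t.comp S ⟶ F) :=
  precompFunctor t S R ⋙ postcomp (t.comp S) κ

/-- `(R, κ)` is a right pseudo-Kan extension of `F` along `t`. -/
def IsRightKan {t : B ⥤ᵖ C} {R : C ⥤ᵖ D} {F : B ⥤ᵖ D} (κ : t.comp R ⟶ F) : Prop :=
  ∀ S : C ⥤ᵖ D, (kanFunctor κ S).IsEquivalence

/-- The transformation `U * κ : U ∘ R ∘ t ⟶ U ∘ F`. -/
def whiskerCounit {t : B ⥤ᵖ C} {R : C ⥤ᵖ H} {F : B ⥤ᵖ H} (κ : t.comp R ⟶ F) (U : H ⥤ᵖ D) :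
    t.comp (R.comp U) ⟶ F.comp U where
  app a := U.map (κ.app a)
  naturality f := (U.mapComp _ _).symm ≪≫ U.map₂Iso (κ.naturality f) ≪≫ U.mapComp _ _
  naturality_naturality η := (whiskerRightTrans κ U).naturality_naturality η
  naturality_id a := by
    refine Eq.trans ?_ (((whiskerRightTrans κ U).naturality_id a).trans ?_)
    · rfl
    · change (U.map₂ (R.map₂ (t.mapId a).hom ≫ (R.mapId (t.obj a)).hom) ≫
          (U.mapId (R.obj (t.obj a))).hom) ▷ U.map (κ.app a) ≫ _ =
        (U.map₂ (R.map₂ (t.mapId a).hom) ≫ U.map₂ (R.mapId (t.obj a)).hom ≫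
          (U.mapId (R.obj (t.obj a))).hom) ▷ U.map (κ.app a) ≫ _
      rw [U.map₂_comp, Category.assoc]
      rfl
  naturality_comp {a b c} f g := by
    refine Eq.trans ?_ (((whiskerRightTrans κ U).naturality_comp f g).trans ?_)
    · rfl
    · change (U.map₂ (R.map₂ (t.mapComp f g).hom ≫ (R.mapComp (t.map f) (t.map g)).hom) ≫
          (U.mapComp (R.map (t.map f)) (R.map (t.map g))).hom) ▷ U.map (κ.app c) ≫ _ =
        (U.map₂ (R.map₂ (t.mapComp f g).hom) ≫ U.map₂ (R.mapComp (t.map f) (t.map g)).hom ≫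
          (U.mapComp (R.map (t.map f)) (R.map (t.map g))).hom) ▷ U.map (κ.app c) ≫ _
      rw [U.map₂_comp, Category.assoc]
      rfl

/-- The representable pseudofunctor `H(X, -)`. -/
def coyoneda (X : H) : H ⥤ᵖ Cat.{w, v} where
  obj y := Cat.of (X ⟶ y)
  map f := (postcomp X f).toCatHom
  map₂ η := NatTrans.toCatHom₂ ((postcomposing X _ _).map η)
  map₂_id f := by ext g; exact whiskerLeft_id g f
  map₂_comp η θ := by ext g; exact Bicategory.whiskerLeft_comp g η θ
  mapId y := Cat.Hom.isoMk (NatIso.ofComponents (fun g => ρ_ g) fun η => rightUnitor_naturality η)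
  mapComp f g := Cat.Hom.isoMk (NatIso.ofComponents (fun h => (α_ h f g).symm)
    fun η => associator_inv_naturality_left η f g)
  map₂_whisker_left f g h η := by
    have e : ∀ k : X ⟶ _, k ◁ f ◁ η = (α_ k f g).inv ≫ (k ≫ f) ◁ η ≫ (α_ k f h).hom := by
      intro k; simp
    ext k
    exact e k
  map₂_whisker_right {_ _ _ f g} η h := by
    have e : ∀ k : X ⟶ _, k ◁ η ▷ h = (α_ k f h).inv ≫ (k ◁ η) ▷ h ≫ (α_ k g h).hom := by
      intro k; simp
    ext k
    exact e k
  map₂_associator f g h := by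
    have e : ∀ k : X ⟶ _, k ◁ (α_ f g h).hom = (α_ k (f ≫ g) h).inv ≫ (α_ k f g).inv ▷ h ≫ 𝟙 _ ≫
        (α_ (k ≫ f) g h).hom ≫ (α_ k f (g ≫ h)).hom := by
      intro k; simp
    ext k
    exact e k
  map₂_left_unitor f := by
    have e : ∀ k : X ⟶ _, k ◁ (λ_ f).hom = (α_ k (𝟙 _) f).inv ≫ (ρ_ k).hom ▷ f ≫ 𝟙 _ := by
      intro k; simp
    ext k
    exact e k
  map₂_right_unitor f := by
    have e : ∀ k : X ⟶ _, k ◁ (ρ_ f).hom = (α_ k f (𝟙 _)).inv ≫ (ρ_ (k ≫ f)).hom ≫ 𝟙 _ := by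
      intro k; simp
    ext k
    exact e k

/-- A right pseudo-Kan extension of `F` along `t`. -/
structure RightPsKan (t : B ⥤ᵖ C) (F : B ⥤ᵖ H) where
  /-- The extended pseudofunctor. -/
  ran : C ⥤ᵖ H
  /-- The universal arrow. -/
  counit : t.comp ran ⟶ F
  isKan : IsRightKan counit

namespace RightPsKan
variable {t : B ⥤ᵖ C}

/-- A right pseudo-Kan extension is pointwise if all representables preserve it. -/
def IsPointwise {F : B ⥤ᵖ H} (K : RightPsKan t F) : Prop :=
  ∀ X : H, IsRightKan (whiskerCounit K.counit (coyoneda X))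

variable {A : C ⥤ᵖ H} (K : RightPsKan t (t.comp A))

instance {F : B ⥤ᵖ H} (K : RightPsKan t F) (S : C ⥤ᵖ H) : (kanFunctor K.counit S).IsEquivalence :=
  K.isKan S

/-- The comparison `η : A ⟶ Ran_t (A ∘ t)`, determined up to isomorphism by `triangle`. -/
noncomputable def comparison : A ⟶ K.ran :=
  (kanFunctor K.counit A).inv.obj (𝟙 (t.comp A))

/-- The defining invertible modification `κ · (η * t) ≅ id`. -/
noncomputable def triangle : precompTrans t K.comparison ≫ K.counit ≅ 𝟙 (t.comp A) :=
  (kanFunctor K.counit A).asEquivalence.counitIso.app (𝟙 (t.comp A))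

end RightPsKan

/-- The component of an invertible modification. -/
def appIso {F G : B ⥤ᵖ D} {α β : F ⟶ G} (Γ : α ≅ β) (a : B) : α.app a ≅ β.app a where
  hom := Γ.hom.as.app a
  inv := Γ.inv.as.app a
  hom_inv_id := congrArg (fun m => Pseudofunctor.StrongTrans.Modification.app
    (Pseudofunctor.StrongTrans.Hom.as m) a) Γ.hom_inv_id
  inv_hom_id := congrArg (fun m => Pseudofunctor.StrongTrans.Modification.app
    (Pseudofunctor.StrongTrans.Hom.as m) a) Γ.inv_hom_id

/-- A factorization of a 1-cell up to an invertible 2-cell. -/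
structure Factorization {x y : H} (f : x ⟶ y) where
  /-- The middle object. -/
  mid : H
  /-- The first factor. -/
  left : x ⟶ mid
  /-- The second factor. -/
  right : mid ⟶ y
  /-- The invertible 2-cell. -/
  iso : left ≫ right ≅ f

/-- Equivalence of factorizations: an equivalence of the middle objects with invertible 2-cells
comparing the factors, compatibly with the 2-cells of the factorizations. -/
def Factorization.IsEquivalent {x y : H} {f : x ⟶ y} (P Q : Factorization f) : Prop :=
  ∃ (e : P.mid ≌ Q.mid) (φ : P.left ≫ e.hom ≅ Q.left) (ψ : e.hom ≫ Q.right ≅ P.right),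
    φ.hom ▷ Q.right ≫ Q.iso.hom =
      (α_ P.left e.hom Q.right).hom ≫ P.left ◁ ψ.hom ≫ P.iso.hom

/-- The `t`-descent factorization of `A(g)`, for `g : x ⟶ t(b)`, through `Ran_t (A ∘ t) (x)`: the
first factor is the component of the comparison, and the 2-cell combines its pseudonaturality at
`g` with `triangle`. -/
noncomputable def RightPsKan.factorization {t : B ⥤ᵖ C} {A : C ⥤ᵖ H}
    (K : RightPsKan t (t.comp A)) {x : C} {b : B} (g : x ⟶ t.obj b) :
    Factorization (A.map g) where
  mid := K.ran.obj x
  left := K.comparison.app x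
  right := K.ran.map g ≫ K.counit.app b
  iso := (α_ (K.comparison.app x) (K.ran.map g) (K.counit.app b)).symm ≪≫
    whiskerRightIso (K.comparison.naturality g).symm (K.counit.app b) ≪≫
    α_ (A.map g) (K.comparison.app (t.obj b)) (K.counit.app b) ≪≫
    whiskerLeftIso (A.map g) (appIso K.triangle b) ≪≫ ρ_ (A.map g)

/-- A 1-cell which is (part of) an equivalence. -/
def IsEquiv₁ {x y : H} (f : x ⟶ y) : Prop :=
  ∃ e : x ≌ y, e.hom = f

/-- A faithful 1-cell: all `H(X, f)` are faithful. -/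
def IsFaithful₁ {x y : H} (f : x ⟶ y) : Prop :=
  ∀ X : H, (postcomp X f).Faithful

/-- A fully faithful 1-cell: all `H(X, f)` are fully faithful. -/
def IsFullyFaithful₁ {x y : H} (f : x ⟶ y) : Prop :=
  ∀ X : H, (postcomp X f).Full ∧ (postcomp X f).Faithful

/-- `A` is of effective `t`-descent: the comparison `A ⟶ Ran_t (A ∘ t)` is an equivalence. -/
def IsEffectiveDescent (t : B ⥤ᵖ C) (A : C ⥤ᵖ H) : Prop :=
  ∃ K : RightPsKan t (t.comp A), K.IsPointwise ∧ IsEquiv₁ K.comparison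

/-- `A` is of `t`-descent at the object `x`: the comparison is fully faithful there. -/
def IsDescent (t : B ⥤ᵖ C) (A : C ⥤ᵖ H) (x : C) : Prop :=
  ∃ K : RightPsKan t (t.comp A), K.IsPointwise ∧ IsFullyFaithful₁ (K.comparison.app x)

/-- `A` is of almost `t`-descent at the object `x`: the comparison is faithful there. -/
def IsAlmostDescent (t : B ⥤ᵖ C) (A : C ⥤ᵖ H) (x : C) : Prop :=
  ∃ K : RightPsKan t (t.comp A), K.IsPointwise ∧ IsFaithful₁ (K.comparison.app x)

end Kan

section EM
variable {H : Type u} [Bicategory.{w, v} H] {x y : H} {l : y ⟶ x} {r : x ⟶ y}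

theorem homAdj_left (adj : Bicategory.Adjunction l r) {X : H} (g : X ⟶ y) :
    ((ρ_ g).inv ≫ g ◁ adj.unit ≫ (α_ g l r).inv) ▷ l ≫
      (α_ (g ≫ l) r l).hom ≫ (g ≫ l) ◁ adj.counit ≫ (ρ_ (g ≫ l)).hom = 𝟙 (g ≫ l) := by
  calc
    _ = 𝟙 _ ⊗≫ g ◁ leftZigzag adj.unit adj.counit ⊗≫ 𝟙 (g ≫ l) := by
      dsimp only [leftZigzag]
      have e : (g ≫ l) ◁ adj.counit = (α_ g l (r ≫ l)).hom ≫ g ◁ l ◁ adj.counit ≫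
        (α_ g l (𝟙 x)).inv := by simp
      rw [e]
      bicategory
    _ = _ := by
      rw [adj.left_triangle]
      bicategory

theorem homAdj_right (adj : Bicategory.Adjunction l r) {X : H} (k : X ⟶ x) :
    ((ρ_ (k ≫ r)).inv ≫ (k ≫ r) ◁ adj.unit ≫ (α_ (k ≫ r) l r).inv) ≫
      ((α_ k r l).hom ≫ k ◁ adj.counit ≫ (ρ_ k).hom) ▷ r = 𝟙 (k ≫ r) := by
  calc
    _ = 𝟙 _ ⊗≫ k ◁ rightZigzag adj.unit adj.counit ⊗≫ 𝟙 (k ≫ r) := by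
      dsimp only [rightZigzag]
      have e : (k ≫ r) ◁ adj.unit = (α_ k r (𝟙 y)).hom ≫ k ◁ r ◁ adj.unit ≫
        (α_ k r (l ≫ r)).inv := by simp
      rw [e]
      bicategory
    _ = _ := by
      rw [adj.right_triangle]
      bicategory

/-- The adjunction `H(X, l) ⊣ H(X, r)` induced by `l ⊣ r`. -/
def homAdj (adj : Bicategory.Adjunction l r) (X : H) : postcomp X l ⊣ postcomp X r :=
  CategoryTheory.Adjunction.mkOfUnitCounit {
    unit := {
      app := fun g => (ρ_ g).inv ≫ g ◁ adj.unit ≫ (α_ g l r).inv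
      naturality := fun g g' η => by
        change η ≫ (ρ_ g').inv ≫ g' ◁ adj.unit ≫ (α_ g' l r).inv =
          ((ρ_ g).inv ≫ g ◁ adj.unit ≫ (α_ g l r).inv) ≫ η ▷ l ▷ r
        rw [rightUnitor_inv_naturality_assoc, ← whisker_exchange_assoc,
          associator_inv_naturality_left]
        simp only [Category.assoc] }
    counit := {
      app := fun k => (α_ k r l).hom ≫ k ◁ adj.counit ≫ (ρ_ k).hom
      naturality := fun k k' η => by
        change η ▷ r ▷ l ≫ (α_ k' r l).hom ≫ k' ◁ adj.counit ≫ (ρ_ k').hom =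
          ((α_ k r l).hom ≫ k ◁ adj.counit ≫ (ρ_ k).hom) ≫ η
        rw [associator_naturality_left_assoc, ← whisker_exchange_assoc, rightUnitor_naturality]
        simp only [Category.assoc] }
    left_triangle := by
      ext g
      change ((ρ_ g).inv ≫ g ◁ adj.unit ≫ (α_ g l r).inv) ▷ l ≫ 𝟙 _ ≫
        (α_ (g ≫ l) r l).hom ≫ (g ≫ l) ◁ adj.counit ≫ (ρ_ (g ≫ l)).hom = 𝟙 (g ≫ l)
      rw [Category.id_comp, homAdj_left]
    right_triangle := by
      ext k
      change ((ρ_ (k ≫ r)).inv ≫ (k ≫ r) ◁ adj.unit ≫ (α_ (k ≫ r) l r).inv) ≫ 𝟙 _ ≫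
        ((α_ k r l).hom ≫ k ◁ adj.counit ≫ (ρ_ k).hom) ▷ r = 𝟙 (k ≫ r)
      rw [Category.id_comp, homAdj_right] }

theorem homMonad_η (adj : Bicategory.Adjunction l r) {X : H} (g : X ⟶ y) :
    (homAdj adj X).toMonad.η.app g = (ρ_ g).inv ≫ g ◁ adj.unit ≫ (α_ g l r).inv := rfl

theorem homMonad_μ (adj : Bicategory.Adjunction l r) {X : H} (g : X ⟶ y) :
    (homAdj adj X).toMonad.μ.app g =
      ((α_ (g ≫ l) r l).hom ≫ (g ≫ l) ◁ adj.counit ≫ (ρ_ (g ≫ l)).hom) ▷ r := rfl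

theorem precomp_unit (n : 𝟙 y ⟶ l ≫ r) {X E : H} (f : X ⟶ E) (m : E ⟶ y)
    (a : (m ≫ l) ≫ r ⟶ m) (h : ((ρ_ m).inv ≫ m ◁ n ≫ (α_ m l r).inv) ≫ a = 𝟙 m) :
    ((ρ_ (f ≫ m)).inv ≫ (f ≫ m) ◁ n ≫ (α_ (f ≫ m) l r).inv) ≫
      (α_ f m l).hom ▷ r ≫ (α_ f (m ≫ l) r).hom ≫ f ◁ a = 𝟙 (f ≫ m) := by
  have h' := congrArg (fun s => f ◁ s) h
  simp only [Bicategory.whiskerLeft_id] at h'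
  rw [← h']
  bicategory

theorem precomp_assoc (c : r ≫ l ⟶ 𝟙 x) {X E : H} (f : X ⟶ E) (m : E ⟶ y)
    (a : (m ≫ l) ≫ r ⟶ m)
    (h : ((α_ (m ≫ l) r l).hom ≫ (m ≫ l) ◁ c ≫ (ρ_ (m ≫ l)).hom) ▷ r ≫ a = a ▷ l ▷ r ≫ a) :
    ((α_ ((f ≫ m) ≫ l) r l).hom ≫ ((f ≫ m) ≫ l) ◁ c ≫ (ρ_ ((f ≫ m) ≫ l)).hom) ▷ r ≫
        ((α_ f m l).hom ▷ r ≫ (α_ f (m ≫ l) r).hom ≫ f ◁ a) =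
      ((α_ f m l).hom ▷ r ≫ (α_ f (m ≫ l) r).hom ≫ f ◁ a) ▷ l ▷ r ≫
        ((α_ f m l).hom ▷ r ≫ (α_ f (m ≫ l) r).hom ≫ f ◁ a) := by
  calc
    _ = 𝟙 _ ⊗≫ f ◁ (((α_ (m ≫ l) r l).hom ≫ (m ≫ l) ◁ c ≫ (ρ_ (m ≫ l)).hom) ▷ r ≫ a) := by
      bicategory
    _ = _ := by
      rw [h]
      bicategory

theorem precomp_hom {X E : H} {f g : X ⟶ E} (η : f ⟶ g) (m : E ⟶ y) (a : (m ≫ l) ≫ r ⟶ m) :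
    η ▷ m ▷ l ▷ r ≫ (α_ g m l).hom ▷ r ≫ (α_ g (m ≫ l) r).hom ≫ g ◁ a =
      ((α_ f m l).hom ▷ r ≫ (α_ f (m ≫ l) r).hom ≫ f ◁ a) ≫ η ▷ m := by
  calc
    _ = 𝟙 _ ⊗≫ (η ▷ ((m ≫ l) ≫ r) ≫ g ◁ a) := by bicategory
    _ = _ := by
      rw [← whisker_exchange]
      bicategory

/-- Restriction of an algebra `M` on a 1-cell out of `E` along 1-cells `X ⟶ E`, for the monad induced
by `l ⊣ r` on hom-categories. -/
def algPrecomp (adj : Bicategory.Adjunction l r) {E : H} (M : (homAdj adj E).toMonad.Algebra)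
    (X : H) : (X ⟶ E) ⥤ (homAdj adj X).toMonad.Algebra where
  obj f := {
    A := f ≫ M.A
    a := (α_ f M.A l).hom ▷ r ≫ (α_ f (M.A ≫ l) r).hom ≫ f ◁ M.a
    unit := precomp_unit adj.unit f M.A M.a M.unit
    assoc := precomp_assoc adj.counit f M.A M.a M.assoc }
  map {f g} η := {
    f := η ▷ M.A
    h := precomp_hom η M.A M.a }
  map_id f := by
    ext
    exact id_whiskerRight f M.A
  map_comp η θ := by
    ext
    exact comp_whiskerRight η θ M.A

/-- An Eilenberg-Moore object of the monad induced by `l ⊣ r`, in the bicategorical sense: an object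
with a universal algebra, so that `X ⟶ E` is equivalent to the category of algebras on 1-cells
`X ⟶ y` via restriction of the universal algebra. -/
structure EMObject (adj : Bicategory.Adjunction l r) where
  /-- The object of algebras. -/
  obj : H
  /-- The universal algebra. -/
  alg : (homAdj adj obj).toMonad.Algebra
  isUniversal (X : H) : (algPrecomp adj alg X).IsEquivalence

namespace EMObject
variable {adj : Bicategory.Adjunction l r} (E : EMObject adj)

instance (X : H) : (algPrecomp adj E.alg X).IsEquivalence := E.isUniversal X

/-- The forgetful 1-cell. -/
def forget : E.obj ⟶ y := E.alg.A

/-- The Eilenberg-Moore comparison 1-cell: the one which corresponds to the canonical algebra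
`(id ≫ r, counit)`, up to isomorphism. -/
noncomputable def comparison : x ⟶ E.obj :=
  (algPrecomp adj E.alg x).inv.obj ((Monad.comparison (homAdj adj x)).obj (𝟙 x))

/-- The comparison 1-cell followed by the forgetful one is the right adjoint. -/
noncomputable def comparisonIso : E.comparison ≫ E.forget ≅ r :=
  (homAdj adj x).toMonad.forget.mapIso ((algPrecomp adj E.alg x).asEquivalence.counitIso.app
    ((Monad.comparison (homAdj adj x)).obj (𝟙 x))) ≪≫ λ_ r

/-- The Eilenberg-Moore factorization of `r`. -/
noncomputable def factorization : Factorization r where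
  mid := E.obj
  left := E.comparison
  right := E.forget
  iso := E.comparisonIso

end EMObject

/-- A monadic 1-cell: a right adjoint whose Eilenberg-Moore comparison is an equivalence. -/
def IsMonadic (r : x ⟶ y) : Prop :=
  ∃ (l : y ⟶ x) (adj : Bicategory.Adjunction l r) (E : EMObject adj), IsEquiv₁ E.comparison

/-- A premonadic 1-cell: a right adjoint whose comparison is fully faithful. -/
def IsPremonadic (r : x ⟶ y) : Prop :=
  ∃ (l : y ⟶ x) (adj : Bicategory.Adjunction l r) (E : EMObject adj),
    IsFullyFaithful₁ E.comparison

/-- An almost monadic 1-cell: a right adjoint whose comparison is faithful. -/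
def IsAlmostMonadic (r : x ⟶ y) : Prop :=
  ∃ (l : y ⟶ x) (adj : Bicategory.Adjunction l r) (E : EMObject adj), IsFaithful₁ E.comparison

end EM

section BeckChevalley

variable {H : Type u} [Bicategory.{w, v} H]

/-- A 2-cell in a square with left adjoints to the two parallel sides `r₁`, `r₂` satisfies the
Beck-Chevalley condition if its mate `g ≫ l₂ ⟶ l₁ ≫ h` is invertible. -/
def SquareBeckChevalley {x y x' y' : H} {l₁ : y ⟶ x} {r₁ : x ⟶ y} {l₂ : y' ⟶ x'} {r₂ : x' ⟶ y'}
    (adj₁ : Bicategory.Adjunction l₁ r₁) (adj₂ : Bicategory.Adjunction l₂ r₂) {g : y ⟶ y'}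
    {h : x ⟶ x'} (θ : r₁ ≫ g ⟶ h ≫ r₂) : Prop :=
  IsIso ((mateEquiv adj₁ adj₂).symm θ)

/-- A pseudonatural transformation satisfies the Beck-Chevalley condition if its components have
left adjoints and all its naturality squares satisfy the Beck-Chevalley condition. -/
def BeckChevalley {B : Type u₁} [Bicategory.{w₁, v₁} B] {F G : B ⥤ᵖ H} (α : F ⟶ G) : Prop :=
  ∃ (l : ∀ b, G.obj b ⟶ F.obj b) (adj : ∀ b, Bicategory.Adjunction (l b) (α.app b)),
    ∀ {b c : B} (f : b ⟶ c), SquareBeckChevalley (adj b) (adj c) (α.naturality f).inv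

end BeckChevalley

section Cosimplicial

variable {H : Type u} [Bicategory.{w, v} H]

/-- The inclusion `j`, between locally discrete bicategories. -/
def jP : LocallyDiscrete SimplexCategory ⥤ᵖ LocallyDiscrete FinOrd :=
  FinOrd.j.toPseudofunctor

/-- The décalage transformation `Suc^A : A ⟶ A ∘ Suc`, with components `A(d⁰)`. -/
def sucTrans (A : LocallyDiscrete FinOrd ⥤ᵖ H) : A ⟶ FinOrd.suc.toPseudofunctor.comp A :=
  unitTrans FinOrd.d0 A

/-- The shift property: `A ∘ Suc` is of effective `j`-descent. -/
def ShiftProperty (A : LocallyDiscrete FinOrd ⥤ᵖ H) : Prop :=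
  IsEffectiveDescent jP (FinOrd.suc.toPseudofunctor.comp A)

/-- The `j`-descent factorization of `A(d) : A(0) ⟶ A(1)`. -/
noncomputable def descentFactorization (A : LocallyDiscrete FinOrd ⥤ᵖ H)
    (K : RightPsKan jP (jP.comp A)) : Factorization (A.map FinOrd.d.toLoc) :=
  K.factorization (x := ⟨FinOrd.zero⟩) (b := ⟨SimplexCategory.mk 0⟩) FinOrd.d.toLoc

end Cosimplicial

section Classical

open Opposite Limits

universe v' u'

variable {C : Type u} [Category.{v} C] (F : LocallyDiscrete Cᵒᵖ ⥤ᵖ Cat.{v', u'})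

/-- All `F(p)` have left adjoints, and for all `p : E ⟶ B` the invertible 2-cell
`F(π₁) F(p) ≅ F(π₂) F(p)` of the kernel pair of `p` satisfies the Beck-Chevalley condition. -/
def KernelPairBeckChevalley [HasPullbacks C] : Prop :=
  ∃ (l : ∀ {E B : C} (_ : E ⟶ B), F.obj ⟨op E⟩ ⟶ F.obj ⟨op B⟩)
    (adj : ∀ {E B : C} (p : E ⟶ B), Bicategory.Adjunction (l p) (F.map p.op.toLoc)),
    ∀ {E B : C} (p : E ⟶ B),
      SquareBeckChevalley (adj p) (adj (pullback.snd p p))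
        (F.isoMapOfCommSq (t := p.op.toLoc) (l := p.op.toLoc)
          (r := (pullback.fst p p).op.toLoc) (b := (pullback.snd p p).op.toLoc)
          ⟨congrArg (fun q => q.op.toLoc) (pullback.condition (f := p) (g := p))⟩).hom

variable {E B : C} {p : E ⟶ B} (sq : ChosenPullback p p) (sq₃ : ChosenPullback₃ sq sq sq)

/-- The category of classical descent data for `F` relative to `p`: objects `x` of `F(E)` with a
gluing morphism `F(π₁) x ⟶ F(π₂) x` over `E ×_B E` satisfying the unit and cocycle conditions. -/
abbrev Desc : Type _ :=
  F.DescentData' (ι := Unit) (f := fun _ => p) (fun _ _ => sq) (fun _ _ _ => sq₃)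

/-- The comparison functor `F(B) ⥤ Desc`. -/
noncomputable def toDesc : F.obj ⟨op B⟩ ⥤ Desc F sq sq₃ :=
  F.toDescentData (fun _ : Unit => p) ⋙ Pseudofunctor.DescentData'.fromDescentDataFunctor F _ _

/-- The forgetful functor `Desc ⥤ F(E)`. Following the comparison functor, it gives `F(p)`. -/
def descForget : Desc F sq sq₃ ⥤ F.obj ⟨op E⟩ where
  obj D := D.obj ()
  map φ := φ.hom ()

end Classical

end FormalDescent

/-! Write `d^*` for the functor attached to `d`, let `L ⊣ d^*`, `T = d^* L`, and let `w`, `w'`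
satisfy `d ≫ w = d ≫ w'`. A morphism `f : T x ⟶ y` glues to `w^* x ⟶ w^* d^* L x ≅ w'^* d^* L x ⟶
w'^* y`. Transposed along the left adjoint of `w'^*`, this is precomposition of `f` with the
Beck–Chevalley mate `w'_! w^* ⟶ d^* L`. So the condition says exactly that gluing is a bijection
from morphisms `T x ⟶ y` to morphisms `w^* x ⟶ w'^* y` (`SquareBeckChevalley.bijective_cat`,
`SquareBeckChevalley.bijective`).

Hence an action `T x ⟶ x` is the same as a gluing morphism `w^* x ⟶ w'^* x`. The unit law matches
the unit condition by transport along the codegeneracy. Associativity matches the cocycle condition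
because a morphism out of `T T x` is also determined by its composite gluing morphism at the triple
stage; this takes two Beck–Chevalley squares, that of `d` and that of `w'`
(`GlueBijective.injective₂`). Thus algebras are descent data (`GlueBijective.exists_algebra`,
`GlueBijective.algebraHom`). The argument is carried out in a `CatSystem`, so that it serves
category-valued pseudofunctors and the hom-categories `H(X, A(-))` alike. For the classical theorem
it remains to see that the canonical algebras glue to the canonical descent data, which is a
triangle identity (`glue_counit`).

For the formal theorem, the pointwise universal property is tested on representables. By the Yoneda
argument, 1-cells from `X` to the value of the Kan extension at `0` amount to coherent families of
1-cells from `X` indexed by the nonempty ordinals (`PseudoCone.hom_ext`, `PseudoCone.exists_hom`,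
`PseudoCone.exists_obj`). Since every simplex has vertices and ordered vertices span edges, such a
family amounts to its value at the one-element ordinal with a gluing morphism along the edge, that
is, to an algebra. The family of the identity 1-cell gives an algebra on the Kan extension at `0`,
and this algebra is universal (`algPrecomp_isEquivalence`). So that object is an Eilenberg–Moore
object. Uniqueness of these, together with the fact that the descent comparison classifies the
canonical algebra (`compatible_comparison`), identifies the factorizations
(`EMObject.factorization_isEquivalent`).

Descent and almost descent concern only the component at `0` and are now immediate. For effective
descent, the components at nonempty ordinals are always equivalences because `j` is fully faithful,
and a pseudonatural transformation whose components are equivalences is an equivalence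
(`comparison_isEquiv₁`, `isEquiv₁_of_app`). -/

set_option linter.checkUnivs false
-- Gluing morphisms in families of categories, and algebras as gluing data.
namespace FormalDescent

/-- A family of categories indexed by a category `J`, functorial up to coherent isomorphism. -/
structure CatSystem (J : Type u₁) [Category.{v₁} J] where
  /-- The categories. -/
  obj : J → Type u
  [cat : ∀ a, Category.{v} (obj a)]
  /-- The transition functors. -/
  map {a b : J} (f : a ⟶ b) : obj a ⥤ obj b
  /-- The composition constraints. -/
  comp {a b c : J} (f : a ⟶ b) (g : b ⟶ c) (h : a ⟶ c) (w : f ≫ g = h) : map f ⋙ map g ≅ map h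
  /-- The unit constraints. -/
  id (a : J) : map (𝟙 a) ≅ 𝟭 (obj a)
  assoc {a b c e : J} (f : a ⟶ b) (g : b ⟶ c) (h : c ⟶ e) (fg : a ⟶ c) (gh : b ⟶ e) (k : a ⟶ e)
    (hfg : f ≫ g = fg) (hgh : g ≫ h = gh) (hk : fg ≫ h = k) (x : obj a) :
    (map h).map ((comp f g fg hfg).hom.app x) ≫ (comp fg h k hk).hom.app x =
      (comp g h gh hgh).hom.app ((map f).obj x) ≫
        (comp f gh k (by rw [← hgh, ← Category.assoc, hfg, hk])).hom.app x

attribute [instance] CatSystem.cat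

namespace CatSystem
variable {J : Type u₁} [Category.{v₁} J] (P : CatSystem.{v, u} J)

/-- The composition constraint at an object. -/
def γ {a b c : J} (f : a ⟶ b) (g : b ⟶ c) (h : a ⟶ c) (w : f ≫ g = h) (x : P.obj a) :
    (P.map g).obj ((P.map f).obj x) ≅ (P.map h).obj x :=
  (P.comp f g h w).app x

@[simp]
theorem γ_hom_naturality {a b c : J} (f : a ⟶ b) (g : b ⟶ c) (h : a ⟶ c) (w : f ≫ g = h)
    {x y : P.obj a} (t : x ⟶ y) :
    (P.map g).map ((P.map f).map t) ≫ (P.γ f g h w y).hom =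
      (P.γ f g h w x).hom ≫ (P.map h).map t :=
  (P.comp f g h w).hom.naturality t

@[simp]
theorem γ_hom_naturality_assoc {a b c : J} (f : a ⟶ b) (g : b ⟶ c) (h : a ⟶ c) (w : f ≫ g = h)
    {x y : P.obj a} (t : x ⟶ y) {z : P.obj c} (q : (P.map h).obj y ⟶ z) :
    (P.map g).map ((P.map f).map t) ≫ (P.γ f g h w y).hom ≫ q =
      (P.γ f g h w x).hom ≫ (P.map h).map t ≫ q := by
  rw [← Category.assoc, γ_hom_naturality, Category.assoc]

theorem γ_inv_naturality {a b c : J} (f : a ⟶ b) (g : b ⟶ c) (h : a ⟶ c) (w : f ≫ g = h)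
    {x y : P.obj a} (t : x ⟶ y) :
    (P.map h).map t ≫ (P.γ f g h w y).inv =
      (P.γ f g h w x).inv ≫ (P.map g).map ((P.map f).map t) :=
  (P.comp f g h w).inv.naturality t

variable {a b c n : J}

theorem γ_assoc {e : J} (f : a ⟶ b) (g : b ⟶ c) (h : c ⟶ e) (fg : a ⟶ c) (gh : b ⟶ e) (k : a ⟶ e)
    (hfg : f ≫ g = fg) (hgh : g ≫ h = gh) (hk : fg ≫ h = k) (hk' : f ≫ gh = k) (x : P.obj a) :
    (P.map h).map (P.γ f g fg hfg x).hom ≫ (P.γ fg h k hk x).hom =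
      (P.γ g h gh hgh ((P.map f).obj x)).hom ≫ (P.γ f gh k hk' x).hom :=
  P.assoc f g h fg gh k hfg hgh hk x

theorem map_γ_hom {e : J} (f : a ⟶ b) (g : b ⟶ c) (h : c ⟶ e) (fg : a ⟶ c) (gh : b ⟶ e) (k : a ⟶ e)
    (hfg : f ≫ g = fg) (hgh : g ≫ h = gh) (hk : fg ≫ h = k) (hk' : f ≫ gh = k) (x : P.obj a) :
    (P.map h).map (P.γ f g fg hfg x).hom =
      (P.γ g h gh hgh ((P.map f).obj x)).hom ≫ (P.γ f gh k hk' x).hom ≫ (P.γ fg h k hk x).inv := by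
  rw [← reassoc_of% P.γ_assoc f g h fg gh k hfg hgh hk hk' x, Iso.hom_inv_id, Category.comp_id]

theorem map_γ_inv {e : J} (f : a ⟶ b) (g : b ⟶ c) (h : c ⟶ e) (fg : a ⟶ c) (gh : b ⟶ e) (k : a ⟶ e)
    (hfg : f ≫ g = fg) (hgh : g ≫ h = gh) (hk : fg ≫ h = k) (hk' : f ≫ gh = k) (x : P.obj a) :
    (P.map h).map (P.γ f g fg hfg x).inv =
      (P.γ fg h k hk x).hom ≫ (P.γ f gh k hk' x).inv ≫ (P.γ g h gh hgh ((P.map f).obj x)).inv := by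
  rw [← cancel_mono ((P.map h).map (P.γ f g fg hfg x).hom), ← Functor.map_comp,
    P.map_γ_hom f g h fg gh k hfg hgh hk hk' x]
  simp

instance (a : J) : (P.map (𝟙 a)).Faithful := Functor.Faithful.of_iso (P.id a).symm

instance (a : J) : (P.map (𝟙 a)).Full := Functor.Full.of_iso (P.id a).symm

/-- Transport of a morphism between images of objects along a further transition functor. -/
def pull {w₀ w₁ : a ⟶ b} {x y : P.obj a} (φ : (P.map w₀).obj x ⟶ (P.map w₁).obj y) (s : b ⟶ c)
    (t₀ t₁ : a ⟶ c) (h₀ : w₀ ≫ s = t₀) (h₁ : w₁ ≫ s = t₁) :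
    (P.map t₀).obj x ⟶ (P.map t₁).obj y :=
  (P.γ w₀ s t₀ h₀ x).inv ≫ (P.map s).map φ ≫ (P.γ w₁ s t₁ h₁ y).hom

section Canonical
variable (d : a ⟶ b)

/-- The canonical isomorphism between images of an object coming from `a`. -/
def can (w w' : b ⟶ n) (h : d ≫ w = d ≫ w') (m : P.obj a) :
    (P.map w).obj ((P.map d).obj m) ≅ (P.map w').obj ((P.map d).obj m) :=
  P.γ d w (d ≫ w) rfl m ≪≫ (P.γ d w' (d ≫ w) h.symm m).symm

variable {d}

theorem can_eq (w w' : b ⟶ n) (k : a ⟶ n) (h : d ≫ w = k) (h' : d ≫ w' = k) (m : P.obj a) :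
    P.can d w w' (h.trans h'.symm) m = P.γ d w k h m ≪≫ (P.γ d w' k h' m).symm := by
  subst h
  rfl

theorem can_naturality (w w' : b ⟶ n) (h : d ≫ w = d ≫ w') {m m' : P.obj a} (t : m ⟶ m') :
    (P.map w).map ((P.map d).map t) ≫ (P.can d w w' h m').hom =
      (P.can d w w' h m).hom ≫ (P.map w').map ((P.map d).map t) := by
  simp [can, γ_inv_naturality]

theorem can_naturality_assoc (w w' : b ⟶ n) (h : d ≫ w = d ≫ w') {m m' : P.obj a} (t : m ⟶ m')
    {z : P.obj n} (q : (P.map w').obj ((P.map d).obj m') ⟶ z) :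
    (P.map w).map ((P.map d).map t) ≫ (P.can d w w' h m').hom ≫ q =
      (P.can d w w' h m).hom ≫ (P.map w').map ((P.map d).map t) ≫ q := by
  rw [← Category.assoc, can_naturality, Category.assoc]

@[simp]
theorem can_self (w : b ⟶ n) (m : P.obj a) : (P.can d w w rfl m).hom = 𝟙 _ := by
  simp [can]

@[simp]
theorem can_trans (w w' w'' : b ⟶ n) (h : d ≫ w = d ≫ w') (h' : d ≫ w' = d ≫ w'') (m : P.obj a) :
    (P.can d w w' h m).hom ≫ (P.can d w' w'' h' m).hom = (P.can d w w'' (h.trans h') m).hom := by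
  rw [P.can_eq w w' _ rfl h.symm, P.can_eq w' w'' (d ≫ w) h.symm (h.trans h').symm,
    P.can_eq w w'' _ rfl (h.trans h').symm]
  simp

@[simp]
theorem can_trans_assoc (w w' w'' : b ⟶ n) (h : d ≫ w = d ≫ w') (h' : d ≫ w' = d ≫ w'')
    (m : P.obj a) {z : P.obj n} (q : (P.map w'').obj ((P.map d).obj m) ⟶ z) :
    (P.can d w w' h m).hom ≫ (P.can d w' w'' h' m).hom ≫ q =
      (P.can d w w'' (h.trans h') m).hom ≫ q := by
  rw [← Category.assoc, can_trans]

/-- Coherence: canonical isomorphisms consist of composition constraints only, so transporting them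
gives canonical isomorphisms again. -/
theorem pull_can {w w' : b ⟶ c} (h : d ≫ w = d ≫ w') (m : P.obj a) (s : c ⟶ n) (t t' : b ⟶ n)
    (ht : w ≫ s = t) (ht' : w' ≫ s = t') :
    P.pull (P.can d w w' h m).hom s t t' ht ht' =
      (P.can d t t' (by rw [← ht, ← ht', reassoc_of% h]) m).hom := by
  subst ht ht'
  rw [P.can_eq (w ≫ s) (w' ≫ s) ((d ≫ w) ≫ s) (by simp) (by simp [h])]
  simp only [pull, can, Iso.trans_hom, Iso.symm_hom, Functor.map_comp, Category.assoc]
  rw [P.map_γ_hom d w s (d ≫ w) (w ≫ s) ((d ≫ w) ≫ s) rfl rfl rfl (by simp),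
    P.map_γ_inv d w' s (d ≫ w) (w' ≫ s) ((d ≫ w) ≫ s) h.symm rfl rfl (by simp [h])]
  simp

end Canonical

section Pull

@[simp]
theorem pull_comp {w₀ w₁ w₂ : a ⟶ b} {x y z : P.obj a} (φ : (P.map w₀).obj x ⟶ (P.map w₁).obj y)
    (ψ : (P.map w₁).obj y ⟶ (P.map w₂).obj z) (s : b ⟶ c)
    (t₀ t₁ t₂ : a ⟶ c) (h₀ : w₀ ≫ s = t₀) (h₁ : w₁ ≫ s = t₁) (h₂ : w₂ ≫ s = t₂) :
    P.pull φ s t₀ t₁ h₀ h₁ ≫ P.pull ψ s t₁ t₂ h₁ h₂ = P.pull (φ ≫ ψ) s t₀ t₂ h₀ h₂ := by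
  simp [pull]

theorem pull_map {w₀ : a ⟶ b} {x y : P.obj a} (t : x ⟶ y) (s : b ⟶ c)
    (t₀ : a ⟶ c) (h₀ : w₀ ≫ s = t₀) :
    P.pull ((P.map w₀).map t) s t₀ t₀ h₀ h₀ = (P.map t₀).map t := by
  simp [pull]

theorem map_eq_pull {w₀ w₁ : a ⟶ b} {x y : P.obj a} (φ : (P.map w₀).obj x ⟶ (P.map w₁).obj y)
    (s : b ⟶ c) (t₀ t₁ : a ⟶ c) (h₀ : w₀ ≫ s = t₀) (h₁ : w₁ ≫ s = t₁) :
    (P.map s).map φ = (P.γ w₀ s t₀ h₀ x).hom ≫ P.pull φ s t₀ t₁ h₀ h₁ ≫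
      (P.γ w₁ s t₁ h₁ y).inv := by
  simp [pull]

end Pull

section Glue
variable {d : a ⟶ b} {L : P.obj b ⥤ P.obj a} (adj : L ⊣ P.map d)

/-- The gluing morphism determined by a morphism out of `d^* L x`. -/
def glue (w w' : b ⟶ n) (h : d ≫ w = d ≫ w') {x y : P.obj b} (f : (P.map d).obj (L.obj x) ⟶ y) :
    (P.map w).obj x ⟶ (P.map w').obj y :=
  (P.map w).map (adj.unit.app x) ≫ (P.can d w w' h (L.obj x)).hom ≫ (P.map w').map f

theorem map_glue (w w' : b ⟶ n) (h : d ≫ w = d ≫ w') {x x' y : P.obj b} (t : x' ⟶ x)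
    (f : (P.map d).obj (L.obj x) ⟶ y) :
    (P.map w).map t ≫ P.glue adj w w' h f =
      P.glue adj w w' h ((P.map d).map (L.map t) ≫ f) := by
  have e := adj.unit.naturality t
  dsimp at e
  rw [glue, ← Functor.map_comp_assoc, e, Functor.map_comp_assoc, can_naturality_assoc, glue,
    Functor.map_comp]

@[simp]
theorem glue_map (w w' : b ⟶ n) (h : d ≫ w = d ≫ w') {x y y' : P.obj b}
    (f : (P.map d).obj (L.obj x) ⟶ y) (t : y ⟶ y') :
    P.glue adj w w' h f ≫ (P.map w').map t = P.glue adj w w' h (f ≫ t) := by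
  simp [glue]

theorem glue_map_assoc (w w' : b ⟶ n) (h : d ≫ w = d ≫ w') {x y y' : P.obj b}
    (f : (P.map d).obj (L.obj x) ⟶ y) (t : y ⟶ y') {z : P.obj n} (q : (P.map w').obj y' ⟶ z) :
    P.glue adj w w' h f ≫ (P.map w').map t ≫ q = P.glue adj w w' h (f ≫ t) ≫ q := by
  rw [← Category.assoc, glue_map]

theorem glue_self (w : b ⟶ n) {x y : P.obj b} (f : (P.map d).obj (L.obj x) ⟶ y) :
    P.glue adj w w rfl f = (P.map w).map (adj.unit.app x ≫ f) := by
  simp [glue]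

/-- Transport preserves each of the three factors of a gluing morphism. So a single `f` governs the
gluing at all later stages, and identities can be moved between double and triple stages. -/
theorem pull_glue {w w' : b ⟶ c} (h : d ≫ w = d ≫ w') {x y : P.obj b}
    (f : (P.map d).obj (L.obj x) ⟶ y) (s : c ⟶ n) (t t' : b ⟶ n)
    (ht : w ≫ s = t) (ht' : w' ≫ s = t') :
    P.pull (P.glue adj w w' h f) s t t' ht ht' =
      P.glue adj t t' (by rw [← ht, ← ht', reassoc_of% h]) f := by
  rw [glue, ← P.pull_comp _ _ s t t t' ht ht ht', ← P.pull_comp _ _ s t t' t' ht ht' ht',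
    pull_map, pull_map, pull_can, glue]

theorem glue_can (w w' w'' : b ⟶ n) (h : d ≫ w = d ≫ w') (h' : d ≫ w' = d ≫ w'') {x : P.obj b}
    {m : P.obj a} (f : L.obj x ⟶ m) :
    P.glue adj w w' h ((P.map d).map f) ≫ (P.can d w' w'' h' m).hom =
      P.glue adj w w'' (h.trans h') ((P.map d).map f) := by
  simp [glue, can_naturality]

/-- The gluing morphism of an action of the counit is the canonical isomorphism. -/
theorem glue_counit (w w' : b ⟶ n) (h : d ≫ w = d ≫ w') (m : P.obj a) :
    P.glue adj w w' h ((P.map d).map (adj.counit.app m)) = (P.can d w w' h m).hom := by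
  rw [glue, ← can_naturality, ← Functor.map_comp_assoc, adj.right_triangle_components,
    CategoryTheory.Functor.map_id]
  exact Category.id_comp _

/-- The counit glues to a canonical isomorphism, and canonical isomorphisms compose. This is the
multiplication side of the associativity law, seen at the triple stage. -/
theorem glue_glue_mul (w w' w'' : b ⟶ n) (h : d ≫ w = d ≫ w') (h' : d ≫ w' = d ≫ w'')
    {x y : P.obj b} (f : (P.map d).obj (L.obj x) ⟶ y) :
    P.glue adj w w' h (𝟙 _) ≫
        P.glue adj w' w'' h' ((P.map d).map (adj.counit.app (L.obj x)) ≫ f) =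
      P.glue adj w w'' (h.trans h') f := by
  rw [← glue_map, glue_counit, glue, glue]
  simp

/-- By naturality `f` slides into the second factor. The composite takes the shape to which
`GlueInjective₂` applies, with the other side `T f ≫ g` of the associativity law inside. -/
theorem glue_comp_glue (w w' w'' : b ⟶ n) (h : d ≫ w = d ≫ w') (h' : d ≫ w' = d ≫ w'')
    {x y z : P.obj b} (f : (P.map d).obj (L.obj x) ⟶ y) (g : (P.map d).obj (L.obj y) ⟶ z) :
    P.glue adj w w' h f ≫ P.glue adj w' w'' h' g =
      P.glue adj w w' h (𝟙 _) ≫ P.glue adj w' w'' h' ((P.map d).map (L.map f) ≫ g) := by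
  rw [← map_glue, glue_map_assoc, Category.id_comp]

/-- Gluing morphisms of type `(w, w')` correspond to morphisms out of `d^* L x`. -/
def GlueBijective (w w' : b ⟶ n) (h : d ≫ w = d ≫ w') : Prop :=
  ∀ x y : P.obj b, Function.Bijective
    fun f : (P.map d).obj (L.obj x) ⟶ y => P.glue adj w w' h f

/-- Morphisms out of `d^* L d^* L x` are determined by their composite gluing morphisms. -/
def GlueInjective₂ (w w' w'' : b ⟶ n) (h : d ≫ w = d ≫ w') (h' : d ≫ w' = d ≫ w'') : Prop :=
  ∀ x y : P.obj b, Function.Injective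
    fun f : (P.map d).obj (L.obj ((P.map d).obj (L.obj x))) ⟶ y =>
      P.glue adj w w' h (𝟙 _) ≫ P.glue adj w' w'' h' f

variable {P adj}

/-- Left adjoints are unique up to isomorphism, so bijectivity does not depend on the one supplied
by the Beck–Chevalley condition. -/
theorem GlueBijective.of_adjunction {w w' : b ⟶ n} {h : d ≫ w = d ≫ w'}
    (H : P.GlueBijective adj w w' h) {L' : P.obj b ⥤ P.obj a} (adj' : L' ⊣ P.map d) :
    P.GlueBijective adj' w w' h := by
  intro x y
  let e := (adj.leftAdjointUniq adj').app x
  have he : adj.unit.app x ≫ (P.map d).map e.hom = adj'.unit.app x := by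
    simp [e]
  have hg : (fun f => P.glue adj' w w' h f) =
      (fun f : (P.map d).obj (L.obj x) ⟶ y => P.glue adj w w' h f) ∘
        fun f : (P.map d).obj (L'.obj x) ⟶ y => (P.map d).map e.hom ≫ f := by
    funext f
    dsimp only [Function.comp]
    rw [glue, glue, ← he, Functor.map_comp_assoc, Functor.map_comp, ← can_naturality_assoc]
  rw [hg]
  refine (H x y).comp ⟨fun f g hfg => (cancel_epi _).1 hfg, fun g => ⟨(P.map d).map e.inv ≫ g, by simp⟩⟩

theorem GlueBijective.of_iso {w w' : b ⟶ c} {h : d ≫ w = d ≫ w'}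
    (H : P.GlueBijective adj w w' h) (s : c ≅ n) (t t' : b ⟶ n) (ht : w ≫ s.hom = t)
    (ht' : w' ≫ s.hom = t') :
    P.GlueBijective adj t t' (by rw [← ht, ← ht', reassoc_of% h]) := by
  have h1 : t ≫ s.inv = w := by simp [← ht]
  have h2 : t' ≫ s.inv = w' := by simp [← ht']
  intro x y
  refine ⟨fun f g hfg => (H x y).1 ?_, fun φ => ?_⟩
  · have := congrArg (fun q => P.pull q s.inv w w' h1 h2) hfg
    simpa only [pull_glue] using this
  · obtain ⟨f, hf⟩ := (H x y).2 (P.pull φ s.inv w w' h1 h2)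
    refine ⟨f, ?_⟩
    -- Equality is tested after transport back along `s`; this loses nothing, since following with
    -- `s.hom` is isomorphic to transport along an identity.
    have hs : (P.map s.inv).Faithful := by
      have : (P.map s.inv ⋙ P.map s.hom).Faithful :=
        Functor.Faithful.of_iso ((P.comp s.inv s.hom (𝟙 n) (by simp)).symm)
      exact Functor.Faithful.of_comp (P.map s.inv) (P.map s.hom)
    apply hs.map_injective
    rw [P.map_eq_pull _ s.inv w w' h1 h2, P.map_eq_pull φ s.inv w w' h1 h2, pull_glue]
    dsimp only at hf
    rw [hf]

/-- An equality at an earlier stage can be transported along `s` to the stage where injectivity is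
known. Only a map is needed, not an isomorphism of triple overlaps. -/
theorem GlueInjective₂.of_map {w w' w'' : b ⟶ n} {h : d ≫ w = d ≫ w'} {h' : d ≫ w' = d ≫ w''}
    (H : P.GlueInjective₂ adj w w' w'' h h') {k : J} (s : k ⟶ n) (t t' t'' : b ⟶ k)
    (ht : t ≫ s = w) (ht' : t' ≫ s = w') (ht'' : t'' ≫ s = w'') (e : d ≫ t = d ≫ t')
    (e' : d ≫ t' = d ≫ t'') :
    P.GlueInjective₂ adj t t' t'' e e' := by
  intro x y f g hfg
  apply H x y
  have := congrArg (fun q => P.pull q s w w'' ht ht'') hfg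
  simpa only [← P.pull_comp _ _ s w w' w'' ht ht' ht'', pull_glue] using this

/-- The first square identifies `L' w₀^* x` with `d^* L x` through `β`. With this identification,
the composite of two gluing morphisms is one gluing morphism for the second square, applied to a
morphism that already contains the gluing of `f` for the first square. Injectivity for the two
squares in turn recovers `f`. -/
theorem GlueBijective.injective₂ {w₀ w₁ : b ⟶ c} {h : d ≫ w₀ = d ≫ w₁}
    (H : P.GlueBijective adj w₀ w₁ h) {L' : P.obj c ⥤ P.obj b} {adj' : L' ⊣ P.map w₁}
    {s₀ s₁ : c ⟶ n} {h' : w₁ ≫ s₀ = w₁ ≫ s₁} (H' : P.GlueBijective adj' s₀ s₁ h')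
    (t₀ t₁ t₂ : b ⟶ n) (h₀ : w₀ ≫ s₀ = t₀) (h₁ : w₀ ≫ s₁ = t₁) (h₂ : w₁ ≫ s₀ = t₂)
    (h₀₁ : d ≫ t₀ = d ≫ t₁) (h₁₂ : d ≫ t₁ = d ≫ t₂) :
    P.GlueInjective₂ adj t₀ t₁ t₂ h₀₁ h₁₂ := by
  have h₂' : w₁ ≫ s₁ = t₂ := h'.symm.trans h₂
  intro x y f f' hf
  let β : L'.obj ((P.map w₀).obj x) ⟶ (P.map d).obj (L.obj x) :=
    (adj'.homEquiv _ _).symm (P.glue adj w₀ w₁ h (𝟙 _))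
  have hβ : adj'.unit.app _ ≫ (P.map w₁).map β = P.glue adj w₀ w₁ h (𝟙 _) := by
    exact (adj'.homEquiv_unit ..).symm.trans (Equiv.apply_symm_apply _ _)
  -- By the Yoneda lemma: precomposition with `β`, transposed, is the gluing bijection of the first
  -- square.
  have hβi : IsIso β := by
    rw [isIso_iff_coyoneda_map_bijective]
    intro z
    have hz : ((adj'.homEquiv _ z) ∘ fun q => β ≫ q) =
        fun q : (P.map d).obj (L.obj x) ⟶ z => P.glue adj w₀ w₁ h q := by
      funext q
      dsimp only [Function.comp]
      rw [adj'.homEquiv_unit, Functor.map_comp, reassoc_of% hβ, glue_map, Category.id_comp]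
    exact (Function.Bijective.of_comp_iff' (adj'.homEquiv _ z).bijective _).1
      (hz ▸ H x z)
  -- the gluing morphism of `β ≫ k` along the second square
  have key : ∀ g : (P.map d).obj (L.obj ((P.map d).obj (L.obj x))) ⟶ y,
      P.glue adj' s₀ s₁ h' ((P.map w₁).map β ≫ (P.can d w₁ w₀ h.symm _).hom ≫
        P.glue adj w₀ w₁ h g) =
      (P.γ w₀ s₀ t₀ h₀ x).hom ≫ (P.glue adj t₀ t₁ h₀₁ (𝟙 _) ≫ P.glue adj t₁ t₂ h₁₂ g) ≫
        (P.γ w₁ s₁ t₂ h₂' y).inv := by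
    intro g
    rw [glue, Functor.map_comp, ← can_naturality_assoc, ← Functor.map_comp_assoc, hβ,
      P.map_eq_pull (P.glue adj w₀ w₁ h (𝟙 _)) s₀ t₀ t₂ h₀ h₂, pull_glue,
      P.map_eq_pull _ s₁ t₂ t₂ h₂' h₂', P.can_eq s₀ s₁ t₂ h₂ h₂',
      ← P.pull_comp _ _ s₁ t₂ t₁ t₂ h₂' h₁ h₂', pull_can, pull_glue]
    simp only [Category.assoc, Iso.trans_hom, Iso.symm_hom, Iso.inv_hom_id_assoc]
    have e := P.glue_can adj t₀ t₂ t₁ (h₀₁.trans h₁₂) h₁₂.symm (𝟙 (L.obj x))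
    rw [CategoryTheory.Functor.map_id] at e
    rw [reassoc_of% e]
  have e := (H' _ _).1 (((key f).trans (by dsimp only at hf; rw [hf])).trans (key f').symm)
  rw [cancel_epi, cancel_epi] at e
  exact (H _ _).1 e

section Algebra
variable (P adj)

/-- The structure map of an algebra, with its domain in terms of the adjunction. -/
def act (N : adj.toMonad.Algebra) : (P.map d).obj (L.obj N.A) ⟶ N.A := N.a

@[simp]
theorem unit_act (N : adj.toMonad.Algebra) : adj.unit.app N.A ≫ P.act adj N = 𝟙 N.A := N.unit

theorem act_act (N : adj.toMonad.Algebra) :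
    (P.map d).map (L.map (P.act adj N)) ≫ P.act adj N =
      (P.map d).map (adj.counit.app (L.obj N.A)) ≫ P.act adj N :=
  N.assoc.symm

/-- The gluing morphism of an algebra is a cocycle. -/
theorem glue_act_comp (N : adj.toMonad.Algebra) (w w' w'' : b ⟶ n) (h : d ≫ w = d ≫ w')
    (h' : d ≫ w' = d ≫ w'') :
    P.glue adj w w' h (P.act adj N) ≫ P.glue adj w' w'' h' (P.act adj N) =
      P.glue adj w w'' (h.trans h') (P.act adj N) := by
  rw [glue_comp_glue, ← P.glue_glue_mul adj w w' w'' h h', act_act]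

theorem glue_act_self (N : adj.toMonad.Algebra) (w : b ⟶ n) :
    P.glue adj w w rfl (P.act adj N) = 𝟙 _ := by
  rw [glue_self, unit_act]
  exact (P.map w).map_id _

/-- The gluing morphism of an algebra is invertible. -/
@[simps]
def glueIso (N : adj.toMonad.Algebra) (w w' : b ⟶ n) (h : d ≫ w = d ≫ w') :
    (P.map w).obj N.A ≅ (P.map w').obj N.A where
  hom := P.glue adj w w' h (P.act adj N)
  inv := P.glue adj w' w h.symm (P.act adj N)
  hom_inv_id := by rw [glue_act_comp, glue_act_self]
  inv_hom_id := by rw [glue_act_comp, glue_act_self]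

variable {adj}

theorem algebraHom_act {N N' : adj.toMonad.Algebra} (f : N ⟶ N') :
    (P.map d).map (L.map f.f) ≫ P.act adj N' = P.act adj N ≫ f.f := f.h

theorem algebraHom_comm {N N' : adj.toMonad.Algebra} (f : N ⟶ N') (w w' : b ⟶ n)
    (h : d ≫ w = d ≫ w') :
    (P.map w).map f.f ≫ P.glue adj w w' h (P.act adj N') =
      P.glue adj w w' h (P.act adj N) ≫ (P.map w').map f.f := by
  rw [map_glue, glue_map, algebraHom_act]

variable {P}

/-- By naturality, the two sides of the compatibility with gluing are the gluing morphisms of the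
two sides of the algebra equation. -/
theorem GlueBijective.algebraHom {w w' : b ⟶ n} {h : d ≫ w = d ≫ w'}
    (H : P.GlueBijective adj w w' h) {N N' : adj.toMonad.Algebra} (f : N.A ⟶ N'.A)
    (hf : (P.map w).map f ≫ P.glue adj w w' h (P.act adj N') =
      P.glue adj w w' h (P.act adj N) ≫ (P.map w').map f) :
    (adj.toMonad : P.obj b ⥤ P.obj b).map f ≫ N'.a = N.a ≫ f := by
  rw [map_glue, glue_map] at hf
  exact (H _ _).1 hf

/-- The action is the unique morphism gluing to `φ`. Its unit law is the unit condition read through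
the faithful transport along an identity; its associativity is the cocycle condition read through
`H₂`. -/
theorem GlueBijective.exists_algebra {w₀ w₁ : b ⟶ c} {h : d ≫ w₀ = d ≫ w₁}
    (H : P.GlueBijective adj w₀ w₁ h) {t₀ t₁ t₂ : b ⟶ n} {h₀₁ : d ≫ t₀ = d ≫ t₁}
    {h₁₂ : d ≫ t₁ = d ≫ t₂} (H₂ : P.GlueInjective₂ adj t₀ t₁ t₂ h₀₁ h₁₂)
    (σ : c ⟶ b) (hσ₀ : w₀ ≫ σ = 𝟙 b) (hσ₁ : w₁ ≫ σ = 𝟙 b)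
    (s₀₁ s₁₂ s₀₂ : c ⟶ n) (e₀ : w₀ ≫ s₀₁ = t₀) (e₁ : w₁ ≫ s₀₁ = t₁) (e₁' : w₀ ≫ s₁₂ = t₁)
    (e₂ : w₁ ≫ s₁₂ = t₂) (e₀' : w₀ ≫ s₀₂ = t₀) (e₂' : w₁ ≫ s₀₂ = t₂)
    {x : P.obj b} (φ : (P.map w₀).obj x ⟶ (P.map w₁).obj x)
    (unit : P.pull φ σ (𝟙 b) (𝟙 b) hσ₀ hσ₁ = 𝟙 _)
    (cocycle : P.pull φ s₀₁ t₀ t₁ e₀ e₁ ≫ P.pull φ s₁₂ t₁ t₂ e₁' e₂ =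
      P.pull φ s₀₂ t₀ t₂ e₀' e₂') :
    ∃ α : (adj.toMonad : P.obj b ⥤ P.obj b).obj x ⟶ x, P.glue adj w₀ w₁ h α = φ ∧
      adj.toMonad.η.app x ≫ α = 𝟙 x ∧
      adj.toMonad.μ.app x ≫ α = (adj.toMonad : P.obj b ⥤ P.obj b).map α ≫ α := by
  obtain ⟨α, rfl⟩ := (H x x).2 φ
  refine ⟨α, rfl, ?_, ?_⟩
  · apply (P.map (𝟙 b)).map_injective
    rw [pull_glue, glue_self] at unit
    exact unit.trans (CategoryTheory.Functor.map_id _ _).symm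
  · apply H₂ x x
    dsimp only
    simp only [pull_glue] at cocycle
    rw [glue_comp_glue] at cocycle
    exact (P.glue_glue_mul adj t₀ t₁ t₂ h₀₁ h₁₂ α).trans cocycle.symm

end Algebra
end Glue
end CatSystem
end FormalDescent

/-! ### The Beck–Chevalley condition as bijectivity of gluing. -/

namespace FormalDescent

/-- The map is precomposition with the component of the mate at `a`, an isomorphism by hypothesis,
followed by transposition along `adj₂`. -/
theorem SquareBeckChevalley.bijective_cat {x y x' y' : Cat.{v, u}} {l₁ : y ⟶ x} {r₁ : x ⟶ y}
    {l₂ : y' ⟶ x'} {r₂ : x' ⟶ y'} {adj₁ : Bicategory.Adjunction l₁ r₁}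
    {adj₂ : Bicategory.Adjunction l₂ r₂} {g : y ⟶ y'} {h : x ⟶ x'} {θ : r₁ ≫ g ⟶ h ≫ r₂}
    (H : SquareBeckChevalley adj₁ adj₂ θ) (a : y) (z : x') :
    Function.Bijective fun f : h.toFunctor.obj (l₁.toFunctor.obj a) ⟶ z =>
      g.toFunctor.map (adj₁.unit.toNatTrans.app a) ≫
        θ.toNatTrans.app (l₁.toFunctor.obj a) ≫ r₂.toFunctor.map f := by
  let α := (mateEquiv adj₁ adj₂).symm θ
  have hα : IsIso α := H
  let m : l₂.toFunctor.obj (g.toFunctor.obj a) ≅ h.toFunctor.obj (l₁.toFunctor.obj a) :=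
    (Cat.Hom.toNatIso (asIso α)).app a
  have e := unit_mateEquiv (Adjunction.ofCat adj₁) (Adjunction.ofCat adj₂) α.toNatTrans a
  have eθ : θ.toNatTrans = (mateEquiv adj₁ adj₂ α).toNatTrans := by simp [α]
  rw [← toNatTrans_mateEquiv, ← eθ] at e
  have key : (fun f : h.toFunctor.obj (l₁.toFunctor.obj a) ⟶ z =>
      g.toFunctor.map (adj₁.unit.toNatTrans.app a) ≫
        θ.toNatTrans.app (l₁.toFunctor.obj a) ≫ r₂.toFunctor.map f) =
      ((Adjunction.ofCat adj₂).homEquiv _ _) ∘ (m.homCongr (Iso.refl z)).symm := by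
    funext f
    refine (Category.assoc _ _ _).symm.trans ((congrArg (· ≫ _) e).trans ?_)
    simp [CategoryTheory.Adjunction.homEquiv_unit, m]
  rw [key]
  exact (((Adjunction.ofCat adj₂).homEquiv _ _).bijective).comp (Equiv.bijective _)

section
variable {H : Type u} [Bicategory.{w, v} H]

/-- The same factorization for 1-cells out of `X`: whisker the invertible mate with `a`, then
transpose 2-cells along `adj₂`. -/
theorem SquareBeckChevalley.bijective {x y x' y' : H} {l₁ : y ⟶ x} {r₁ : x ⟶ y}
    {l₂ : y' ⟶ x'} {r₂ : x' ⟶ y'} {adj₁ : Bicategory.Adjunction l₁ r₁}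
    {adj₂ : Bicategory.Adjunction l₂ r₂} {g : y ⟶ y'} {h : x ⟶ x'} {θ : r₁ ≫ g ⟶ h ≫ r₂}
    (hθ : SquareBeckChevalley adj₁ adj₂ θ) {X : H} (a : X ⟶ y) (z : X ⟶ x') :
    Function.Bijective fun f : (a ≫ l₁) ≫ h ⟶ z =>
      ((ρ_ a).inv ≫ a ◁ adj₁.unit ≫ (α_ a l₁ r₁).inv) ▷ g ≫
        (α_ (a ≫ l₁) r₁ g).hom ≫ (a ≫ l₁) ◁ θ ≫ (α_ (a ≫ l₁) h r₂).inv ≫ f ▷ r₂ := by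
  let α := (mateEquiv adj₁ adj₂).symm θ
  have hα : IsIso α := hθ
  let m : (a ≫ g) ≫ l₂ ≅ (a ≫ l₁) ≫ h :=
    α_ a g l₂ ≪≫ whiskerLeftIso a (asIso α) ≪≫ (α_ a l₁ h).symm
  have key : (fun f : (a ≫ l₁) ≫ h ⟶ z =>
      ((ρ_ a).inv ≫ a ◁ adj₁.unit ≫ (α_ a l₁ r₁).inv) ▷ g ≫
        (α_ (a ≫ l₁) r₁ g).hom ≫ (a ≫ l₁) ◁ θ ≫ (α_ (a ≫ l₁) h r₂).inv ≫ f ▷ r₂) =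
      adj₂.homEquiv₂ ∘ (m.homCongr (Iso.refl z)).symm := by
    have hm : adj₂.homEquiv₂ m.hom =
        ((ρ_ a).inv ≫ a ◁ adj₁.unit ≫ (α_ a l₁ r₁).inv) ▷ g ≫
        (α_ (a ≫ l₁) r₁ g).hom ≫ (a ≫ l₁) ◁ θ ≫ (α_ (a ≫ l₁) h r₂).inv := by
      have hα' := (mateEquiv_eq_iff adj₁ adj₂ α θ).1 (by simp [α])
      rw [Adjunction.homEquiv₁_symm_apply, Adjunction.homEquiv₂_apply] at hα'
      rw [Adjunction.homEquiv₂_apply]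
      calc
        _ = 𝟙 _ ⊗≫ a ◁ (((ρ_ _).inv ≫ g ◁ adj₂.unit ≫ (α_ _ _ _).inv ≫ α ▷ r₂) ≫
              (α_ _ _ _).hom) ⊗≫ 𝟙 _ := by
          simp only [m, Iso.trans_hom, whiskerLeftIso_hom, asIso_hom, Iso.symm_hom]
          bicategory
        _ = _ := by
          rw [← hα']
          bicategory
    funext f
    have e : adj₂.homEquiv₂ (m.hom ≫ f) = adj₂.homEquiv₂ m.hom ≫ f ▷ r₂ := by
      simp [Adjunction.homEquiv₂_apply]
    rw [hm] at e
    simpa using e.symm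
  rw [key]
  exact adj₂.homEquiv₂.bijective.comp (Equiv.bijective _)

end

namespace CatSystem
variable {J : Type u₁} [Category.{v₁} J]

theorem toLoc_comp {a b c : J} {f : a ⟶ b} {g : b ⟶ c} {h : a ⟶ c} (w : f ≫ g = h) :
    f.toLoc ≫ g.toLoc = h.toLoc :=
  congrArg Quiver.Hom.toLoc w

/-- The family of categories of a category-valued pseudofunctor. -/
def ofCat (F : LocallyDiscrete J ⥤ᵖ Cat.{v, u}) : CatSystem.{v, u} J where
  obj a := F.obj ⟨a⟩
  map f := (F.map f.toLoc).toFunctor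
  comp f g h w := (Cat.Hom.toNatIso (F.mapComp' f.toLoc g.toLoc h.toLoc (toLoc_comp w))).symm
  id a := Cat.Hom.toNatIso (F.mapId ⟨a⟩)
  assoc f g h fg gh k hfg hgh hk x := by
    have := F.mapComp'_inv_whiskerRight_mapComp'₀₂₃_inv_app f.toLoc g.toLoc h.toLoc fg.toLoc
      gh.toLoc k.toLoc (toLoc_comp hfg) (toLoc_comp hgh) (toLoc_comp hk) x
    simpa using this

/-- The family of hom-categories out of an object. -/
def ofHom {H : Type u} [Bicategory.{w, v} H] (A : LocallyDiscrete J ⥤ᵖ H) (X : H) :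
    CatSystem.{w, v} J where
  obj a := X ⟶ A.obj ⟨a⟩
  map f := postcomp X (A.map f.toLoc)
  comp f g h w := NatIso.ofComponents (fun x => α_ x (A.map f.toLoc) (A.map g.toLoc) ≪≫
    whiskerLeftIso x (A.mapComp' f.toLoc g.toLoc h.toLoc (toLoc_comp w)).symm)
    fun {x y} η => by
      change η ▷ A.map f.toLoc ▷ A.map g.toLoc ≫ (α_ y (A.map f.toLoc) (A.map g.toLoc)).hom ≫
        y ◁ (A.mapComp' f.toLoc g.toLoc h.toLoc (toLoc_comp w)).inv =
        ((α_ x (A.map f.toLoc) (A.map g.toLoc)).hom ≫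
        x ◁ (A.mapComp' f.toLoc g.toLoc h.toLoc (toLoc_comp w)).inv) ≫ η ▷ A.map h.toLoc
      rw [associator_naturality_left_assoc, Category.assoc, whisker_exchange]
  id a := NatIso.ofComponents (fun x => whiskerLeftIso x (A.mapId ⟨a⟩) ≪≫ ρ_ x)
    fun {x y} η => by
      change η ▷ A.map (𝟙 _) ≫ y ◁ (A.mapId ⟨a⟩).hom ≫ (ρ_ y).hom =
        (x ◁ (A.mapId ⟨a⟩).hom ≫ (ρ_ x).hom) ≫ η
      rw [← whisker_exchange_assoc, rightUnitor_naturality, Category.assoc]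
  assoc f g h fg gh k hfg hgh hk x := by
    have hk' : f.toLoc ≫ gh.toLoc = k.toLoc :=
      toLoc_comp (by rw [← hgh, ← Category.assoc, hfg, hk])
    have := congrArg (fun t => x ◁ t) (A.mapComp'_inv_whiskerRight_mapComp'₀₂₃_inv f.toLoc g.toLoc
      h.toLoc fg.toLoc gh.toLoc k.toLoc (toLoc_comp hfg) (toLoc_comp hgh)
      (toLoc_comp hk))
    simp only [Bicategory.whiskerLeft_comp] at this
    change ((α_ x (A.map f.toLoc) (A.map g.toLoc)).hom ≫
        x ◁ (A.mapComp' f.toLoc g.toLoc fg.toLoc (toLoc_comp hfg)).inv) ▷ A.map h.toLoc ≫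
        (α_ x (A.map fg.toLoc) (A.map h.toLoc)).hom ≫
        x ◁ (A.mapComp' fg.toLoc h.toLoc k.toLoc (toLoc_comp hk)).inv =
      ((α_ (x ≫ A.map f.toLoc) (A.map g.toLoc) (A.map h.toLoc)).hom ≫
        (x ≫ A.map f.toLoc) ◁ (A.mapComp' g.toLoc h.toLoc gh.toLoc (toLoc_comp hgh)).inv) ≫
        (α_ x (A.map f.toLoc) (A.map gh.toLoc)).hom ≫
        x ◁ (A.mapComp' f.toLoc gh.toLoc k.toLoc hk').inv
    simp only [Bicategory.comp_whiskerRight, Bicategory.whisker_assoc, Category.assoc,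
      Iso.inv_hom_id_assoc, this]
    simp

theorem ofHom_γ_hom {H : Type u} [Bicategory.{w, v} H] (A : LocallyDiscrete J ⥤ᵖ H) (X : H)
    {a b c : J} (f : a ⟶ b) (g : b ⟶ c) (h : a ⟶ c) (e : f ≫ g = h) (x : X ⟶ A.obj ⟨a⟩) :
    ((ofHom A X).γ f g h e x).hom = (α_ x (A.map f.toLoc) (A.map g.toLoc)).hom ≫
      x ◁ (A.mapComp' f.toLoc g.toLoc h.toLoc (toLoc_comp e)).inv := rfl

/-- The Beck-Chevalley condition makes gluing bijective, for category-valued pseudofunctors. -/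
theorem glueBijective_ofCat (F : LocallyDiscrete J ⥤ᵖ Cat.{v, u}) {a b n : J} {d : a ⟶ b}
    {w w' : b ⟶ n} (h : d ≫ w = d ≫ w') {l : F.obj ⟨b⟩ ⟶ F.obj ⟨a⟩} {l' : F.obj ⟨n⟩ ⟶ F.obj ⟨b⟩}
    (adj : Bicategory.Adjunction l (F.map d.toLoc))
    (adj' : Bicategory.Adjunction l' (F.map w'.toLoc))
    (sq : CommSq d.toLoc d.toLoc w.toLoc w'.toLoc)
    (H : SquareBeckChevalley adj adj' (F.isoMapOfCommSq sq).hom) :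
    (ofCat F).GlueBijective (d := d) (Adjunction.ofCat adj) w w' h := by
  intro x y
  have e : (fun f => (ofCat F).glue (Adjunction.ofCat adj) w w' h f) =
      fun f : (F.map d.toLoc).toFunctor.obj (l.toFunctor.obj x) ⟶ y =>
        (F.map w.toLoc).toFunctor.map (adj.unit.toNatTrans.app x) ≫
        (F.isoMapOfCommSq sq).hom.toNatTrans.app (l.toFunctor.obj x) ≫
        (F.map w'.toLoc).toFunctor.map f := by
    funext f
    rw [F.isoMapOfCommSq_eq sq (d ≫ w).toLoc rfl]
    rfl
  rw [e]
  exact H.bijective_cat x y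

/-- The Beck-Chevalley condition makes gluing bijective, for hom-categories. -/
theorem glueBijective_ofHom {H : Type u} [Bicategory.{w, v} H] (A : LocallyDiscrete J ⥤ᵖ H)
    {a b n : J} {d : a ⟶ b}
    {w w' : b ⟶ n} (h : d ≫ w = d ≫ w') {l : A.obj ⟨b⟩ ⟶ A.obj ⟨a⟩} {l' : A.obj ⟨n⟩ ⟶ A.obj ⟨b⟩}
    (adj : Bicategory.Adjunction l (A.map d.toLoc))
    (adj' : Bicategory.Adjunction l' (A.map w'.toLoc))
    (sq : CommSq d.toLoc d.toLoc w'.toLoc w.toLoc)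
    (hsq : SquareBeckChevalley adj adj' (A.isoMapOfCommSq sq).inv) (X : H) :
    (ofHom A X).GlueBijective (d := d) (homAdj adj X) w w' h := by
  intro (x : X ⟶ A.obj ⟨b⟩) (y : X ⟶ A.obj ⟨b⟩)
  have e : (fun f => (ofHom A X).glue (homAdj adj X) w w' h f) =
      fun f : (x ≫ l) ≫ A.map d.toLoc ⟶ y =>
        ((ρ_ x).inv ≫ x ◁ adj.unit ≫ (α_ x l (A.map d.toLoc)).inv) ▷ A.map w.toLoc ≫
        (α_ (x ≫ l) (A.map d.toLoc) (A.map w.toLoc)).hom ≫ (x ≫ l) ◁ (A.isoMapOfCommSq sq).inv ≫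
        (α_ (x ≫ l) (A.map d.toLoc) (A.map w'.toLoc)).inv ≫ f ▷ A.map w'.toLoc := by
    funext (f : (x ≫ l) ≫ A.map d.toLoc ⟶ y)
    rw [A.isoMapOfCommSq_eq sq (d ≫ w).toLoc (toLoc_comp h.symm), Iso.trans_inv, Iso.symm_inv,
      Bicategory.whiskerLeft_comp]
    change ((ρ_ x).inv ≫ x ◁ adj.unit ≫ (α_ x l (A.map d.toLoc)).inv) ▷ A.map w.toLoc ≫
      (((α_ (x ≫ l) (A.map d.toLoc) (A.map w.toLoc)).hom ≫
        (x ≫ l) ◁ (A.mapComp' d.toLoc w.toLoc (d ≫ w).toLoc (toLoc_comp rfl)).inv) ≫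
      (x ≫ l) ◁ (A.mapComp' d.toLoc w'.toLoc (d ≫ w).toLoc (toLoc_comp h.symm)).hom ≫
        (α_ (x ≫ l) (A.map d.toLoc) (A.map w'.toLoc)).inv) ≫ f ▷ A.map w'.toLoc = _
    simp only [Category.assoc]
  rw [e]
  exact hsq.bijective x y
end CatSystem
end FormalDescent

/-! ### Classical descent data and algebras. -/

namespace FormalDescent

section Classical

open Opposite Limits CatSystem

universe v' u'

variable {C : Type u} [Category.{v} C] (F : LocallyDiscrete Cᵒᵖ ⥤ᵖ Cat.{v', u'})

theorem op_comp_eq {E B W : C} {p : E ⟶ B} {f g : W ⟶ E} (h : f ≫ p = g ≫ p) :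
    p.op ≫ f.op = p.op ≫ g.op :=
  congrArg Quiver.Hom.op h

variable {F}

theorem KernelPairBeckChevalley.exists_glueBijective [HasPullbacks C]
    (H : KernelPairBeckChevalley F) {E B : C} (p : E ⟶ B) :
    ∃ (L : F.obj ⟨op E⟩ ⥤ F.obj ⟨op B⟩) (adj : L ⊣ (F.map p.op.toLoc).toFunctor),
      (ofCat F).GlueBijective (d := p.op) adj (pullback.fst p p).op (pullback.snd p p).op
        (op_comp_eq pullback.condition) := by
  obtain ⟨l, adj, H⟩ := H
  exact ⟨_, Adjunction.ofCat (adj p), glueBijective_ofCat F _ (adj p) (adj (pullback.snd p p)) _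
    (H p)⟩

variable {E B : C} {p : E ⟶ B} (sq : ChosenPullback p p) (sq₃ : ChosenPullback₃ sq sq sq)
  {L : F.obj ⟨op E⟩ ⥤ F.obj ⟨op B⟩} (adj : L ⊣ (F.map p.op.toLoc).toFunctor)

/-- The condition speaks of one kernel pair and one left adjoint; bijectivity is invariant under
changing either. -/
theorem KernelPairBeckChevalley.glueBijective [HasPullbacks C] (H : KernelPairBeckChevalley F) :
    (ofCat F).GlueBijective (d := p.op) adj sq.p₁.op sq.p₂.op (op_comp_eq sq.condition) := by
  obtain ⟨L', adj', H'⟩ := H.exists_glueBijective p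
  let e : pullback p p ≅ sq.pullback := (IsPullback.of_hasPullback p p).isoIsPullback _ _ sq.isPullback
  have H'' := (H'.of_adjunction (P := ofCat F) (d := p.op) adj).of_iso e.symm.op sq.p₁.op sq.p₂.op
    (by simp [e, ← op_comp]) (by simp [e, ← op_comp])
  exact H''

/-- The second square is the kernel pair of the second projection `q`, for which the condition also
holds. A point of it consists of pairs `(e₀, e₂)` and `(e₁, e₂)`, hence is a point `(e₀, e₁, e₂)` of
the triple overlap. -/
theorem KernelPairBeckChevalley.glueInjective₂ [HasPullbacks C] (H : KernelPairBeckChevalley F) :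
    (ofCat F).GlueInjective₂ (d := p.op) adj sq₃.p₁.op sq₃.p₂.op sq₃.p₃.op
      (op_comp_eq (by simp)) (op_comp_eq (by simp)) := by
  obtain ⟨L', adj', H'⟩ := H.exists_glueBijective p
  obtain ⟨L'', adj'', H''⟩ := H.exists_glueBijective (pullback.snd p p)
  let q := pullback.snd p p
  have hq := pullback.condition (f := p) (g := p)
  have hqq := pullback.condition (f := q) (g := q)
  obtain ⟨φ, h₁, h₂, h₃⟩ := sq₃.exists_lift (pullback.fst q q ≫ pullback.fst p p)
    (pullback.snd q q ≫ pullback.fst p p) (pullback.fst q q ≫ pullback.snd p p)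
    (pullback.fst q q ≫ pullback.fst p p ≫ p) (by simp)
    (by rw [Category.assoc, hq, ← reassoc_of% hqq]) (by simp [hq])
  have := (H'.of_adjunction (P := ofCat F) (d := p.op) adj).injective₂ H''
    (pullback.fst q q ≫ pullback.fst p p).op (pullback.snd q q ≫ pullback.fst p p).op
    (pullback.fst q q ≫ pullback.snd p p).op rfl rfl rfl
    (op_comp_eq (by rw [Category.assoc, Category.assoc, hq, reassoc_of% hqq]))
    (op_comp_eq (by rw [Category.assoc, Category.assoc, hq, reassoc_of% hqq]))
  exact this.of_map φ.op sq₃.p₁.op sq₃.p₂.op sq₃.p₃.op (congrArg Quiver.Hom.op h₁) (congrArg Quiver.Hom.op h₂)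
    (congrArg Quiver.Hom.op h₃) _ _

theorem pullHom_eq_pull {E' W W' : C} {x y : F.obj ⟨op E'⟩} {f g : W ⟶ E'}
    (φ : (F.map f.op.toLoc).toFunctor.obj x ⟶ (F.map g.op.toLoc).toFunctor.obj y) (s : W' ⟶ W)
    (f' g' : W' ⟶ E') (hf : s ≫ f = f') (hg : s ≫ g = g') :
    Pseudofunctor.LocallyDiscreteOpToCat.pullHom φ s f' g' hf hg =
      (ofCat F).pull (w₀ := f.op) (w₁ := g.op) φ s.op f'.op g'.op (congrArg Quiver.Hom.op hf)
        (congrArg Quiver.Hom.op hg) := rfl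

/-- Stability of gluing under transport, along the map into the chosen pullback. It reduces the unit
and cocycle conditions of an algebra's descent datum to the composition law of its gluing morphisms.
-/
theorem pullHom'_glue {x y : F.obj ⟨op E⟩} (a : (F.map p.op.toLoc).toFunctor.obj (L.obj x) ⟶ y)
    {W : C} (q : W ⟶ B) (f g : W ⟶ E) (hf : f ≫ p = q) (hg : g ≫ p = q) :
    Pseudofunctor.DescentData'.pullHom' (F := F) (sq := fun _ _ : Unit => sq)
      (fun _ _ => (ofCat F).glue (d := p.op) adj sq.p₁.op sq.p₂.op (op_comp_eq sq.condition) a)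
      q (i₁ := ()) (i₂ := ()) f g hf hg =
      (ofCat F).glue (d := p.op) adj f.op g.op (op_comp_eq (hf.trans hg.symm)) a := by
  exact pull_glue (ofCat F) (d := p.op) adj (w := sq.p₁.op) (w' := sq.p₂.op)
    (op_comp_eq sq.condition) a
    (sq.isPullback.lift f g (hf.trans hg.symm)).op f.op g.op
    (congrArg Quiver.Hom.op (sq.isPullback.lift_fst ..))
    (congrArg Quiver.Hom.op (sq.isPullback.lift_snd ..))

/-- Algebras for the monad of the adjunction determine descent data. -/
noncomputable def algebraToDesc : adj.toMonad.Algebra ⥤ Desc F sq sq₃ where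
  obj N := {
    obj := fun _ => N.A
    hom := fun _ _ => (ofCat F).glue (d := p.op) adj sq.p₁.op sq.p₂.op (op_comp_eq sq.condition)
      ((ofCat F).act (d := p.op) adj N)
    pullHom'_hom_self := fun _ => by
      exact (pullHom'_glue sq adj _ _ _ _ _ _).trans
        (glue_act_self (ofCat F) (d := p.op) adj N _)
    pullHom'_hom_comp := fun _ _ _ => by
      exact (congrArg₂ (· ≫ ·) (pullHom'_glue sq adj _ _ _ _ _ _)
        (pullHom'_glue sq adj _ _ _ _ _ _)).trans
        ((glue_act_comp (ofCat F) (d := p.op) adj N _ _ _ _ _).trans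
          (pullHom'_glue sq adj _ _ _ _ _ _).symm) }
  map f := {
    hom := fun _ => f.f
    comm := fun _ _ => algebraHom_comm (P := ofCat F) (d := p.op) f _ _ _ }

instance : (algebraToDesc sq sq₃ adj).Faithful where
  map_injective h := by
    ext
    exact congrArg (fun t => Pseudofunctor.DescentData'.Hom.hom t ()) h

theorem algebraToDesc_isEquivalence [HasPullbacks C] (H : KernelPairBeckChevalley F) :
    (algebraToDesc sq sq₃ adj).IsEquivalence where
  full := ⟨fun {N N'} f => ⟨⟨f.hom (), (H.glueBijective sq adj).algebraHom _ (f.comm () ())⟩, by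
    ext
    rfl⟩⟩
  essSurj := ⟨fun D => by
    -- The unit condition is expressed along a diagonal and the cocycle condition on the chosen
    -- triple pullback, which is the form in which gluing data yield an algebra.
    obtain ⟨δ⟩ : Nonempty sq.Diagonal := inferInstance
    have h1 := D.pullHom'_hom_self ()
    have h2 := D.pullHom'_hom_comp () () ()
    rw [Pseudofunctor.DescentData'.pullHom'_eq_pullHom D.hom _ _ _ δ.f, pullHom_eq_pull] at h1
    rw [Pseudofunctor.DescentData'.pullHom'₁₂_eq_pullHom_of_chosenPullback₃ (fun _ _ _ => sq₃) D.hom () () (),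
      Pseudofunctor.DescentData'.pullHom'₂₃_eq_pullHom_of_chosenPullback₃ (fun _ _ _ => sq₃) D.hom () () (),
      Pseudofunctor.DescentData'.pullHom'₁₃_eq_pullHom_of_chosenPullback₃ (fun _ _ _ => sq₃) D.hom () () (),
      pullHom_eq_pull, pullHom_eq_pull, pullHom_eq_pull] at h2
    obtain ⟨α, h, hη, hμ⟩ := (H.glueBijective sq adj).exists_algebra (H.glueInjective₂ sq sq₃ adj)
      δ.f.op _ _ sq₃.p₁₂.op sq₃.p₂₃.op sq₃.p₁₃.op _ _ _ _ _ _ (D.hom () ()) h1 h2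
    exact ⟨{ A := D.obj (), a := α, unit := hη, assoc := hμ },
      ⟨Pseudofunctor.DescentData'.isoMk (fun _ => Iso.refl _) fun _ _ => by
        refine (congrArg (· ≫ _) (CategoryTheory.Functor.map_id _ _)).trans ((Category.id_comp _).trans
          (h.symm.trans ((Category.comp_id _).symm.trans
            (congrArg (_ ≫ ·) (CategoryTheory.Functor.map_id _ _).symm))))⟩⟩⟩

/-- The comparison with algebras, followed by the passage to descent data, is the comparison with
descent data. -/
noncomputable def comparisonAlgebraToDesc :
    Monad.comparison adj ⋙ algebraToDesc sq sq₃ adj ≅ toDesc F sq sq₃ :=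
  NatIso.ofComponents (fun M => Pseudofunctor.DescentData'.isoMk (fun _ => Iso.refl _) fun _ _ => by
    refine (congrArg (· ≫ _) (CategoryTheory.Functor.map_id _ _)).trans ((Category.id_comp _).trans
      (Eq.trans ?_ ((Category.comp_id _).symm.trans
        (congrArg (_ ≫ ·) (CategoryTheory.Functor.map_id _ _).symm))))
    -- The canonical algebra acts by the counit, so its gluing morphism is the canonical
    -- isomorphism, which is the descent datum of `M`.
    have e := glue_counit (ofCat F) (d := p.op) adj sq.p₁.op sq.p₂.op (op_comp_eq sq.condition) M
    exact (e.trans (congrArg Iso.hom (can_eq (ofCat F) (d := p.op) sq.p₁.op sq.p₂.op sq.p.op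
      (congrArg Quiver.Hom.op sq.hp₁) (congrArg Quiver.Hom.op sq.hp₂) M))).symm) fun f => by
      ext
      exact (Category.comp_id _).trans (Category.id_comp _).symm

/-- The classical Bénabou-Roubaud theorem. -/
theorem benabou_roubaud [HasPullbacks C] (H : KernelPairBeckChevalley F) :
    (∃ (Φ : adj.toMonad.Algebra ≌ Desc F sq sq₃)
      (φ : Monad.comparison adj ⋙ Φ.functor ≅ toDesc F sq sq₃)
      (ψ : Φ.functor ⋙ descForget F sq sq₃ ≅ adj.toMonad.forget),
      ∀ M : F.obj ⟨op B⟩, (descForget F sq sq₃).map (φ.hom.app M) =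
        ψ.hom.app ((Monad.comparison adj).obj M)) ∧
    ((toDesc F sq sq₃).IsEquivalence ↔ (Monad.comparison adj).IsEquivalence) ∧
    ((toDesc F sq sq₃).Full ∧ (toDesc F sq sq₃).Faithful ↔
      (Monad.comparison adj).Full ∧ (Monad.comparison adj).Faithful) ∧
    ((toDesc F sq sq₃).Faithful ↔ (Monad.comparison adj).Faithful) := by
  have := algebraToDesc_isEquivalence sq sq₃ adj H
  let φ := comparisonAlgebraToDesc sq sq₃ adj
  have hfull : (toDesc F sq sq₃).Full ↔ (Monad.comparison adj).Full := by
    refine ⟨fun h => ?_, fun h => Functor.Full.of_iso φ⟩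
    have : (Monad.comparison adj ⋙ algebraToDesc sq sq₃ adj).Full := Functor.Full.of_iso φ.symm
    exact Functor.Full.of_comp_faithful _ (algebraToDesc sq sq₃ adj)
  have hfaith : (toDesc F sq sq₃).Faithful ↔ (Monad.comparison adj).Faithful := by
    refine ⟨fun h => ?_, fun h => Functor.Faithful.of_iso φ⟩
    have : (Monad.comparison adj ⋙ algebraToDesc sq sq₃ adj).Faithful :=
      Functor.Faithful.of_iso φ.symm
    exact Functor.Faithful.of_comp _ (algebraToDesc sq sq₃ adj)
  refine ⟨⟨(algebraToDesc sq sq₃ adj).asEquivalence, φ, Iso.refl _, fun M => rfl⟩, ?_,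
    and_congr hfull hfaith, hfaith⟩
  refine ⟨fun h => ?_, fun h => Functor.isEquivalence_of_iso φ⟩
  have : (Monad.comparison adj ⋙ algebraToDesc sq sq₃ adj).IsEquivalence :=
    Functor.isEquivalence_of_iso φ.symm
  exact Functor.isEquivalence_of_comp_right _ (algebraToDesc sq sq₃ adj)

end Classical
end FormalDescent

/-! ### Representables and coherent families of objects. -/

namespace FormalDescent

/-- The discrete category on a type, in arbitrary universes. -/
structure Disc (X : Type) : Type v where
  /-- The underlying element. -/
  as : X

instance (X : Type) : Category.{w, v} (Disc.{v} X) where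
  Hom a b := ULift.{w} (PLift (a.as = b.as))
  id _ := ⟨⟨rfl⟩⟩
  comp f g := ⟨⟨f.down.down.trans g.down.down⟩⟩

namespace Disc

theorem hom_eq {X : Type} {a b : Disc.{v} X}
    (f g : @Quiver.Hom _ (instCategoryDisc.{w, v} X).toQuiver a b) : f = g :=
  Subsingleton.elim (α := ULift.{w} (PLift (a.as = b.as))) f g

/-- The isomorphism given by an equality. -/
def iso {X : Type} {a b : Disc.{v} X} (h : a.as = b.as) :
    @CategoryTheory.Iso _ (instCategoryDisc.{w, v} X) a b where
  hom := ⟨⟨h⟩⟩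
  inv := ⟨⟨h.symm⟩⟩
  hom_inv_id := hom_eq _ _
  inv_hom_id := hom_eq _ _

variable {I : Type u₁} [Category.{v₁} I] {J : Type u₂} [Category.{0} J]

/-- The category-valued pseudofunctor represented by `x`, restricted along a functor. -/
def rep (x : J) (t : I ⥤ J) : LocallyDiscrete I ⥤ᵖ Cat.{w, v} where
  obj a := Cat.of (Disc (x ⟶ t.obj a.as))
  map f := Functor.toCatHom
    { obj := fun s => ⟨s.as ≫ t.map f.as⟩
      map := fun e => ⟨⟨congrArg (· ≫ t.map f.as) e.down.down⟩⟩ }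
  map₂ {a b f g} η := NatTrans.toCatHom₂
    { app := fun s => ⟨⟨congrArg (fun q => s.as ≫ t.map (q)) (congrArg Discrete.as (LocallyDiscrete.eq_of_hom η))⟩⟩
      naturality := fun _ _ _ => hom_eq _ _ }
  map₂_id _ := by ext; exact hom_eq _ _
  map₂_comp _ _ := by ext; exact hom_eq _ _
  mapId a := Cat.Hom.isoMk (NatIso.ofComponents (fun s => iso (by
    change s.as ≫ t.map (𝟙 a.as) = s.as
    simp)) fun _ => hom_eq _ _)
  mapComp f g := Cat.Hom.isoMk (NatIso.ofComponents (fun s => iso (by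
    change s.as ≫ t.map (f.as ≫ g.as) = (s.as ≫ t.map f.as) ≫ t.map g.as
    simp)) fun _ => hom_eq _ _)
  map₂_whisker_left _ _ _ _ := by ext; exact hom_eq _ _
  map₂_whisker_right _ _ := by ext; exact hom_eq _ _
  map₂_associator _ _ _ := by ext; exact hom_eq _ _
  map₂_left_unitor _ := by ext; exact hom_eq _ _
  map₂_right_unitor _ := by ext; exact hom_eq _ _

end Disc

open CatSystem

/-- A coherent family of objects indexed by the maps `x ⟶ t i`. -/
structure PseudoCone {I : Type u₁} [Category.{v₁} I] {J : Type u₂} [Category.{0} J] (x : J)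
    (t : I ⥤ J) (Q : CatSystem.{w, v} I) where
  /-- The objects. -/
  obj (i : I) (s : x ⟶ t.obj i) : Q.obj i
  /-- The transition isomorphisms. -/
  iso {i k : I} (f : i ⟶ k) (s : x ⟶ t.obj i) (s' : x ⟶ t.obj k) (h : s ≫ t.map f = s') :
    (Q.map f).obj (obj i s) ≅ obj k s'
  comp {i k l : I} (f : i ⟶ k) (g : k ⟶ l) (fg : i ⟶ l) (h : f ≫ g = fg) (s : x ⟶ t.obj i)
    (s' : x ⟶ t.obj k) (s'' : x ⟶ t.obj l) (hf : s ≫ t.map f = s') (hg : s' ≫ t.map g = s'')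
    (hfg : s ≫ t.map fg = s'') :
    (Q.map g).map (iso f s s' hf).hom ≫ (iso g s' s'' hg).hom =
      (Q.γ f g fg h (obj i s)).hom ≫ (iso fg s s'' hfg).hom

namespace PseudoCone
variable {I : Type u₁} [Category.{v₁} I] {J : Type u₂} [Category.{0} J] {x : J}
    {t : I ⥤ J} {Q : CatSystem.{w, v} I} (Z : PseudoCone x t Q)

/-- Coherent families carry no unit axiom: it follows from the composition law at identities, by
cancelling an isomorphism. -/
theorem iso_id {i : I} (s : x ⟶ t.obj i) (h : s ≫ t.map (𝟙 i) = s) :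
    (Q.map (𝟙 i)).map (Z.iso (𝟙 i) s s h).hom =
      (Q.γ (𝟙 i) (𝟙 i) (𝟙 i) (by simp) (Z.obj i s)).hom := by
  rw [← cancel_mono (Z.iso (𝟙 i) s s h).hom, Z.comp (𝟙 i) (𝟙 i) (𝟙 i) (by simp) s s s h h h]

theorem eqToHom_iso {i k : I} (f : i ⟶ k) {s s₁ : x ⟶ t.obj i} {s' s₁' : x ⟶ t.obj k}
    (h : s ≫ t.map f = s') (h₁ : s₁ ≫ t.map f = s₁') (e : s = s₁) (e' : s' = s₁') :
    eqToHom (congrArg (Z.obj k) e') ≫ (Z.iso f s₁ s₁' h₁).inv = (Z.iso f s s' h).inv ≫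
    (Q.map f).map (eqToHom (congrArg (Z.obj i) e)) := by
  subst e e'
  simp

/-- The two ways of reaching stage `l` give indices that are equal without being syntactically the
same, whence the transport along `e`. -/
theorem comp_inv {i k l : I} (f : i ⟶ k) (g : k ⟶ l) (fg : i ⟶ l) (h : f ≫ g = fg) (s : x ⟶ t.obj i)
    (s' : x ⟶ t.obj k) (s'' s₁'' : x ⟶ t.obj l) (hf : s ≫ t.map f = s') (hg : s' ≫ t.map g = s'')
    (hfg : s ≫ t.map fg = s₁'') (e : s₁'' = s'') :
    (Z.iso fg s s₁'' hfg).inv ≫ (Q.γ f g fg h (Z.obj i s)).inv =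
      eqToHom (congrArg (Z.obj l) e) ≫ (Z.iso g s' s'' hg).inv ≫
        (Q.map g).map (Z.iso f s s' hf).inv := by
  subst e
  have := Z.comp f g fg h s s' s₁'' hf hg hfg
  rw [← cancel_epi (Z.iso fg s s₁'' hfg).hom, ← cancel_epi (Q.γ f g fg h (Z.obj i s)).hom]
  simp [← reassoc_of% this, ← Functor.map_comp]

variable {F : LocallyDiscrete I ⥤ᵖ Cat.{w, v}} (Z : PseudoCone x t (ofCat F))

theorem iso_id_ofCat {i : I} {s s' : x ⟶ t.obj i} (h : s ≫ t.map (𝟙 i) = s') (e : s' = s) :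
    (Z.iso (𝟙 i) s s' h).inv ≫ (F.mapId ⟨i⟩).hom.toNatTrans.app (Z.obj i s) =
      eqToHom (congrArg (Z.obj i) e) := by
  subst e
  have e₁ := Z.iso_id s' h
  -- Both morphisms are compared after the faithful functor attached to `𝟙 i`, where both become the
  -- same composition constraint.
  have e₂ : (F.mapId ⟨i⟩).hom.toNatTrans.app (Z.obj i s') = (Z.iso (𝟙 i) s' s' h).hom := by
    apply ((ofCat F).map (𝟙 i)).map_injective
    refine Eq.trans ?_ e₁.symm
    refine Eq.trans ?_ (F.mapComp'_id_comp_inv_app (𝟙 (⟨i⟩ : LocallyDiscrete I))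
      (Z.obj i s')).symm
    rfl
  rw [e₂]
  simp

/-- The transformation from a representable determined by a coherent family of objects. -/
def toTrans : Disc.rep.{w, v} x t ⟶ F where
  app a := Functor.toCatHom
    { obj := fun s => Z.obj a.as s.as
      map := fun e => eqToHom (congrArg (Z.obj a.as) e.down.down)
      map_id := fun s => eqToHom_refl _ _
      map_comp := fun e e' => (eqToHom_trans (C := (ofCat F).obj a.as) (congrArg (Z.obj a.as) e.down.down)
        (congrArg (Z.obj a.as) e'.down.down)).symm }
  naturality {a b} f := Cat.Hom.isoMk (NatIso.ofComponents
    (fun s => (Z.iso f.as s.as _ rfl).symm) fun {s s'} e => by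
      exact Z.eqToHom_iso f.as rfl rfl e.down.down (congrArg (· ≫ t.map f.as) e.down.down))
  naturality_naturality {a b f g} η := by
    obtain rfl := LocallyDiscrete.eq_of_hom η
    obtain rfl : η = 𝟙 _ := Subsingleton.elim _ _
    rw [PrelaxFunctor.map₂_id, PrelaxFunctor.map₂_id]
    exact (congrArg (· ≫ _) (id_whiskerRight _ _)).trans ((Category.id_comp _).trans
      ((Category.comp_id _).symm.trans (congrArg (_ ≫ ·) (whiskerLeft_id _ _).symm)))
  naturality_id a := by
    ext s
    refine (Z.iso_id_ofCat (s := s.as) rfl (by simp)).trans ?_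
    refine (Category.comp_id _).symm.trans ?_
    exact congrArg (fun q => eqToHom _ ≫ q) (Category.comp_id _).symm
  naturality_comp {a b c} f g := by
    ext s
    have e : (F.mapComp f g).hom.toNatTrans.app (Z.obj a.as s.as) =
        ((ofCat F).γ f.as g.as (f.as ≫ g.as) rfl (Z.obj a.as s.as)).inv :=
      congrArg (fun q : F.map (f ≫ g) ≅ F.map f ≫ F.map g => q.hom.toNatTrans.app
        (Z.obj a.as s.as)) (F.mapComp'_eq_mapComp f g).symm
    refine Eq.trans (congrArg ((Z.iso (f.as ≫ g.as) s.as _ rfl).inv ≫ ·) e) ?_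
    refine (Z.comp_inv f.as g.as (f.as ≫ g.as) rfl s.as _ _ _ rfl rfl rfl (by simp)).trans ?_
    refine congrArg (fun q => eqToHom _ ≫ q) ?_
    refine Eq.trans ?_ (Category.id_comp _).symm
    refine congrArg (fun q => (Z.iso g.as _ _ rfl).inv ≫ q) ?_
    refine Eq.trans ?_ (Category.id_comp _).symm
    exact (Category.comp_id _).symm

end PseudoCone
theorem CatSystem.inv_comp_inv {I : Type u₁} [Category.{v₁} I] {Q : CatSystem.{w, v} I} {i k l : I}
    {f : i ⟶ k} {g : k ⟶ l} {fg : i ⟶ l} {h : f ≫ g = fg} {a : Q.obj i} {b : Q.obj k}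
    {c c' : Q.obj l} {p : b ≅ (Q.map f).obj a} {q : c' ≅ (Q.map g).obj b}
    {r : c ≅ (Q.map fg).obj a} {e : c ≅ c'}
    (key : e.hom ≫ q.hom ≫ (Q.map g).map p.hom = r.hom ≫ (Q.γ f g fg h a).inv) :
    (Q.map g).map p.inv ≫ q.inv = (Q.γ f g fg h a).hom ≫ r.inv ≫ e.hom := by
  have h2 : e ≪≫ q ≪≫ (Q.map g).mapIso p = r ≪≫ (Q.γ f g fg h a).symm := by
    ext
    exact key
  have h3 : (Q.map g).map p.inv ≫ q.inv ≫ e.inv = (Q.γ f g fg h a).hom ≫ r.inv := by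
    simpa using congrArg Iso.inv h2
  rw [← reassoc_of% h3, Iso.inv_hom_id, Category.comp_id]

theorem square_inv_comp {C : Type u} [Category.{v} C] {a b c a' b' c' : C} (p : b ≅ a)
    (p' : b' ≅ a') {r : b ⟶ b'} {r' : a ⟶ a'} {e : b ⟶ c} {e' : b' ⟶ c'} {q : c ⟶ c'}
    (h₁ : r ≫ p'.hom = p.hom ≫ r') (h₂ : e ≫ q = r ≫ e') :
    r' ≫ p'.inv ≫ e' = (p.inv ≫ e) ≫ q := by
  rw [Category.assoc, h₂, Iso.eq_inv_comp, ← reassoc_of% h₁, Iso.hom_inv_id_assoc]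

theorem square_hom_of_inv {C : Type u} [Category.{v} C] {a b a' b' : C} (p : b ≅ a)
    (p' : b' ≅ a') {r : b ⟶ b'} {r' : a ⟶ a'} (h : r' ≫ p'.inv = p.inv ≫ r) :
    r ≫ p'.hom = p.hom ≫ r' := by
  rw [← Iso.inv_comp_eq, ← reassoc_of% h, Iso.inv_hom_id, Category.comp_id]

namespace PseudoCone
variable {I : Type u₁} [Category.{v₁} I] {J : Type u₂} [Category.{0} J] {x : J}
    {t : I ⥤ J} {F : LocallyDiscrete I ⥤ᵖ Cat.{w, v}}

/-- The coherent family of objects determined by a transformation from a representable. -/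
def ofTrans (α : Disc.rep.{w, v} x t ⟶ F) : PseudoCone x t (ofCat F) where
  obj i s := (α.app ⟨i⟩).toFunctor.obj ⟨s⟩
  iso {i k} f s s' h := ((Cat.Hom.toNatIso (α.naturality f.toLoc)).app ⟨s⟩).symm ≪≫
    (α.app ⟨k⟩).toFunctor.mapIso (Disc.iso h)
  comp {i k l} f g fg h s s' s'' hf hg hfg := by
    subst h hf hg
    let Nf : (α.app ⟨k⟩).toFunctor.obj ⟨s ≫ t.map f⟩ ≅
      ((ofCat F).map f).obj ((α.app ⟨i⟩).toFunctor.obj ⟨s⟩) :=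
      (Cat.Hom.toNatIso (α.naturality f.toLoc)).app ⟨s⟩
    let Ng : (α.app ⟨l⟩).toFunctor.obj ⟨(s ≫ t.map f) ≫ t.map g⟩ ≅
      ((ofCat F).map g).obj ((α.app ⟨k⟩).toFunctor.obj ⟨s ≫ t.map f⟩) :=
      (Cat.Hom.toNatIso (α.naturality g.toLoc)).app ⟨s ≫ t.map f⟩
    let N : (α.app ⟨l⟩).toFunctor.obj ⟨s ≫ t.map (f ≫ g)⟩ ≅
      ((ofCat F).map (f ≫ g)).obj ((α.app ⟨i⟩).toFunctor.obj ⟨s⟩) :=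
      (Cat.Hom.toNatIso (α.naturality (f ≫ g).toLoc)).app ⟨s⟩
    let e : (α.app ⟨l⟩).toFunctor.obj ⟨s ≫ t.map (f ≫ g)⟩ ≅
      (α.app ⟨l⟩).toFunctor.obj ⟨(s ≫ t.map f) ≫ t.map g⟩ :=
      (α.app ⟨l⟩).toFunctor.mapIso (Disc.iso hfg)
    have key : e.hom ≫ Ng.hom ≫ ((ofCat F).map g).map Nf.hom =
        N.hom ≫ ((ofCat F).γ f g (f ≫ g) rfl ((α.app ⟨i⟩).toFunctor.obj ⟨s⟩)).inv := by
      have h0 : N.hom ≫ (F.mapComp f.toLoc g.toLoc).hom.toNatTrans.app _ = _ :=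
        congrArg (fun q : (Disc.rep.{w, v} x t).map (f.toLoc ≫ g.toLoc) ≫ α.app ⟨l⟩ ⟶
          α.app ⟨i⟩ ≫ F.map f.toLoc ≫ F.map g.toLoc => q.toNatTrans.app ⟨s⟩)
          (α.naturality_comp f.toLoc g.toLoc)
      have h1 : (F.mapComp f.toLoc g.toLoc).hom.toNatTrans.app ((α.app ⟨i⟩).toFunctor.obj ⟨s⟩) =
          ((ofCat F).γ f g (f ≫ g) rfl ((α.app ⟨i⟩).toFunctor.obj ⟨s⟩)).inv :=
        congrArg (fun q : F.map (f.toLoc ≫ g.toLoc) ≅ F.map f.toLoc ≫ F.map g.toLoc =>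
          q.hom.toNatTrans.app ((α.app ⟨i⟩).toFunctor.obj ⟨s⟩))
          (F.mapComp'_eq_mapComp f.toLoc g.toLoc).symm
      rw [h1] at h0
      refine Eq.trans ?_ h0.symm
      refine congrArg (fun q => e.hom ≫ q) ?_
      refine Eq.trans ?_ (Category.id_comp _).symm
      refine congrArg (fun q => Ng.hom ≫ q) ?_
      refine Eq.trans ?_ (Category.id_comp _).symm
      exact (Category.comp_id _).symm
    refine Eq.trans ?_ (inv_comp_inv (Q := ofCat F) (f := f) (g := g) (h := rfl) (p := Nf)
      (q := Ng) (r := N) (e := e) key)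
    have u₁ : Nf.inv ≫ (α.app ⟨k⟩).toFunctor.map (Disc.iso rfl).hom = Nf.inv :=
      (congrArg (Nf.inv ≫ ·) ((α.app ⟨k⟩).toFunctor.map_id _)).trans (Category.comp_id _)
    have u₂ : Ng.inv ≫ (α.app ⟨l⟩).toFunctor.map (Disc.iso rfl).hom = Ng.inv :=
      (congrArg (Ng.inv ≫ ·) ((α.app ⟨l⟩).toFunctor.map_id _)).trans (Category.comp_id _)
    exact congrArg₂ (fun p q => ((ofCat F).map g).map p ≫ q) u₁ u₂

theorem ofTrans_toTrans_iso (Z : PseudoCone x t (ofCat F)) {i k : I} (f : i ⟶ k) (s : x ⟶ t.obj i)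
    (s' : x ⟶ t.obj k) (h : s ≫ t.map f = s') : (ofTrans Z.toTrans).iso f s s' h = Z.iso f s s' h := by
  subst h
  ext
  exact Category.comp_id _

theorem ofTrans_naturality {α β : Disc.rep.{w, v} x t ⟶ F} (Γ : α ⟶ β) {i k : I} (f : i ⟶ k)
    (s : x ⟶ t.obj i) (s' : x ⟶ t.obj k) (h : s ≫ t.map f = s') :
    ((ofCat F).map f).map ((Γ.as.app ⟨i⟩).toNatTrans.app ⟨s⟩) ≫
        ((ofTrans β).iso f s s' h).hom =
      ((ofTrans α).iso f s s' h).hom ≫ (Γ.as.app ⟨k⟩).toNatTrans.app ⟨s'⟩ := by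
  have h1 : (Γ.as.app ⟨k⟩).toNatTrans.app ⟨s ≫ t.map f⟩ ≫
      ((Cat.Hom.toNatIso (β.naturality f.toLoc)).app ⟨s⟩).hom =
      ((Cat.Hom.toNatIso (α.naturality f.toLoc)).app ⟨s⟩).hom ≫
        (F.map f.toLoc).toFunctor.map ((Γ.as.app ⟨i⟩).toNatTrans.app ⟨s⟩) :=
    congrArg (fun q : (Disc.rep.{w, v} x t).map f.toLoc ≫ α.app ⟨k⟩ ⟶ β.app ⟨i⟩ ≫ F.map f.toLoc =>
      q.toNatTrans.app ⟨s⟩) (Γ.as.naturality f.toLoc)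
  have h2 := (Γ.as.app ⟨k⟩).toNatTrans.naturality (Disc.iso.{w, v} h).hom
  exact square_inv_comp ((Cat.Hom.toNatIso (α.naturality f.toLoc)).app ⟨s⟩)
    ((Cat.Hom.toNatIso (β.naturality f.toLoc)).app ⟨s⟩) h1 h2

/-- A modification between transformations from a representable. -/
def homMk {α β : Disc.rep.{w, v} x t ⟶ F}
    (θ : ∀ (i : I) (s : x ⟶ t.obj i), (ofTrans α).obj i s ⟶ (ofTrans β).obj i s)
    (h : ∀ {i k : I} (f : i ⟶ k) (s : x ⟶ t.obj i) (s' : x ⟶ t.obj k) (h : s ≫ t.map f = s'),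
      ((ofCat F).map f).map (θ i s) ≫ ((ofTrans β).iso f s s' h).hom =
        ((ofTrans α).iso f s s' h).hom ≫ θ k s') : α ⟶ β where
  as := {
    app a := NatTrans.toCatHom₂
      { app := fun s => θ a.as s.as
        naturality := fun s s' e => by
          obtain ⟨s⟩ := s
          obtain ⟨s'⟩ := s'
          obtain ⟨⟨e⟩⟩ := e
          change s = s' at e
          subst e
          exact (congrArg (· ≫ _) ((α.app a).toFunctor.map_id _)).trans ((Category.id_comp _).trans
            ((Category.comp_id _).symm.trans
              (congrArg (_ ≫ ·) ((β.app a).toFunctor.map_id _).symm))) }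
    naturality {a b} f := by
      ext s
      let p := (Cat.Hom.toNatIso (α.naturality f)).app s
      let p' := (Cat.Hom.toNatIso (β.naturality f)).app s
      have u : p.inv ≫ (α.app b).toFunctor.map (Disc.iso rfl).hom = p.inv :=
        (congrArg (p.inv ≫ ·) ((α.app b).toFunctor.map_id _)).trans (Category.comp_id _)
      have u' : p'.inv ≫ (β.app b).toFunctor.map (Disc.iso rfl).hom = p'.inv :=
        (congrArg (p'.inv ≫ ·) ((β.app b).toFunctor.map_id _)).trans (Category.comp_id _)
      have h' : ((ofCat F).map f.as).map (θ a.as s.as) ≫ p'.inv = p.inv ≫ θ b.as _ :=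
        (congrArg (_ ≫ ·) u'.symm).trans ((h f.as s.as _ rfl).trans (congrArg (· ≫ _) u))
      exact square_hom_of_inv p p' h' }

end PseudoCone
end FormalDescent

/-! ### Values of a Kan extension as coherent families. -/

namespace FormalDescent
open CatSystem

namespace PseudoCone
variable {I : Type u₁} [Category.{v₁} I] {J : Type u₂} [Category.{0} J] {x : J}
    {t : I ⥤ J}

/-- The coherent family of images of an object. -/
def ofObj (Q : CatSystem.{w, v} J) (a : Q.obj x) : PseudoCone x (𝟭 J) Q where
  obj _ s := (Q.map s).obj a
  iso f s s' h := Q.γ s f s' h a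
  comp f g fg h s s' s'' hf hg hfg := Q.γ_assoc s f g s' fg s'' hf h hg hfg a

variable {P : LocallyDiscrete J ⥤ᵖ Cat.{w, v}} {F : LocallyDiscrete I ⥤ᵖ Cat.{w, v}}
  (κ : t.toPseudofunctor.comp P ⟶ F)

/-- The coherent family `κ (P(s) a)`. -/
def image (a : P.obj ⟨x⟩) : PseudoCone x t (ofCat F) :=
  ofTrans ((kanFunctor κ (Disc.rep x (𝟭 J))).obj (ofObj (ofCat P) a).toTrans)

theorem image_iso (a : P.obj ⟨x⟩) {i k : I} (f : i ⟶ k) (s : x ⟶ t.obj i) (s' : x ⟶ t.obj k)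
    (h : s ≫ t.map f = s') : ((image κ a).iso f s s' h).hom =
      (κ.naturality f.toLoc).inv.toNatTrans.app ((P.map s.toLoc).toFunctor.obj a) ≫
        (κ.app ⟨k⟩).toFunctor.map ((ofCat P).γ s (t.map f) s' h a).hom := by
  subst h
  let p := (κ.naturality f.toLoc).inv.toNatTrans.app ((P.map s.toLoc).toFunctor.obj a)
  let q := (κ.app ⟨k⟩).toFunctor.map ((ofCat P).γ s (t.map f) (s ≫ t.map f) rfl a).hom
  refine (congrArg (_ ≫ ·) (CategoryTheory.Functor.map_id _ _)).trans
    ((Category.comp_id _).trans ?_)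
  change ((((𝟙 _ ≫ p) ≫ 𝟙 _) ≫ q) ≫ 𝟙 _) = p ≫ q
  simp

/-- The modification induced by a morphism. -/
def ofObjHom {a b : P.obj ⟨x⟩} (η : a ⟶ b) :
    (ofObj (ofCat P) a).toTrans ⟶ (ofObj (ofCat P) b).toTrans :=
  homMk (fun _ s => (P.map s.toLoc).toFunctor.map η) fun f s s' h => by
    rw [ofTrans_toTrans_iso, ofTrans_toTrans_iso]
    exact (ofCat P).γ_hom_naturality s f s' h η

variable {κ}

/-- Faithfulness of the Kan functor at the representable of `x`: a morphism in `P(x)` induces a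
modification, which is recovered from its images under `κ`. -/
theorem hom_ext (hκ : IsRightKan κ) {a b : P.obj ⟨x⟩} {η η' : a ⟶ b}
    (h : ∀ (i : I) (s : x ⟶ t.obj i),
      (κ.app ⟨i⟩).toFunctor.map ((P.map s.toLoc).toFunctor.map η) =
        (κ.app ⟨i⟩).toFunctor.map ((P.map s.toLoc).toFunctor.map η')) : η = η' := by
  have := hκ (Disc.rep x (𝟭 J))
  have e : ofObjHom η = ofObjHom η' := by
    apply (kanFunctor κ (Disc.rep x (𝟭 J))).map_injective
    ext i s
    exact h i.as s.as
  -- Evaluation at the universal element `𝟙 x` returns the morphism up to the unit constraint.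
  apply ((ofCat P).map (𝟙 x)).map_injective
  exact congrArg (fun Γ : (ofObj (ofCat P) a).toTrans ⟶ (ofObj (ofCat P) b).toTrans =>
    (Γ.as.app ⟨x⟩).toNatTrans.app ⟨𝟙 x⟩) e

/-- Fullness of the Kan functor at the representable of `x` gives a modification. Its component at
`𝟙 x` is the required morphism, and naturality determines all other components from that one. -/
theorem exists_hom (hκ : IsRightKan κ) {a b : P.obj ⟨x⟩}
    (θ : ∀ (i : I) (s : x ⟶ t.obj i), (image κ a).obj i s ⟶ (image κ b).obj i s)
    (hθ : ∀ {i k : I} (f : i ⟶ k) (s : x ⟶ t.obj i) (s' : x ⟶ t.obj k) (h : s ≫ t.map f = s'),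
      ((ofCat F).map f).map (θ i s) ≫ ((image κ b).iso f s s' h).hom =
        ((image κ a).iso f s s' h).hom ≫ θ k s') :
    ∃ η : a ⟶ b, ∀ (i : I) (s : x ⟶ t.obj i),
      (κ.app ⟨i⟩).toFunctor.map ((P.map s.toLoc).toFunctor.map η) = θ i s := by
  have := hκ (Disc.rep x (𝟭 J))
  obtain ⟨Γ, hΓ⟩ := (kanFunctor κ (Disc.rep x (𝟭 J))).map_surjective (homMk θ hθ)
  have hΓ' (i : I) (s : x ⟶ t.obj i) : (κ.app ⟨i⟩).toFunctor.map
      ((Γ.as.app ⟨t.obj i⟩).toNatTrans.app ⟨s⟩) = θ i s :=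
    congrArg (fun Γ : (kanFunctor κ (Disc.rep x (𝟭 J))).obj (ofObj (ofCat P) a).toTrans ⟶
      (kanFunctor κ (Disc.rep x (𝟭 J))).obj (ofObj (ofCat P) b).toTrans =>
      (Γ.as.app ⟨i⟩).toNatTrans.app ⟨s⟩) hΓ
  have hs (u v : (ofCat P).obj x) : Function.Surjective
      fun η : u ⟶ v => ((ofCat P).map (𝟙 x)).map η := ((ofCat P).map (𝟙 x)).map_surjective
  obtain ⟨η, hη⟩ := hs a b ((Γ.as.app ⟨x⟩).toNatTrans.app ⟨𝟙 x⟩)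
  dsimp only at hη
  refine ⟨η, fun i s => ?_⟩
  rw [← hΓ']
  congr 1
  have h1 := ofTrans_naturality Γ s (𝟙 x) s (Category.id_comp s)
  rw [ofTrans_toTrans_iso, ofTrans_toTrans_iso] at h1
  have h2 := (ofCat P).γ_hom_naturality (𝟙 x) s s (Category.id_comp s) η
  rw [hη] at h2
  exact (Iso.cancel_iso_hom_left ((ofCat P).γ (𝟙 x) s s (Category.id_comp s) a) _ _).1
    (h2.symm.trans h1)

/-- Essential surjectivity gives a transformation `α` over `Z`. Its value at `𝟙 x` is the object
`a`, and `α` is compared with the transformation represented by `a` through its own transition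
isomorphisms. -/
theorem exists_obj (hκ : IsRightKan κ) (Z : PseudoCone x t (ofCat F)) :
    ∃ (a : P.obj ⟨x⟩) (τ : ∀ (i : I) (s : x ⟶ t.obj i), (image κ a).obj i s ≅ Z.obj i s),
      ∀ {i k : I} (f : i ⟶ k) (s : x ⟶ t.obj i) (s' : x ⟶ t.obj k) (h : s ≫ t.map f = s'),
      ((ofCat F).map f).map (τ i s).hom ≫ (Z.iso f s s' h).hom =
        ((image κ a).iso f s s' h).hom ≫ (τ k s').hom := by
  have := hκ (Disc.rep x (𝟭 J))
  let k := kanFunctor κ (Disc.rep x (𝟭 J))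
  let α := k.objPreimage Z.toTrans
  let Γ : k.obj α ≅ Z.toTrans := k.objObjPreimageIso Z.toTrans
  let a : P.obj ⟨x⟩ := (ofTrans α).obj x (𝟙 x)
  let e : (ofObj (ofCat P) a).toTrans ⟶ α :=
    homMk (fun y s => ((ofTrans α).iso s (𝟙 x) s (Category.id_comp s)).hom) fun f s s' h => by
      rw [ofTrans_toTrans_iso]
      exact (ofTrans α).comp s f s' h (𝟙 x) s s' _ _ _
  let δ : k.obj (ofObj (ofCat P) a).toTrans ⟶ Z.toTrans := k.map e ≫ Γ.hom
  let τ (i : I) (s : x ⟶ t.obj i) : (image κ a).obj i s ≅ Z.obj i s :=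
    (κ.app ⟨i⟩).toFunctor.mapIso ((ofTrans α).iso s (𝟙 x) s (Category.id_comp s)) ≪≫
      (Cat.Hom.toNatIso (appIso Γ ⟨i⟩)).app ⟨s⟩
  refine ⟨a, τ, fun f s s' h => ?_⟩
  rw [← ofTrans_toTrans_iso]
  exact ofTrans_naturality δ f s s' h

end PseudoCone
end FormalDescent

/-! ### Algebras and coherent families over the simplices. -/

namespace FormalDescent

/-- A vertex of a simplex. -/
abbrev vertex {n : SimplexCategory} (i : Fin (n.len + 1)) : SimplexCategory.mk 0 ⟶ n :=
  SimplexCategory.const _ n i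

/-- The bottom vertex of the interval. -/
abbrev bot : SimplexCategory.mk 0 ⟶ SimplexCategory.mk 1 := vertex 0

/-- The top vertex of the interval. -/
abbrev top : SimplexCategory.mk 0 ⟶ SimplexCategory.mk 1 := vertex 1

theorem vertex_zero_eq_id : vertex (n := SimplexCategory.mk 0) 0 = 𝟙 _ :=
  SimplexCategory.Hom.ext _ _ (OrderHom.ext _ _ (funext fun _ =>
    Subsingleton.elim (α := Fin 1) _ _))

/-- This reduces relations between vertices of any simplex to the single edge of the interval. -/
theorem exists_edge {n : SimplexCategory} (a b : SimplexCategory.mk 0 ⟶ n)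
    (h : a.toOrderHom 0 ≤ b.toOrderHom 0) :
    ∃ e : SimplexCategory.mk 1 ⟶ n, bot ≫ e = a ∧ top ≫ e = b := by
  refine ⟨SimplexCategory.mkHom ⟨![a.toOrderHom 0, b.toOrderHom 0], ?_⟩, ?_, ?_⟩
  · intro i k hik
    fin_cases i <;> fin_cases k <;> simp_all
  · ext i
    fin_cases i
    rfl
  · ext i
    fin_cases i
    rfl

namespace CatSystem

/-- Restriction along a functor. -/
abbrev restrict {I : Type u₁} [Category.{v₁} I] {J : Type u₂} [Category.{v₂} J]
    (P : CatSystem.{v, u} J) (t : I ⥤ J) : CatSystem.{v, u} I where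
  obj i := P.obj (t.obj i)
  map f := P.map (t.map f)
  comp f g h w := P.comp (t.map f) (t.map g) (t.map h) (by rw [← w, t.map_comp])
  id i := eqToIso (congrArg P.map (t.map_id i)) ≪≫ P.id (t.obj i)
  assoc f g h fg gh k hfg hgh hk x := P.assoc _ _ _ _ _ _ _ _ _ x

/-- A `CatSystem` relates its unit and composition constraints by no axiom, so a unit isomorphism
coherent with composition is extracted from the composition constraint at identities. A variable `q`
is allowed because it will be the image of a vertex, only provably an identity. -/
theorem exists_unitIso {J : Type u₁} [Category.{v₁} J] (P : CatSystem.{v, u} J) {a : J}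
    (q : a ⟶ a) (hq : q = 𝟙 a) (x : P.obj a) :
    ∃ r : (P.map q).obj x ≅ x, ∀ {b : J} (w : a ⟶ b) (h : q ≫ w = w),
      (P.map w).map r.hom = (P.γ q w w h x).hom := by
  subst hq
  let r : (P.map (𝟙 a)).obj x ≅ x :=
    (P.map (𝟙 a)).preimageIso (P.γ (𝟙 a) (𝟙 a) (𝟙 a) (Category.id_comp _) x)
  have hr : (P.map (𝟙 a)).map r.hom = (P.γ (𝟙 a) (𝟙 a) (𝟙 a) (Category.id_comp _) x).hom := by
    simp [r]
  refine ⟨r, fun {b} w _ => ?_⟩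
  have h1 := P.γ_assoc (𝟙 a) (𝟙 a) w (𝟙 a) w w (Category.id_comp _) (Category.id_comp _)
    (Category.id_comp _) (Category.id_comp _) x
  rw [cancel_mono, ← hr] at h1
  have h2 := P.γ_hom_naturality (𝟙 a) w w (Category.id_comp w) r.hom
  rw [h1, cancel_epi] at h2
  exact h2.symm

theorem _root_.FormalDescent.PseudoCone.map_iso {I : Type u₁} [Category.{v₁} I] {J : Type u₂}
    [Category.{0} J] {P : CatSystem.{w, v} J} {t : I ⥤ J} {x : J}
    (Z : PseudoCone x t (P.restrict t)) {i k l : I} (f : i ⟶ k) (g : k ⟶ l)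
    (fg : i ⟶ l) (h : f ≫ g = fg) (s : x ⟶ t.obj i) (s' : x ⟶ t.obj k) (s'' : x ⟶ t.obj l)
    (hf : s ≫ t.map f = s') (hg : s' ≫ t.map g = s'') (hfg : s ≫ t.map fg = s'') :
    (P.map (t.map g)).map (Z.iso f s s' hf).hom =
      (P.γ (t.map f) (t.map g) (t.map fg) (by rw [← h, t.map_comp]) (Z.obj i s)).hom ≫
        (Z.iso fg s s'' hfg).hom ≫ (Z.iso g s' s'' hg).inv := by
  have := Z.comp f g fg h s s' s'' hf hg hfg
  rw [← Category.assoc, Iso.eq_comp_inv]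
  exact this

section Simplicial

variable {J : Type u₁} [Category.{0} J] {P : CatSystem.{w, v} J} {t : SimplexCategory ⥤ J} {x : J}
  [hx : ∀ n, Subsingleton (x ⟶ t.obj n)] {d : x ⟶ t.obj (SimplexCategory.mk 0)}

variable {L : P.obj (t.obj (SimplexCategory.mk 0)) ⥤ P.obj x} {adj : L ⊣ P.map d}

/-- The gluing morphisms of an algebra agree with those of a coherent family of objects. -/
structure Compatible (N : adj.toMonad.Algebra) (Z : PseudoCone x t (P.restrict t))
    (e : N.A ≅ Z.obj (SimplexCategory.mk 0) d) : Prop where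
  comm {n : SimplexCategory} (a b : SimplexCategory.mk 0 ⟶ n) (s : x ⟶ t.obj n) :
    (P.map (t.map a)).map e.hom ≫ (Z.iso a d s (Subsingleton.elim _ _)).hom =
      P.glue adj (t.map a) (t.map b) (Subsingleton.elim _ _) (P.act adj N) ≫
        (P.map (t.map b)).map e.hom ≫ (Z.iso b d s (Subsingleton.elim _ _)).hom

/-- If `a ≤ b`, the edge from `a` to `b` transports the relation, since gluing and the transitions
of `Z` are both stable. If `b ≤ a`, the gluing morphism of an algebra is inverted. -/
theorem Compatible.of_edge {N : adj.toMonad.Algebra} {Z : PseudoCone x t (P.restrict t)}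
    {e : N.A ≅ Z.obj (SimplexCategory.mk 0) d} (s₁ : x ⟶ t.obj (SimplexCategory.mk 1))
    (h : (P.map (t.map bot)).map e.hom ≫ (Z.iso bot d s₁ (Subsingleton.elim _ _)).hom =
      P.glue adj (t.map bot) (t.map top) (Subsingleton.elim _ _) (P.act adj N) ≫
        (P.map (t.map top)).map e.hom ≫ (Z.iso top d s₁ (Subsingleton.elim _ _)).hom) :
    Compatible N Z e := by
  have main : ∀ {n : SimplexCategory} (a b : SimplexCategory.mk 0 ⟶ n) (s : x ⟶ t.obj n),
      a.toOrderHom 0 ≤ b.toOrderHom 0 →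
      (P.map (t.map a)).map e.hom ≫ (Z.iso a d s (Subsingleton.elim _ _)).hom =
      P.glue adj (t.map a) (t.map b) (Subsingleton.elim _ _) (P.act adj N) ≫
        (P.map (t.map b)).map e.hom ≫ (Z.iso b d s (Subsingleton.elim _ _)).hom := by
    intro n a b s hab
    obtain ⟨g, ha, hb⟩ := exists_edge a b hab
    have ha' : t.map bot ≫ t.map g = t.map a := by rw [← t.map_comp, ha]
    have hb' : t.map top ≫ t.map g = t.map b := by rw [← t.map_comp, hb]
    have h' := congrArg (fun q => (P.map (t.map g)).map q) h
    simp only [Functor.map_comp] at h'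
    rw [Z.map_iso bot g a ha d s₁ s (Subsingleton.elim _ _) (Subsingleton.elim _ _)
        (Subsingleton.elim _ _),
      Z.map_iso top g b hb d s₁ s (Subsingleton.elim _ _) (Subsingleton.elim _ _)
        (Subsingleton.elim _ _), γ_hom_naturality_assoc, γ_hom_naturality_assoc,
      P.map_eq_pull (P.glue adj _ _ _ _) (t.map g) (t.map a) (t.map b) ha' hb', pull_glue] at h'
    simp only [Category.assoc, Iso.inv_hom_id_assoc, Iso.cancel_iso_hom_left] at h'
    rw [← cancel_mono (Z.iso g s₁ s (Subsingleton.elim _ _)).inv]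
    simpa using h'
  refine ⟨fun {n} a b s => ?_⟩
  obtain hab | hab := le_total (a.toOrderHom 0) (b.toOrderHom 0)
  · exact main a b s hab
  · rw [main b a s hab, ← Category.assoc, glue_act_comp, glue_act_self]
    simp

/-- The transitions of `Z` from the two ends of the interval give a descent datum `φ`. Along any
edge it becomes the comparison of two transitions into one object, so the unit and cocycle
conditions are automatic. -/
theorem exists_algebra_of_cone
    (H : P.GlueBijective adj (t.map bot) (t.map top) (Subsingleton.elim _ _))
    (H₂ : P.GlueInjective₂ adj (t.map (vertex (n := SimplexCategory.mk 2) 0)) (t.map (vertex 1))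
      (t.map (vertex 2)) (Subsingleton.elim _ _) (Subsingleton.elim _ _))
    (Z : PseudoCone x t (P.restrict t)) :
    ∃ (N : adj.toMonad.Algebra) (e : N.A ≅ Z.obj (SimplexCategory.mk 0) d),
      Compatible N Z e := by
  let s₁ := d ≫ t.map bot
  let φ : (P.map (t.map bot)).obj (Z.obj _ d) ⟶ (P.map (t.map top)).obj (Z.obj _ d) :=
    (Z.iso bot d s₁ (Subsingleton.elim _ _)).hom ≫ (Z.iso top d s₁ (Subsingleton.elim _ _)).inv
  have hφ : ∀ {n : SimplexCategory} (a b : SimplexCategory.mk 0 ⟶ n)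
      (g : SimplexCategory.mk 1 ⟶ n) (ha : bot ≫ g = a) (hb : top ≫ g = b) (s : x ⟶ t.obj n),
      P.pull φ (t.map g) (t.map a) (t.map b) (by rw [← t.map_comp, ha])
        (by rw [← t.map_comp, hb]) =
      (Z.iso a d s (Subsingleton.elim _ _)).hom ≫
        (Z.iso b d s (Subsingleton.elim _ _)).inv := by
    intro n a b g ha hb s
    have e₁ := Z.map_iso bot g a ha d s₁ s (Subsingleton.elim _ _)
      (Subsingleton.elim _ _) (Subsingleton.elim _ _)
    have e₂ : (P.map (t.map g)).map (Z.iso top d s₁ (Subsingleton.elim _ _)).inv =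
        (Z.iso g s₁ s (Subsingleton.elim _ _)).hom ≫
        (Z.iso b d s (Subsingleton.elim _ _)).inv ≫
        (P.γ (t.map top) (t.map g) (t.map b) (by rw [← t.map_comp, hb]) (Z.obj _ d)).inv := by
      rw [← cancel_epi ((P.map (t.map g)).map (Z.iso top d s₁ (Subsingleton.elim _ _)).hom),
        ← Functor.map_comp, Iso.hom_inv_id, CategoryTheory.Functor.map_id,
        Z.map_iso top g b hb d s₁ s (Subsingleton.elim _ _)
        (Subsingleton.elim _ _) (Subsingleton.elim _ _)]
      simp
    rw [pull, show φ = _ from rfl, (P.map (t.map g)).map_comp, e₁, e₂]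
    simp
  obtain ⟨g₀₁, h₀, h₁⟩ := exists_edge (n := SimplexCategory.mk 2) (vertex 0) (vertex 1)
    (by decide)
  obtain ⟨g₁₂, h₁', h₂⟩ := exists_edge (n := SimplexCategory.mk 2) (vertex 1) (vertex 2)
    (by decide)
  obtain ⟨g₀₂, h₀', h₂'⟩ := exists_edge (n := SimplexCategory.mk 2) (vertex 0) (vertex 2)
    (by decide)
  -- The degenerate edge is the codegeneracy that tests the unit condition.
  obtain ⟨σ, hσ, hσ'⟩ := exists_edge (𝟙 (SimplexCategory.mk 0)) (𝟙 _) le_rfl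
  obtain ⟨α, hα, unit, assoc⟩ := H.exists_algebra H₂ (t.map σ) (by simp [← t.map_comp, hσ])
    (by simp [← t.map_comp, hσ']) (t.map g₀₁) (t.map g₁₂) (t.map g₀₂) (by simp [← t.map_comp, h₀])
    (by simp [← t.map_comp, h₁]) (by simp [← t.map_comp, h₁']) (by simp [← t.map_comp, h₂])
    (by simp [← t.map_comp, h₀']) (by simp [← t.map_comp, h₂']) φ (by
      have e := hφ _ _ σ hσ hσ' d
      rw [Iso.hom_inv_id] at e
      have aux : ∀ (q : t.obj (SimplexCategory.mk 0) ⟶ t.obj (SimplexCategory.mk 0))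
          (h₀ : t.map bot ≫ t.map σ = q) (h₁ : t.map top ≫ t.map σ = q) (q' : _) (hq : q = q')
          (_ : P.pull φ (t.map σ) q q h₀ h₁ = 𝟙 _),
          P.pull φ (t.map σ) q' q' (h₀.trans hq) (h₁.trans hq) = 𝟙 _ := by
        intro q h₀ h₁ q' hq hh
        subst hq
        exact hh
      exact aux _ _ _ _ (t.map_id _) e) (by
      have s := d ≫ t.map (vertex (n := SimplexCategory.mk 2) 0)
      rw [hφ _ _ _ h₀ h₁ s, hφ _ _ _ h₁' h₂ s, hφ _ _ _ h₀' h₂' s]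
      simp only [Category.assoc, Iso.inv_hom_id_assoc])
  refine ⟨⟨Z.obj _ d, α, unit, assoc⟩, Iso.refl _, Compatible.of_edge s₁ ?_⟩
  have hα' : P.glue adj (t.map bot) (t.map top) (Subsingleton.elim _ _)
    (P.act adj ⟨Z.obj _ d, α, unit, assoc⟩) = φ := hα
  rw [hα', Iso.refl_hom]
  simp [φ]

variable (adj) in
/-- The coherent family of objects determined by an algebra. -/
def coneOfAlgebra (N : adj.toMonad.Algebra) : PseudoCone x t (P.restrict t) where
  obj n _ := (P.map (t.map (vertex 0))).obj N.A
  iso {n m} f _ _ _ := P.γ (t.map (vertex 0)) (t.map f) (t.map (vertex 0 ≫ f))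
      (t.map_comp _ _).symm N.A ≪≫
    P.glueIso adj N (t.map (vertex 0 ≫ f)) (t.map (vertex 0)) (Subsingleton.elim _ _)
  comp {n m k} f g fg h s s' s'' _ _ _ := by
    have e₁ : t.map (vertex 0 ≫ f) ≫ t.map g = t.map (vertex 0 ≫ fg) := by
      rw [← t.map_comp, Category.assoc, h]
    have e₂ : t.map (vertex 0) ≫ t.map g = t.map (vertex 0 ≫ g) := (t.map_comp _ _).symm
    have e₃ := P.γ_assoc (t.map (vertex 0)) (t.map f) (t.map g) (t.map (vertex 0 ≫ f)) (t.map fg)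
      (t.map (vertex 0 ≫ fg)) (t.map_comp _ _).symm (by rw [← h, t.map_comp]) e₁
      (t.map_comp _ _).symm N.A
    simp only [Iso.trans_hom, glueIso_hom, Functor.map_comp, Category.assoc]
    rw [P.map_eq_pull (P.glue adj _ _ _ _) (t.map g) (t.map (vertex 0 ≫ fg))
      (t.map (vertex 0 ≫ g)) e₁ e₂, pull_glue]
    simp only [Category.assoc, Iso.inv_hom_id_assoc]
    rw [reassoc_of% e₃, glue_act_comp]
    rfl

/-- The family of `N` at the point is `N.A` transported along the identity vertex, so the
identification is the inverse of a coherent unit isomorphism. The rest is the cocycle law of the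
gluing morphisms. -/
theorem exists_compatible (N : adj.toMonad.Algebra) :
    ∃ e : N.A ≅ (coneOfAlgebra adj N).obj (SimplexCategory.mk 0) d,
      Compatible N (coneOfAlgebra adj N) e := by
  obtain ⟨r, hr⟩ := P.exists_unitIso (t.map (vertex (n := SimplexCategory.mk 0) 0))
    (by rw [vertex_zero_eq_id, t.map_id]) N.A
  have key : ∀ {n : SimplexCategory} (a : SimplexCategory.mk 0 ⟶ n) (s : x ⟶ t.obj n),
      (P.map (t.map a)).map r.inv ≫
        ((coneOfAlgebra adj N).iso a d s (Subsingleton.elim _ _)).hom =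
        P.glue adj (t.map a) (t.map (vertex 0)) (Subsingleton.elim _ _) (P.act adj N) := by
    intro n a s
    have ha : t.map (vertex 0 ≫ a) = t.map a := by
      rw [vertex_zero_eq_id, Category.id_comp]
    have aux : ∀ (q : _) (h : t.map (vertex 0) ≫ t.map a = q) (_ : t.map a = q),
        (P.map (t.map a)).map r.inv ≫ (P.γ (t.map (vertex 0)) (t.map a) q h N.A).hom ≫
          P.glue adj q (t.map (vertex 0)) (Subsingleton.elim _ _) (P.act adj N) =
        P.glue adj (t.map a) (t.map (vertex 0)) (Subsingleton.elim _ _) (P.act adj N) := by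
      intro q h hq
      subst hq
      rw [← hr (t.map a) h, ← Functor.map_comp_assoc, Iso.inv_hom_id,
        CategoryTheory.Functor.map_id, Category.id_comp]
    exact aux _ (t.map_comp _ _).symm ha.symm
  refine ⟨r.symm, ⟨fun a b s => ?_⟩⟩
  exact (key a s).trans ((congrArg (_ ≫ ·) (key b s)).trans (P.glue_act_comp ..)).symm

variable {N N' : adj.toMonad.Algebra} {Z Z' : PseudoCone x t (P.restrict t)}
    {e : N.A ≅ Z.obj (SimplexCategory.mk 0) d} {e' : N'.A ≅ Z'.obj (SimplexCategory.mk 0) d}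

/-- The morphism is carried to each simplex through its bottom vertex. Algebra morphisms commute
with gluing, so any other vertex gives the same result, and this independence yields naturality. -/
theorem Compatible.exists_family (h : Compatible N Z e) (h' : Compatible N' Z' e') (f : N ⟶ N') :
    ∃ θ : ∀ (i : SimplexCategory) (s : x ⟶ t.obj i), Z.obj i s ⟶ Z'.obj i s,
      (∀ {i k : SimplexCategory} (g : i ⟶ k) (s : x ⟶ t.obj i) (s' : x ⟶ t.obj k)
        (h : s ≫ t.map g = s'), ((P.restrict t).map g).map (θ i s) ≫ (Z'.iso g s s' h).hom =
          (Z.iso g s s' h).hom ≫ θ k s') ∧ e.hom ≫ θ (SimplexCategory.mk 0) d = f.f ≫ e'.hom := by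
  let θ₀ : Z.obj (SimplexCategory.mk 0) d ⟶ Z'.obj (SimplexCategory.mk 0) d :=
    e.inv ≫ f.f ≫ e'.hom
  have hθ₀ : e.hom ≫ θ₀ = f.f ≫ e'.hom := by simp [θ₀]
  let θ (i : SimplexCategory) (s : x ⟶ t.obj i) : Z.obj i s ⟶ Z'.obj i s :=
    (Z.iso (vertex 0) d s (Subsingleton.elim _ _)).inv ≫ (P.map (t.map (vertex 0))).map θ₀ ≫
      (Z'.iso (vertex 0) d s (Subsingleton.elim _ _)).hom
  have key : ∀ {i : SimplexCategory} (a : SimplexCategory.mk 0 ⟶ i) (s : x ⟶ t.obj i),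
      (P.map (t.map a)).map θ₀ ≫ (Z'.iso a d s (Subsingleton.elim _ _)).hom =
        (Z.iso a d s (Subsingleton.elim _ _)).hom ≫ θ i s := by
    intro i a s
    rw [← cancel_epi ((P.map (t.map a)).map e.hom), ← Functor.map_comp_assoc, hθ₀,
      reassoc_of% h.comm a (vertex 0) s, Functor.map_comp, Category.assoc, h'.comm a (vertex 0) s,
      reassoc_of% P.algebraHom_comm f]
    simp only [θ, Iso.hom_inv_id_assoc]
    rw [← Functor.map_comp_assoc, ← Functor.map_comp_assoc, hθ₀]
  have nat : ∀ {i k : SimplexCategory} (g : i ⟶ k) (s : x ⟶ t.obj i) (s' : x ⟶ t.obj k)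
      (h : s ≫ t.map g = s'), (P.map (t.map g)).map (θ i s) ≫ (Z'.iso g s s' h).hom =
        (Z.iso g s s' h).hom ≫ θ k s' := by
    intro i k g s s' hs
    rw [← cancel_epi ((P.map (t.map g)).map (Z.iso (vertex 0) d s (Subsingleton.elim _ _)).hom),
      ← Functor.map_comp_assoc, ← key, Functor.map_comp,
      Z'.map_iso (vertex 0) g _ rfl d s s' (Subsingleton.elim _ _) hs (Subsingleton.elim _ _),
      Z.map_iso (vertex 0) g _ rfl d s s' (Subsingleton.elim _ _) hs (Subsingleton.elim _ _)]
    simp only [Category.assoc, Iso.inv_hom_id, Category.comp_id, γ_hom_naturality_assoc, key,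
      Iso.inv_hom_id_assoc]
  refine ⟨θ, nat, ?_⟩
  rw [← hθ₀]
  congr 1
  -- At the point itself, `θ` agrees with `θ₀` only after comparing the two along the identity
  -- transition.
  have : (P.map (t.map (𝟙 (SimplexCategory.mk 0)))).Faithful := by
    rw [t.map_id]
    infer_instance
  apply (P.map (t.map (𝟙 (SimplexCategory.mk 0)))).map_injective
  have e₁ := key (𝟙 _) d
  have e₂ := nat (𝟙 _) d d (Subsingleton.elim _ _)
  exact (cancel_mono _).1 (e₂.trans e₁.symm)

/-- Naturality of `θ` at the two ends of the interval makes its component at the point commute with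
gluing; bijectivity turns this into the algebra equation. -/
theorem Compatible.exists_algebraHom
    (H : P.GlueBijective adj (t.map bot) (t.map top) (Subsingleton.elim _ _))
    (h : Compatible N Z e) (h' : Compatible N' Z' e')
    (θ : ∀ (i : SimplexCategory) (s : x ⟶ t.obj i), Z.obj i s ⟶ Z'.obj i s)
    (hθ : ∀ {i k : SimplexCategory} (g : i ⟶ k) (s : x ⟶ t.obj i) (s' : x ⟶ t.obj k)
        (h : s ≫ t.map g = s'), ((P.restrict t).map g).map (θ i s) ≫ (Z'.iso g s s' h).hom =
          (Z.iso g s s' h).hom ≫ θ k s') :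
    ∃ f : N ⟶ N', e.hom ≫ θ (SimplexCategory.mk 0) d = f.f ≫ e'.hom := by
  let θ₀ : Z.obj (SimplexCategory.mk 0) d ⟶ Z'.obj (SimplexCategory.mk 0) d := θ _ d
  let f₀ : N.A ⟶ N'.A := e.hom ≫ θ₀ ≫ e'.inv
  have hf₀ : e.hom ≫ θ₀ = f₀ ≫ e'.hom := by simp [f₀]
  refine ⟨⟨f₀, H.algebraHom f₀ ?_⟩, hf₀⟩
  let s := d ≫ t.map bot
  have e₁ := hθ bot d s (Subsingleton.elim _ _)
  have e₂ := hθ top d s (Subsingleton.elim _ _)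
  change (P.map (t.map bot)).map θ₀ ≫ _ = _ at e₁
  change (P.map (t.map top)).map θ₀ ≫ _ = _ at e₂
  rw [← cancel_mono ((P.map (t.map top)).map e'.hom),
    ← cancel_mono (Z'.iso top d s (Subsingleton.elim _ _)).hom]
  simp only [Category.assoc]
  rw [← h'.comm bot top s, ← Functor.map_comp_assoc, ← Functor.map_comp_assoc, ← hf₀,
    Functor.map_comp, Functor.map_comp, Category.assoc, Category.assoc, e₁, e₂,
    reassoc_of% h.comm bot top s]

theorem Compatible.nonempty_algebraIso
    (H : P.GlueBijective adj (t.map bot) (t.map top) (Subsingleton.elim _ _))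
    (h : Compatible N Z e) (h' : Compatible N' Z' e')
    (τ : ∀ (i : SimplexCategory) (s : x ⟶ t.obj i), Z.obj i s ≅ Z'.obj i s)
    (hτ : ∀ {i k : SimplexCategory} (g : i ⟶ k) (s : x ⟶ t.obj i) (s' : x ⟶ t.obj k)
        (h : s ≫ t.map g = s'), ((P.restrict t).map g).map (τ i s).hom ≫ (Z'.iso g s s' h).hom =
          (Z.iso g s s' h).hom ≫ (τ k s').hom) :
    Nonempty (N ≅ N') := by
  obtain ⟨f, hf⟩ := h.exists_algebraHom H h' (fun i s => (τ i s).hom) hτ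
  have hf' : f.f = e.hom ≫ (τ _ d).hom ≫ e'.inv := by
    rw [← Category.assoc, Iso.eq_comp_inv]
    exact hf.symm
  have : IsIso f.f := by
    rw [hf']
    infer_instance
  have : IsIso f := Monad.algebra_iso_of_iso adj.toMonad f
  exact ⟨asIso f⟩

end Simplicial
end CatSystem
end FormalDescent

/-! ### Coherent families of 1-cells and pointwise Kan extensions. -/

namespace FormalDescent
open CatSystem

section
variable {H : Type u} [Bicategory.{w, v} H]

/-- The hom-categories form a `CatSystem` directly and through the representable pseudofunctor.
Agreement of the constraints lets the Kan property, stated for the latter, be used with gluing,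
stated for the former. -/
theorem ofCat_coyoneda_γ {J : Type u₁} [Category.{v₁} J] (R : LocallyDiscrete J ⥤ᵖ H) (X : H)
    {a b c : J} (f : a ⟶ b) (g : b ⟶ c) (h : a ⟶ c) (e : f ≫ g = h) (x : X ⟶ R.obj ⟨a⟩) :
    ((ofCat (R.comp (coyoneda X))).γ f g h e x).hom = ((ofHom R X).γ f g h e x).hom := by
  subst e
  rw [ofHom_γ_hom]
  have h1 := congrArg (fun q : R.map (f.toLoc ≫ g.toLoc) ≅ R.map f.toLoc ≫ R.map g.toLoc =>
    (α_ x (R.map f.toLoc) (R.map g.toLoc)).hom ≫ x ◁ q.inv) (R.mapComp'_eq_mapComp f.toLoc g.toLoc)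
  refine Eq.trans ?_ h1.symm
  exact congrArg (fun q : (R.comp (coyoneda X)).map (f.toLoc ≫ g.toLoc) ≅
    (R.comp (coyoneda X)).map f.toLoc ≫ (R.comp (coyoneda X)).map g.toLoc => q.inv.toNatTrans.app x)
    ((R.comp (coyoneda X)).mapComp'_eq_mapComp f.toLoc g.toLoc)

theorem ofCat_restrict_coyoneda_γ {I : Type u₁} [Category.{v₁} I] {J : Type u₂} [Category.{v₂} J]
    (t : I ⥤ J) (A : LocallyDiscrete J ⥤ᵖ H) (X : H)
    {a b c : I} (f : a ⟶ b) (g : b ⟶ c) (h : a ⟶ c) (e : f ≫ g = h) (x : X ⟶ A.obj ⟨t.obj a⟩) :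
    ((ofCat ((t.toPseudofunctor.comp A).comp (coyoneda X))).γ f g h e x).hom =
      (((ofHom A X).restrict t).γ f g h e x).hom := by
  subst e
  have h0 : (t.toPseudofunctor.comp A).mapComp f.toLoc g.toLoc =
    A.mapComp' (t.map f).toLoc (t.map g).toLoc (t.map (f ≫ g)).toLoc
      (toLoc_comp (t.map_comp f g).symm) := by
    ext
    change A.map₂ _ ≫ _ = A.map₂ _ ≫ _
    congr 2
  have h1 := congrArg (fun q : A.map (t.map (f ≫ g)).toLoc ≅ A.map (t.map f).toLoc ≫ A.map (t.map g).toLoc =>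
    (α_ x (A.map (t.map f).toLoc) (A.map (t.map g).toLoc)).hom ≫ x ◁ q.inv) h0
  refine Eq.trans ?_ h1
  exact congrArg (fun q : ((t.toPseudofunctor.comp A).comp (coyoneda X)).map (f.toLoc ≫ g.toLoc) ≅
    ((t.toPseudofunctor.comp A).comp (coyoneda X)).map f.toLoc ≫
      ((t.toPseudofunctor.comp A).comp (coyoneda X)).map g.toLoc => q.inv.toNatTrans.app x)
    (((t.toPseudofunctor.comp A).comp (coyoneda X)).mapComp'_eq_mapComp f.toLoc g.toLoc)

/-- The pasting of a square with a composition constraint, restricted along a 1-cell. -/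
def paste {X r₀ r₁ r₂ a₁ a₂ : H} (z : X ⟶ r₀) {s : r₀ ⟶ r₁} {r : r₁ ⟶ r₂} {s' : r₀ ⟶ r₂}
    (m : s ≫ r ⟶ s') {k : r₁ ⟶ a₁} {k' : r₂ ⟶ a₂} {a : a₁ ⟶ a₂} (n : k ≫ a ⟶ r ≫ k') :
    ((z ≫ s) ≫ k) ≫ a ⟶ (z ≫ s') ≫ k' :=
  (α_ (z ≫ s) k a).hom ≫ (z ≫ s) ◁ n ≫ (α_ (z ≫ s) r k').inv ≫
    ((α_ z s r).hom ≫ z ◁ m) ▷ k'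

/-- Up to unitors and associators, the transitions of the family of `z` are those of the family of
the identity, whiskered with `z`. -/
theorem paste_id {X r₀ r₁ r₂ a₁ a₂ : H} (z : X ⟶ r₀) {s : r₀ ⟶ r₁} {r : r₁ ⟶ r₂} {s' : r₀ ⟶ r₂}
    (m : s ≫ r ⟶ s') {k : r₁ ⟶ a₁} {k' : r₂ ⟶ a₂} {a : a₁ ⟶ a₂} (n : k ≫ a ⟶ r ≫ k') :
    (z ◁ (λ_ s).hom ▷ k ≫ (α_ z s k).inv) ▷ a ≫ paste z m n =
      (α_ z ((𝟙 r₀ ≫ s) ≫ k) a).hom ≫ z ◁ paste (𝟙 r₀) m n ≫ z ◁ (λ_ s').hom ▷ k' ≫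
        (α_ z s' k').inv := by
  dsimp only [paste]
  calc
    _ = 𝟙 _ ⊗≫ z ◁ s ◁ n ⊗≫ z ◁ m ▷ k' ⊗≫ 𝟙 _ := by bicategory
    _ = 𝟙 _ ⊗≫ z ◁ ((𝟙 r₀ ≫ s) ◁ n) ⊗≫ z ◁ (𝟙 r₀ ◁ m) ▷ k' ⊗≫ 𝟙 _ := by
      rw [id_whiskerLeft, comp_whiskerLeft, id_whiskerLeft]
      bicategory
    _ = _ := by bicategory

end

section
variable {H : Type u} [Bicategory.{w, v} H]
  {I : Type u₁} [Category.{v₁} I] {J : Type u₂} [Category.{0} J] {t : I ⥤ J}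
  {R A : LocallyDiscrete J ⥤ᵖ H} (κ : t.toPseudofunctor.comp R ⟶ t.toPseudofunctor.comp A)
  {x : J} {X : H}

/-- The coherent family of 1-cells `κ (R(s) z)`. -/
def imageCone (z : X ⟶ R.obj ⟨x⟩) : PseudoCone x t ((ofHom A X).restrict t) where
  obj i s := (z ≫ R.map s.toLoc) ≫ κ.app ⟨i⟩
  iso f s s' h := (PseudoCone.image (whiskerCounit κ (coyoneda X)) z).iso f s s' h
  comp f g fg h s s' s'' hf hg hfg :=
    ((PseudoCone.image (whiskerCounit κ (coyoneda X)) z).comp f g fg h s s' s'' hf hg hfg).trans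
      (congrArg (· ≫ _) (ofCat_restrict_coyoneda_γ t A X f g fg h _))

theorem imageCone_iso (z : X ⟶ R.obj ⟨x⟩) {i k : I} (f : i ⟶ k) (s : x ⟶ t.obj i)
    (s' : x ⟶ t.obj k) (h : s ≫ t.map f = s') :
    ((imageCone κ z).iso f s s' h).hom =
      paste z (R.mapComp' s.toLoc (t.map f).toLoc s'.toLoc (toLoc_comp h)).inv
        (κ.naturality f.toLoc).inv := by
  refine (PseudoCone.image_iso (whiskerCounit κ (coyoneda X)) z f s s' h).trans ?_
  have h1 := congrArg (fun q => q ▷ κ.app ⟨k⟩) (ofCat_coyoneda_γ R X s (t.map f) s' h z)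
  refine (congrArg (_ ≫ ·) h1).trans ?_
  refine (Category.assoc _ _ _).trans ((Category.assoc _ _ _).trans ?_)
  rfl

variable {κ}

/-- The transport of a coherent family of 1-cells to category-valued pseudofunctors. -/
def coneToCat (Z : PseudoCone x t ((ofHom A X).restrict t)) :
    PseudoCone x t (ofCat ((t.toPseudofunctor.comp A).comp (coyoneda X))) where
  obj := Z.obj
  iso f s s' h := Z.iso f s s' h
  comp f g fg h s s' s'' hf hg hfg := (Z.comp f g fg h s s' s'' hf hg hfg).trans
      (congrArg (· ≫ _) (ofCat_restrict_coyoneda_γ t A X f g fg h _).symm)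

theorem imageCone_naturality {z z' : X ⟶ R.obj ⟨x⟩} (η : z ⟶ z') {i k : I} (f : i ⟶ k)
    (s : x ⟶ t.obj i) (s' : x ⟶ t.obj k) (h : s ≫ t.map f = s') :
    (η ▷ R.map s.toLoc) ▷ κ.app ⟨i⟩ ▷ A.map (t.map f).toLoc ≫ ((imageCone κ z').iso f s s' h).hom =
      ((imageCone κ z).iso f s s' h).hom ≫ (η ▷ R.map s'.toLoc) ▷ κ.app ⟨k⟩ :=
  PseudoCone.ofTrans_naturality ((kanFunctor (whiskerCounit κ (coyoneda X)) _).map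
    (PseudoCone.ofObjHom η)) f s s' h

theorem imageCone_hom_ext (hκ : IsRightKan (whiskerCounit κ (coyoneda X)))
    {z z' : X ⟶ R.obj ⟨x⟩} {η η' : z ⟶ z'}
    (h : ∀ (i : I) (s : x ⟶ t.obj i),
      (η ▷ R.map s.toLoc) ▷ κ.app ⟨i⟩ = (η' ▷ R.map s.toLoc) ▷ κ.app ⟨i⟩) : η = η' :=
  PseudoCone.hom_ext hκ h

theorem imageCone_exists_hom (hκ : IsRightKan (whiskerCounit κ (coyoneda X)))
    {z z' : X ⟶ R.obj ⟨x⟩}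
    (θ : ∀ (i : I) (s : x ⟶ t.obj i), (imageCone κ z).obj i s ⟶ (imageCone κ z').obj i s)
    (hθ : ∀ {i k : I} (f : i ⟶ k) (s : x ⟶ t.obj i) (s' : x ⟶ t.obj k) (h : s ≫ t.map f = s'),
      (((ofHom A X).restrict t).map f).map (θ i s) ≫ ((imageCone κ z').iso f s s' h).hom =
        ((imageCone κ z).iso f s s' h).hom ≫ θ k s') :
    ∃ η : z ⟶ z', ∀ (i : I) (s : x ⟶ t.obj i), (η ▷ R.map s.toLoc) ▷ κ.app ⟨i⟩ = θ i s :=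
  PseudoCone.exists_hom hκ θ hθ

theorem imageCone_exists_obj (hκ : IsRightKan (whiskerCounit κ (coyoneda X)))
    (Z : PseudoCone x t ((ofHom A X).restrict t)) :
    ∃ (z : X ⟶ R.obj ⟨x⟩) (τ : ∀ (i : I) (s : x ⟶ t.obj i), (imageCone κ z).obj i s ≅ Z.obj i s),
      ∀ {i k : I} (f : i ⟶ k) (s : x ⟶ t.obj i) (s' : x ⟶ t.obj k) (h : s ≫ t.map f = s'),
      (((ofHom A X).restrict t).map f).map (τ i s).hom ≫ (Z.iso f s s' h).hom =
        ((imageCone κ z).iso f s s' h).hom ≫ (τ k s').hom :=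
  PseudoCone.exists_obj hκ (coneToCat Z)

end
end FormalDescent

/-! ### The universal algebra on the Kan extension. -/

namespace FormalDescent
open CatSystem

section
variable {H : Type u} [Bicategory.{w, v} H]

theorem whiskerLeft_glue {X E x y y' : H} {l : y ⟶ x} {r : x ⟶ y} (c : 𝟙 y ⟶ l ≫ r) (z : X ⟶ E)
    (M : E ⟶ y) (a : (M ≫ l) ≫ r ⟶ M) {b b' : y ⟶ y'} {k : x ⟶ y'} (m : r ≫ b ⟶ k)
    (m' : k ⟶ r ≫ b') :
    ((ρ_ (z ≫ M)).inv ≫ (z ≫ M) ◁ c ≫ (α_ (z ≫ M) l r).inv) ▷ b ≫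
      (((α_ ((z ≫ M) ≫ l) r b).hom ≫ ((z ≫ M) ≫ l) ◁ m) ≫
        ((z ≫ M) ≫ l) ◁ m' ≫ (α_ ((z ≫ M) ≫ l) r b').inv) ≫
      ((α_ z M l).hom ▷ r ≫ (α_ z (M ≫ l) r).hom ≫ z ◁ a) ▷ b' =
    (α_ z M b).hom ≫ z ◁ (((ρ_ M).inv ≫ M ◁ c ≫ (α_ M l r).inv) ▷ b ≫
      (((α_ (M ≫ l) r b).hom ≫ (M ≫ l) ◁ m) ≫ (M ≫ l) ◁ m' ≫ (α_ (M ≫ l) r b').inv) ≫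
        a ▷ b') ≫ (α_ z M b').inv := by
  simp only [comp_whiskerLeft]
  bicategory

variable {J : Type u₁} [Category.{v₁} J] (A : LocallyDiscrete J ⥤ᵖ H)

/-- Unit, constraints and action of a restricted algebra are all whiskerings with `z`, hence so is
its gluing morphism. -/
theorem glue_algPrecomp {a b n : J} {d : a ⟶ b} {l : A.obj ⟨b⟩ ⟶ A.obj ⟨a⟩}
    (adj : Bicategory.Adjunction l (A.map d.toLoc)) {E X : H}
    (N : (homAdj adj E).toMonad.Algebra) (z : X ⟶ E) (w w' : b ⟶ n) (h : d ≫ w = d ≫ w') :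
    (ofHom A X).glue (d := d) (homAdj adj X) w w' h
      ((ofHom A X).act (d := d) (homAdj adj X) ((algPrecomp adj N X).obj z)) =
    (α_ z N.A (A.map w.toLoc)).hom ≫
      z ◁ (ofHom A E).glue (d := d) (homAdj adj E) w w' h ((ofHom A E).act (d := d) _ N) ≫
        (α_ z N.A (A.map w'.toLoc)).inv :=
  whiskerLeft_glue adj.unit z N.A N.a
    (A.mapComp' d.toLoc w.toLoc (d ≫ w).toLoc (toLoc_comp rfl)).inv
    (A.mapComp' d.toLoc w'.toLoc (d ≫ w).toLoc (toLoc_comp h.symm)).hom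

end

section
variable {H : Type u} [Bicategory.{w, v} H]
  {J : Type u₂} [Category.{0} J] {t : SimplexCategory ⥤ J}
  {R A : LocallyDiscrete J ⥤ᵖ H} {κ : t.toPseudofunctor.comp R ⟶ t.toPseudofunctor.comp A}
  {x : J} {d : x ⟶ t.obj (SimplexCategory.mk 0)}
  {l : A.obj ⟨t.obj (SimplexCategory.mk 0)⟩ ⟶ A.obj ⟨x⟩}
  {adj : Bicategory.Adjunction l (A.map d.toLoc)}

/-- The identification of the restriction of an algebra along a 1-cell. -/
def restrictIso {X E y r₁ : H} (z : X ⟶ E) {s : E ⟶ r₁} {k : r₁ ⟶ y} {M : E ⟶ y}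
    (e : M ≅ (𝟙 E ≫ s) ≫ k) : z ≫ M ≅ (z ≫ s) ≫ k :=
  whiskerLeftIso z (e ≪≫ whiskerRightIso (λ_ s) k) ≪≫ (α_ z s k).symm

theorem restrictIso_naturality {X E y r₁ : H} {z z' : X ⟶ E} (η : z ⟶ z') {s : E ⟶ r₁}
    {k : r₁ ⟶ y} {M : E ⟶ y} (e : M ≅ (𝟙 E ≫ s) ≫ k) :
    η ▷ M ≫ (restrictIso z' e).hom = (restrictIso z e).hom ≫ η ▷ s ▷ k := by
  simp only [restrictIso, Iso.trans_hom, whiskerLeftIso_hom, Iso.symm_hom, Category.assoc]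
  rw [← associator_inv_naturality_left, ← whisker_exchange_assoc]

theorem restrictIso_paste {X r₀ r₁ r₂ a₁ a₂ : H} (z : X ⟶ r₀) {s : r₀ ⟶ r₁} {r : r₁ ⟶ r₂}
    {s' : r₀ ⟶ r₂} (m : s ≫ r ⟶ s') {k : r₁ ⟶ a₁} {k' : r₂ ⟶ a₂} {a : a₁ ⟶ a₂}
    (n : k ≫ a ⟶ r ≫ k') {M : r₀ ⟶ a₁} (e : M ≅ (𝟙 r₀ ≫ s) ≫ k) :
    (restrictIso z e).hom ▷ a ≫ paste z m n = (α_ z M a).hom ≫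
      z ◁ (e.hom ▷ a ≫ paste (𝟙 r₀) m n) ≫ z ◁ (λ_ s').hom ▷ k' ≫ (α_ z s' k').inv := by
  have h := paste_id z m n
  simp only [restrictIso, Iso.trans_hom, whiskerLeftIso_hom, Iso.symm_hom, whiskerRightIso_hom,
    Bicategory.whiskerLeft_comp, Category.assoc]
  simp only [comp_whiskerRight, Category.assoc] at h ⊢
  rw [h]
  simp

theorem whiskerLeft_comp_aux {X E y a : H} (z : X ⟶ E) {M : E ⟶ y} {p : y ⟶ a}
    {q : y ⟶ a} {c : E ⟶ a} (g : M ≫ p ⟶ M ≫ q) (h : M ≫ q ⟶ c) {c' : X ⟶ a} (k : z ≫ c ⟶ c') :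
    (α_ z M p).hom ≫ z ◁ (g ≫ h) ≫ k =
      ((α_ z M p).hom ≫ z ◁ g ≫ (α_ z M q).inv) ≫ (α_ z M q).hom ≫ z ◁ h ≫ k := by
  simp

theorem restrictIso_imageCone {X : H} (z : X ⟶ R.obj ⟨x⟩) {M : R.obj ⟨x⟩ ⟶ A.obj ⟨t.obj (SimplexCategory.mk 0)⟩}
    (e : M ≅ (𝟙 (R.obj ⟨x⟩) ≫ R.map d.toLoc) ≫ κ.app ⟨SimplexCategory.mk 0⟩)
    {n : SimplexCategory} (f : SimplexCategory.mk 0 ⟶ n) (s : x ⟶ t.obj n) (h : d ≫ t.map f = s) :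
    (restrictIso z e).hom ▷ A.map (t.map f).toLoc ≫ ((imageCone κ z).iso f d s h).hom =
      (α_ z M (A.map (t.map f).toLoc)).hom ≫ z ◁ (e.hom ▷ A.map (t.map f).toLoc ≫
        ((imageCone κ (𝟙 (R.obj ⟨x⟩))).iso f d s h).hom) ≫ z ◁ (λ_ (R.map s.toLoc)).hom ▷ κ.app ⟨n⟩ ≫
        (α_ z (R.map s.toLoc) (κ.app ⟨n⟩)).inv := by
  rw [imageCone_iso, imageCone_iso]
  exact restrictIso_paste z (R.mapComp' d.toLoc (t.map f).toLoc s.toLoc (toLoc_comp h)).inv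
    (κ.naturality f.toLoc).inv e

variable [hx : ∀ n, Subsingleton (x ⟶ t.obj n)]

/-- Both the restricted algebra and the family of `z` come by whiskering with `z` from the universal
case `z = 𝟙`, so compatibility there suffices; it need only be checked on the edge. -/
theorem compatible_algPrecomp {N : (homAdj adj (R.obj ⟨x⟩)).toMonad.Algebra}
    {e : N.A ≅ (𝟙 (R.obj ⟨x⟩) ≫ R.map d.toLoc) ≫ κ.app ⟨SimplexCategory.mk 0⟩}
    (h : Compatible (P := ofHom A (R.obj ⟨x⟩)) (d := d) (adj := homAdj adj (R.obj ⟨x⟩)) N (imageCone κ (𝟙 (R.obj ⟨x⟩))) e) {X : H}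
    (z : X ⟶ R.obj ⟨x⟩) :
    Compatible (P := ofHom A X) (d := d) (adj := homAdj adj X) ((algPrecomp adj N X).obj z)
      (imageCone κ z) (restrictIso z e) := by
  refine Compatible.of_edge (P := ofHom A X) (d := d) (adj := homAdj adj X) (d ≫ t.map bot) ?_
  refine (restrictIso_imageCone z e bot (d ≫ t.map bot) rfl).trans ?_
  have h1 := h.comm bot top (d ≫ t.map bot)
  refine (congrArg (fun q => (α_ z N.A (A.map (t.map bot).toLoc)).hom ≫ z ◁ q ≫ _) h1).trans ?_
  refine Eq.trans ?_ (congrArg₂ (· ≫ ·)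
    (glue_algPrecomp A adj N z (t.map bot) (t.map top) (Subsingleton.elim _ _))
    (restrictIso_imageCone z e top (d ≫ t.map bot) (Subsingleton.elim _ _))).symm
  exact whiskerLeft_comp_aux z _ _ _

/-- 1-cells into the Kan extension are coherent families by the pointwise property, and coherent
families are algebras by gluing. Compatibility of `N` with the family of the identity says that
restriction of `N` realizes this correspondence. -/
theorem algPrecomp_isEquivalence {N : (homAdj adj (R.obj ⟨x⟩)).toMonad.Algebra}
    {e : N.A ≅ (𝟙 (R.obj ⟨x⟩) ≫ R.map d.toLoc) ≫ κ.app ⟨SimplexCategory.mk 0⟩}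
    (h : Compatible (P := ofHom A (R.obj ⟨x⟩)) (d := d) (adj := homAdj adj (R.obj ⟨x⟩)) N (imageCone κ (𝟙 (R.obj ⟨x⟩))) e) {X : H}
    (hκ : IsRightKan (whiskerCounit κ (coyoneda X)))
    (H₁ : (ofHom A X).GlueBijective (d := d) (homAdj adj X) (t.map bot) (t.map top)
      (Subsingleton.elim _ _)) :
    (algPrecomp adj N X).IsEquivalence where
  faithful := ⟨fun {z z'} η η' hη => by
    have hd : η ▷ R.map d.toLoc ▷ κ.app ⟨SimplexCategory.mk 0⟩ =
        η' ▷ R.map d.toLoc ▷ κ.app ⟨SimplexCategory.mk 0⟩ := by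
      have h₁ : η ▷ N.A = η' ▷ N.A := congrArg (fun q => Monad.Algebra.Hom.f q) hη
      have h₂ := restrictIso_naturality η e
      rw [h₁, restrictIso_naturality η' e] at h₂
      exact ((Iso.cancel_iso_hom_left _ _ _).1 h₂).symm
    refine imageCone_hom_ext hκ fun i s => ?_
    -- Every simplex receives a vertex, so the component at the point determines all the others.
    have h₁ := imageCone_naturality (κ := κ) η (vertex 0) d s (Subsingleton.elim _ _)
    have h₂ := imageCone_naturality (κ := κ) η' (vertex 0) d s (Subsingleton.elim _ _)
    rw [hd] at h₁
    exact (Iso.cancel_iso_hom_left _ _ _).1 (h₁.symm.trans h₂)⟩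
  full := ⟨fun {z z'} f => by
    obtain ⟨θ, hθ, hf⟩ := Compatible.exists_family (compatible_algPrecomp h z)
      (compatible_algPrecomp h z') f
    obtain ⟨η, hη⟩ := imageCone_exists_hom hκ θ hθ
    refine ⟨η, ?_⟩
    ext
    rw [← hη] at hf
    exact (Iso.cancel_iso_hom_right _ _ (restrictIso z' e)).1
      ((restrictIso_naturality η e).trans hf)⟩
  essSurj := ⟨fun N' => by
    obtain ⟨e', h'⟩ := exists_compatible (P := ofHom A X) (d := d) (adj := homAdj adj X) N'
    obtain ⟨z, τ, hτ⟩ := imageCone_exists_obj hκ (coneOfAlgebra (P := ofHom A X) (d := d) (homAdj adj X) N')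
    exact ⟨z, Compatible.nonempty_algebraIso H₁ (compatible_algPrecomp h z) h' τ hτ⟩⟩

end
end FormalDescent

/-! ### Retractions, restriction of algebras and uniqueness of Eilenberg–Moore objects. -/

namespace FormalDescent
open CatSystem

section
variable {H : Type u} [Bicategory.{w, v} H]

/-- The identification of `A` with its image under `η` followed by `κ` respects composition
constraints. The modification axiom `ht` moves the retraction past `af`, and compatibility of `η`
with composition, `hη`, does the rest. -/
theorem paste_retraction {ax ai ak rx ri rk : H} {as : ax ⟶ ai} {af : ai ⟶ ak} {as' : ax ⟶ ak}
    {rs : rx ⟶ ri} {rf : ri ⟶ rk} {rs' : rx ⟶ rk} {ηx : ax ⟶ rx} {ηi : ai ⟶ ri} {ηk : ak ⟶ rk}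
    {κi : ri ⟶ ai} {κk : rk ⟶ ak} (ηs : as ≫ ηi ≅ ηx ≫ rs) (ηf : af ≫ ηk ≅ ηi ≫ rf)
    (ηs' : as' ≫ ηk ≅ ηx ≫ rs') (n : rf ≫ κk ≅ κi ≫ af) (mA : as' ≅ as ≫ af)
    (mR : rs' ≅ rs ≫ rf) (ti : ηi ≫ κi ≅ 𝟙 ai) (tk : ηk ≫ κk ≅ 𝟙 ak)
    (hη : ηs'.hom ≫ ηx ◁ mR.hom = mA.hom ▷ ηk ≫ (α_ as af ηk).hom ≫ as ◁ ηf.hom ≫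
      (α_ as ηi rf).inv ≫ ηs.hom ▷ rf ≫ (α_ ηx rs rf).hom)
    (ht : af ◁ tk.hom ≫ (ρ_ af).hom ≫ (λ_ af).inv =
      ((α_ af ηk κk).inv ≫ ηf.hom ▷ κk ≫ (α_ ηi rf κk).hom ≫ ηi ◁ n.hom ≫ (α_ ηi κi af).inv) ≫
        ti.hom ▷ af) :
    ((ρ_ as).inv ≫ as ◁ ti.inv ≫ (α_ as ηi κi).inv ≫ ηs.hom ▷ κi) ▷ af ≫
        paste ηx mR.inv n.inv =
      mA.inv ≫ (ρ_ as').inv ≫ as' ◁ tk.inv ≫ (α_ as' ηk κk).inv ≫ ηs'.hom ▷ κk := by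
  have ht' : ti.inv ▷ af ≫ (α_ ηi κi af).hom ≫ ηi ◁ n.inv ≫ (α_ ηi rf κk).inv =
      (λ_ af).hom ≫ (ρ_ af).inv ≫ af ◁ tk.inv ≫ (α_ af ηk κk).inv ≫ ηf.hom ▷ κk := by
    have h1 : whiskerLeftIso af tk ≪≫ ρ_ af ≪≫ (λ_ af).symm =
        ((α_ af ηk κk).symm ≪≫ whiskerRightIso ηf κk ≪≫ α_ ηi rf κk ≪≫ whiskerLeftIso ηi n ≪≫
          (α_ ηi κi af).symm) ≪≫ whiskerRightIso ti af := by
      ext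
      simpa using ht
    have h2 := congrArg Iso.inv h1
    have h3 := congrArg (· ≫ (α_ af ηk κk).inv ≫ ηf.hom ▷ κk) h2
    simp only [Iso.trans_inv, Iso.symm_inv, whiskerLeftIso_inv, whiskerRightIso_inv,
      Category.assoc, Iso.hom_inv_id_assoc, inv_hom_whiskerRight, Category.comp_id] at h3
    exact h3.symm
  have hη' : as ◁ ηf.hom ≫ (α_ as ηi rf).inv ≫ ηs.hom ▷ rf ≫ (α_ ηx rs rf).hom ≫ ηx ◁ mR.inv =
      (α_ as af ηk).inv ≫ mA.inv ▷ ηk ≫ ηs'.hom := by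
    rw [← cancel_mono (ηx ◁ mR.hom)]
    simp [hη]
  calc
    _ = 𝟙 (as ≫ af) ⊗≫ as ◁ ti.inv ▷ af ⊗≫ (ηs.hom ▷ (κi ≫ af) ≫ (ηx ≫ rs) ◁ n.inv) ⊗≫
        ηx ◁ mR.inv ▷ κk ⊗≫ 𝟙 ((ηx ≫ rs') ≫ κk) := by
      dsimp only [paste]
      bicategory
    _ = 𝟙 (as ≫ af) ⊗≫ as ◁ (ti.inv ▷ af ≫ (α_ ηi κi af).hom ≫ ηi ◁ n.inv ≫ (α_ ηi rf κk).inv) ⊗≫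
        ηs.hom ▷ rf ▷ κk ⊗≫ ηx ◁ mR.inv ▷ κk ⊗≫ 𝟙 ((ηx ≫ rs') ≫ κk) := by
      rw [← whisker_exchange, comp_whiskerLeft]
      bicategory
    _ = 𝟙 (as ≫ af) ⊗≫ as ◁ af ◁ tk.inv ⊗≫ (as ◁ ηf.hom ≫ (α_ as ηi rf).inv ≫ ηs.hom ▷ rf ≫
        (α_ ηx rs rf).hom ≫ ηx ◁ mR.inv) ▷ κk := by
      rw [ht']
      bicategory
    _ = 𝟙 (as ≫ af) ⊗≫ ((as ≫ af) ◁ tk.inv ≫ mA.inv ▷ (ηk ≫ κk)) ⊗≫ ηs'.hom ▷ κk := by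
      rw [hη', comp_whiskerLeft]
      bicategory
    _ = _ := by
      rw [whisker_exchange]
      bicategory

/-- A 1-cell whose postcomposition functors are equivalences is an equivalence. -/
theorem isEquiv₁_of_postcomp {x y : H} (f : x ⟶ y) (hf : ∀ X : H, (postcomp X f).IsEquivalence) :
    IsEquiv₁ f := by
  have h₁ := hf y
  have h₂ := hf x
  let g : y ⟶ x := (postcomp y f).objPreimage (𝟙 y)
  let e₁ : g ≫ f ≅ 𝟙 y := (postcomp y f).objObjPreimageIso (𝟙 y)
  let u' : (postcomp x f).obj (𝟙 x) ≅ (postcomp x f).obj (f ≫ g) :=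
    λ_ f ≪≫ (ρ_ f).symm ≪≫ (whiskerLeftIso f e₁).symm ≪≫ (α_ f g f).symm
  let u : 𝟙 x ≅ f ≫ g := (postcomp x f).preimageIso u'
  exact ⟨Equivalence.mkOfAdjointifyCounit u e₁, rfl⟩

variable {x y : H} {l : y ⟶ x} {r : x ⟶ y} {adj : Bicategory.Adjunction l r}

theorem precomp_algHom {X E : H} (f : X ⟶ E) {m m' : E ⟶ y} (a : (m ≫ l) ≫ r ⟶ m)
    (a' : (m' ≫ l) ≫ r ⟶ m') (g : m ⟶ m') (h : g ▷ l ▷ r ≫ a' = a ≫ g) :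
    (f ◁ g) ▷ l ▷ r ≫ (α_ f m' l).hom ▷ r ≫ (α_ f (m' ≫ l) r).hom ≫ f ◁ a' =
      ((α_ f m l).hom ▷ r ≫ (α_ f (m ≫ l) r).hom ≫ f ◁ a) ≫ f ◁ g := by
  calc
    _ = 𝟙 _ ⊗≫ f ◁ (g ▷ l ▷ r ≫ a') := by bicategory
    _ = _ := by
      rw [h]
      bicategory

theorem precomp_algComp {X Y E : H} (f : X ⟶ Y) (g : Y ⟶ E) {m : E ⟶ y}
    (a : (m ≫ l) ≫ r ⟶ m) :
    (α_ f g m).hom ▷ l ▷ r ≫ (α_ f (g ≫ m) l).hom ▷ r ≫ (α_ f ((g ≫ m) ≫ l) r).hom ≫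
      f ◁ ((α_ g m l).hom ▷ r ≫ (α_ g (m ≫ l) r).hom ≫ g ◁ a) =
    ((α_ (f ≫ g) m l).hom ▷ r ≫ (α_ (f ≫ g) (m ≫ l) r).hom ≫ (f ≫ g) ◁ a) ≫ (α_ f g m).hom := by
  simp only [comp_whiskerLeft]
  bicategory

/-- Restriction of a morphism of algebras along a 1-cell. -/
def algPrecompHom {E X : H} (f : X ⟶ E) {M M' : (homAdj adj E).toMonad.Algebra} (g : M ⟶ M') :
    (algPrecomp adj M X).obj f ⟶ (algPrecomp adj M' X).obj f where
  f := f ◁ g.f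
  h := precomp_algHom f M.a M'.a g.f g.h

/-- Restriction of an isomorphism of algebras along a 1-cell. -/
def algPrecompIso {E X : H} (f : X ⟶ E) {M M' : (homAdj adj E).toMonad.Algebra} (g : M ≅ M') :
    (algPrecomp adj M X).obj f ≅ (algPrecomp adj M' X).obj f where
  hom := algPrecompHom f g.hom
  inv := algPrecompHom f g.inv
  hom_inv_id := by
    ext
    have := congrArg (fun q : M ⟶ M => f ◁ q.f) g.hom_inv_id
    exact (Bicategory.whiskerLeft_comp f _ _).symm.trans (this.trans (whiskerLeft_id _ _))
  inv_hom_id := by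
    ext
    have := congrArg (fun q : M' ⟶ M' => f ◁ q.f) g.inv_hom_id
    exact (Bicategory.whiskerLeft_comp f _ _).symm.trans (this.trans (whiskerLeft_id _ _))

/-- Restriction of algebras is compatible with composition of 1-cells. -/
def algPrecompComp {E X Y : H} (f : X ⟶ Y) (g : Y ⟶ E) (M : (homAdj adj E).toMonad.Algebra) :
    (algPrecomp adj M X).obj (f ≫ g) ≅
      (algPrecomp adj ((algPrecomp adj M Y).obj g) X).obj f :=
  Monad.Algebra.isoMk (α_ f g M.A) (precomp_algComp f g M.a)

end
end FormalDescent

namespace FormalDescent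
open CatSystem

section
variable {H : Type u} [Bicategory.{w, v} H] {x y : H} {l : y ⟶ x} {r : x ⟶ y}
  {adj : Bicategory.Adjunction l r}

theorem whiskerRight_factor {x y e m : H} {p : x ⟶ e} {f : e ⟶ m} {q : x ⟶ m} {A R : m ⟶ y}
    {G : e ⟶ y} {s r : x ⟶ y} (φ : p ≫ f ⟶ q) (i : A ≅ R) (a : f ≫ A ⟶ G) (b : p ≫ G ⟶ s)
    (c : s ⟶ q ≫ A) (k : q ≫ R ⟶ r) (n : s ⟶ r)
    (hφ : φ ▷ A = (α_ p f A).hom ≫ p ◁ a ≫ b ≫ c) (hc : c ≫ q ◁ i.hom ≫ k = n) :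
    φ ▷ R ≫ k = (α_ p f R).hom ≫ p ◁ (f ◁ i.inv ≫ a) ≫ b ≫ n := by
  have h : φ ▷ R = (p ≫ f) ◁ i.inv ≫ φ ▷ A ≫ q ◁ i.hom := by
    rw [← whisker_exchange, whiskerLeft_inv_hom_assoc]
  rw [h, hφ, ← hc]
  simp

/-- Postcomposition with a 1-cell along which an algebra restricts to another one. -/
def postcompAlgPrecompIso {E E' : H} {M : (homAdj adj E).toMonad.Algebra}
    {N : (homAdj adj E').toMonad.Algebra} {f : E ⟶ E'} (a : (algPrecomp adj N E).obj f ≅ M)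
    (X : H) : postcomp X f ⋙ algPrecomp adj N X ≅ algPrecomp adj M X :=
  NatIso.ofComponents (fun g => algPrecompComp g f N ≪≫ algPrecompIso g a) fun {g g'} η => by
    have key : ∀ {b : E' ⟶ y} {c : E ⟶ y} (a : f ≫ b ⟶ c),
        η ▷ f ▷ b ≫ (α_ g' f b).hom ≫ g' ◁ a = ((α_ g f b).hom ≫ g ◁ a) ≫ η ▷ c := by
      intro b c a
      rw [associator_naturality_left_assoc, ← whisker_exchange, Category.assoc]
    ext
    exact key a.hom.f

/-- The Eilenberg-Moore factorization is equivalent to any factorization whose middle object has a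
universal algebra which restricts to the canonical one. -/
theorem EMObject.factorization_isEquivalent (E : EMObject adj) (Q : Factorization r)
    (N : (homAdj adj Q.mid).toMonad.Algebra) (hN : ∀ X, (algPrecomp adj N X).IsEquivalence)
    (i : N.A ≅ Q.right)
    (c : (algPrecomp adj N x).obj Q.left ≅ (Monad.comparison (homAdj adj x)).obj (𝟙 x))
    (hc : c.hom.f = Q.left ◁ i.hom ≫ Q.iso.hom ≫ (λ_ r).inv) :
    E.factorization.IsEquivalent Q := by
  have := hN E.obj
  have := hN x
  -- Universality of `N` classifies the algebra of `E` by a 1-cell `f`. Postcomposition with `f`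
  -- followed by restriction of `N` is restriction of `E.alg`, so `f` is an equivalence.
  obtain ⟨f, ⟨a⟩⟩ := Functor.EssSurj.mem_essImage (F := algPrecomp adj N E.obj) E.alg
  obtain ⟨e, rfl⟩ : IsEquiv₁ f := isEquiv₁_of_postcomp f fun X => by
    have := hN X
    have : (postcomp X f ⋙ algPrecomp adj N X).IsEquivalence :=
      Functor.isEquivalence_of_iso (postcompAlgPrecompIso a X).symm
    exact Functor.isEquivalence_of_comp_right (postcomp X f) (algPrecomp adj N X)
  let b : (algPrecomp adj E.alg x).obj E.comparison ≅
      (Monad.comparison (homAdj adj x)).obj (𝟙 x) :=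
    (algPrecomp adj E.alg x).asEquivalence.counitIso.app _
  -- Both 1-cells classify the canonical algebra, so full faithfulness supplies the 2-cell.
  let φ : E.comparison ≫ e.hom ≅ Q.left := (algPrecomp adj N x).preimageIso
    (algPrecompComp E.comparison e.hom N ≪≫ algPrecompIso E.comparison a ≪≫ b ≪≫ c.symm)
  have hφ : φ.hom ▷ N.A = (α_ E.comparison e.hom N.A).hom ≫ E.comparison ◁ a.hom.f ≫
      b.hom.f ≫ c.inv.f := by
    have h : (algPrecomp adj N x).map φ.hom = _ := (algPrecomp adj N x).map_preimage _
    exact congrArg (fun q => Monad.Algebra.Hom.f q) h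
  have hc' : c.inv.f ≫ Q.left ◁ i.hom ≫ Q.iso.hom = (λ_ r).hom := by
    have h₁ : c.inv.f ≫ c.hom.f = 𝟙 (𝟙 x ≫ r) :=
      congrArg (fun q => Monad.Algebra.Hom.f q) c.inv_hom_id
    have h₂ : ∀ {s t : x ⟶ y} (q : s ⟶ t) (m : t ⟶ r) (n : s ≅ r)
      (_ : q ≫ m ≫ n.inv = 𝟙 s), q ≫ m = n.hom := by
      intro s t q m n h
      rw [← Category.assoc, Iso.comp_inv_eq, Category.id_comp] at h
      exact h
    rw [hc] at h₁
    exact h₂ c.inv.f (Q.left ◁ i.hom ≫ Q.iso.hom) (λ_ r)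
      ((congrArg (c.inv.f ≫ ·) (Category.assoc _ _ _)).trans h₁)
  refine ⟨e, φ, (whiskerLeftIso e.hom i).symm ≪≫ (homAdj adj E.obj).toMonad.forget.mapIso a, ?_⟩
  exact whiskerRight_factor φ.hom i a.hom.f b.hom.f c.inv.f Q.iso.hom (λ_ r).hom hφ hc'

end
end FormalDescent

/-! ### The descent comparison classifies the canonical algebra. -/

namespace FormalDescent
open CatSystem

section
variable {H : Type u} [Bicategory.{w, v} H]

theorem naturality_mapComp' {B : Type u₁} [Bicategory.{w₁, v₁} B] {F G : B ⥤ᵖ H} (η : F ⟶ G)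
    [Strict B] {a b c : B} (f : a ⟶ b) (g : b ⟶ c) (h : a ⟶ c) (e : f ≫ g = h) :
    (η.naturality h).hom ≫ η.app a ◁ (G.mapComp' f g h e).hom =
      (F.mapComp' f g h e).hom ▷ η.app c ≫ (α_ _ _ _).hom ≫ F.map f ◁ (η.naturality g).hom ≫
        (α_ _ _ _).inv ≫ (η.naturality f).hom ▷ G.map g ≫ (α_ _ _ _).hom := by
  subst e
  rw [G.mapComp'_eq_mapComp, F.mapComp'_eq_mapComp]
  exact η.naturality_comp f g

variable {I : Type u₁} [Category.{v₁} I] {J : Type u₂} [Category.{0} J] {t : I ⥤ J}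
  {R A : LocallyDiscrete J ⥤ᵖ H} {κ : t.toPseudofunctor.comp R ⟶ t.toPseudofunctor.comp A}
  {η : A ⟶ R} (T : precompTrans t.toPseudofunctor η ≫ κ ≅ 𝟙 (t.toPseudofunctor.comp A))

/-- The identification of `A(s)` with the composite of `η`, `R(s)` and `κ`. -/
def retractionIso {x : J} {i : I} (s : x ⟶ t.obj i) :
    A.map s.toLoc ≅ (η.app ⟨x⟩ ≫ R.map s.toLoc) ≫ κ.app ⟨i⟩ :=
  (ρ_ _).symm ≪≫ whiskerLeftIso (A.map s.toLoc) (appIso T ⟨i⟩).symm ≪≫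
    (α_ (A.map s.toLoc) (η.app ⟨t.obj i⟩) (κ.app ⟨i⟩)).symm ≪≫
      whiskerRightIso (η.naturality s.toLoc) (κ.app ⟨i⟩)

/-- Shows that the family determined by the comparison at `x` is the family of the 1-cells `A(s)`
with the constraints of `A`. -/
theorem retractionIso_paste {x : J} {i k : I} (s : x ⟶ t.obj i) (f : i ⟶ k) (s' : x ⟶ t.obj k)
    (h : s ≫ t.map f = s') :
    (retractionIso T s).hom ▷ A.map (t.map f).toLoc ≫
        ((imageCone κ (η.app ⟨x⟩)).iso f s s' h).hom =
      (A.mapComp' s.toLoc (t.map f).toLoc s'.toLoc (toLoc_comp h)).inv ≫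
        (retractionIso T s').hom := by
  rw [imageCone_iso]
  exact paste_retraction (η.naturality s.toLoc) (η.naturality (t.map f).toLoc)
    (η.naturality s'.toLoc) (κ.naturality f.toLoc)
    (A.mapComp' s.toLoc (t.map f).toLoc s'.toLoc (toLoc_comp h))
    (R.mapComp' s.toLoc (t.map f).toLoc s'.toLoc (toLoc_comp h)) (appIso T ⟨i⟩) (appIso T ⟨k⟩)
    (naturality_mapComp' η _ _ _ (toLoc_comp h)) (T.hom.as.naturality f.toLoc)

end

section
variable {H : Type u} [Bicategory.{w, v} H]
  {J : Type u₂} [Category.{0} J] {t : SimplexCategory ⥤ J}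
  {R A : LocallyDiscrete J ⥤ᵖ H} {κ : t.toPseudofunctor.comp R ⟶ t.toPseudofunctor.comp A}
  {η : A ⟶ R} (T : precompTrans t.toPseudofunctor η ≫ κ ≅ 𝟙 (t.toPseudofunctor.comp A))
  {x : J} [hx : ∀ n, Subsingleton (x ⟶ t.obj n)] {d : x ⟶ t.obj (SimplexCategory.mk 0)}
  {l : A.obj ⟨t.obj (SimplexCategory.mk 0)⟩ ⟶ A.obj ⟨x⟩}
  (adj : Bicategory.Adjunction l (A.map d.toLoc))

theorem whiskerRight_leftUnitor_aux {x y z : H} {p : x ⟶ y} {q : x ⟶ y} {k : y ⟶ z} {s c : x ⟶ z}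
    (E : p ⟶ q) (m : p ≫ k ⟶ s) (E' : s ⟶ c) (i : q ≫ k ⟶ c) (h : E ▷ k ≫ i = m ≫ E') :
    ((λ_ p).hom ≫ E) ▷ k ≫ i = ((α_ (𝟙 x) p k).hom ≫ 𝟙 x ◁ m) ≫ (λ_ s).hom ≫ E' := by
  rw [comp_whiskerRight, Category.assoc, h]
  simp

/-- The counit glues to the canonical isomorphism built from the constraints of `A`, and
`retractionIso` carries those constraints to the transitions of the image family. -/
theorem compatible_comparison :
    Compatible (P := ofHom A (A.obj ⟨x⟩)) (d := d) (adj := homAdj adj (A.obj ⟨x⟩))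
      ((Monad.comparison (homAdj adj (A.obj ⟨x⟩))).obj (𝟙 (A.obj ⟨x⟩)))
      (imageCone κ (η.app ⟨x⟩)) (λ_ (A.map d.toLoc) ≪≫ retractionIso T d) where
  comm {n} a b s := by
    have key : ∀ c : SimplexCategory.mk 0 ⟶ n,
        ((λ_ (A.map d.toLoc)).hom ≫ (retractionIso T d).hom) ▷ A.map (t.map c).toLoc ≫
          ((imageCone κ (η.app ⟨x⟩)).iso c d s (Subsingleton.elim _ _)).hom =
        ((ofHom A (A.obj ⟨x⟩)).γ d (t.map c) s (Subsingleton.elim _ _) (𝟙 (A.obj ⟨x⟩))).hom ≫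
          (λ_ (A.map s.toLoc)).hom ≫ (retractionIso T s).hom :=
      fun c => whiskerRight_leftUnitor_aux _ _ _ _
        (retractionIso_paste T d c s (Subsingleton.elim _ _))
    have h₁ : (ofHom A (A.obj ⟨x⟩)).glue (d := d) (homAdj adj (A.obj ⟨x⟩)) (t.map a) (t.map b)
        (Subsingleton.elim _ _) ((ofHom A (A.obj ⟨x⟩)).act (d := d) _
          ((Monad.comparison (homAdj adj (A.obj ⟨x⟩))).obj (𝟙 (A.obj ⟨x⟩)))) = _ :=
      (ofHom A (A.obj ⟨x⟩)).glue_counit (d := d) (homAdj adj (A.obj ⟨x⟩)) (t.map a) (t.map b)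
        (Subsingleton.elim _ _) (𝟙 (A.obj ⟨x⟩))
    have h₂ := h₁.trans (congrArg Iso.hom ((ofHom A (A.obj ⟨x⟩)).can_eq (d := d) (t.map a)
      (t.map b) s (Subsingleton.elim _ _) (Subsingleton.elim _ _) (𝟙 (A.obj ⟨x⟩))))
    refine (key a).trans (Eq.trans ?_ (congrArg₂ (· ≫ ·) h₂ (key b)).symm)
    have aux : ∀ {p q r : A.obj ⟨x⟩ ⟶ A.obj ⟨t.obj n⟩} (g : p ≅ r) (g' : q ≅ r) {c} (k : r ⟶ c),
        g.hom ≫ k = (g ≪≫ g'.symm).hom ≫ g'.hom ≫ k := by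
      intro p q r g g' c k
      simp
    exact aux _ _ _

/-- The Eilenberg-Moore factorization of `A(d)` is equivalent to its descent factorization, if the
gluing functions are bijective. -/
theorem isEquivalent_of_glueBijective (K : RightPsKan t.toPseudofunctor (t.toPseudofunctor.comp A)) (hK : K.IsPointwise)
    (H₁ : ∀ X, (ofHom A X).GlueBijective (d := d) (homAdj adj X) (t.map bot) (t.map top)
      (Subsingleton.elim _ _))
    (H₂ : ∀ X, (ofHom A X).GlueInjective₂ (d := d) (homAdj adj X)
      (t.map (vertex (n := SimplexCategory.mk 2) 0)) (t.map (vertex 1)) (t.map (vertex 2))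
      (Subsingleton.elim _ _) (Subsingleton.elim _ _)) (E : EMObject adj) :
    E.factorization.IsEquivalent
      (K.factorization (x := ⟨x⟩) (b := ⟨SimplexCategory.mk 0⟩) d.toLoc) := by
  -- The universal algebra is the one belonging to the family of the identity 1-cell.
  obtain ⟨N, e, he⟩ := exists_algebra_of_cone (P := ofHom A (K.ran.obj ⟨x⟩)) (d := d)
    (adj := homAdj adj (K.ran.obj ⟨x⟩)) (H₁ _) (H₂ _) (imageCone K.counit (𝟙 (K.ran.obj ⟨x⟩)))
  have h := compatible_algPrecomp (adj := adj) he (K.comparison.app ⟨x⟩)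
  -- The restriction of `N` along the comparison and the canonical algebra are compatible with the
  -- same family, so the identity of that family induces a morphism between them.
  obtain ⟨c, hc⟩ := Compatible.exists_algebraHom (P := ofHom A (A.obj ⟨x⟩)) (d := d)
    (adj := homAdj adj (A.obj ⟨x⟩)) (H₁ _) h (compatible_comparison K.triangle adj)
    (fun i s => 𝟙 _) (fun f s s' h => (congrArg (· ≫ _) (CategoryTheory.Functor.map_id _ _)).trans
      ((Category.id_comp _).trans (Category.comp_id _).symm))
  have hc' : c.f = (restrictIso (K.comparison.app ⟨x⟩) e).hom ≫
      (λ_ (A.map d.toLoc) ≪≫ retractionIso K.triangle d).inv := by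
    have aux : ∀ {p q r : A.obj ⟨x⟩ ⟶ A.obj ⟨t.obj (SimplexCategory.mk 0)⟩} (f : p ⟶ q)
        (g : p ⟶ r) (m : r ≅ q) (_ : f ≫ 𝟙 q = g ≫ m.hom), g = f ≫ m.inv := by
      intro p q r f g m h
      rw [Iso.eq_comp_inv, ← h, Category.comp_id]
    exact aux _ c.f _ hc
  have hiso : IsIso c.f := by
    rw [hc']
    exact ((restrictIso (K.comparison.app ⟨x⟩) e) ≪≫
      (λ_ (A.map d.toLoc) ≪≫ retractionIso K.triangle d).symm).isIso_hom
  have hc'' : IsIso c := @Monad.algebra_iso_of_iso _ _ _ _ _ c hiso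
  refine E.factorization_isEquivalent _ N
    (fun X => algPrecomp_isEquivalence he (hK X) (H₁ X))
    (e ≪≫ whiskerRightIso (λ_ (K.ran.map d.toLoc)) (K.counit.app ⟨SimplexCategory.mk 0⟩))
    (@asIso _ _ _ _ c hc'') ?_
  refine hc'.trans ?_
  -- Once unfolded, the 2-cell of the descent factorization and the underlying 2-cell of `c` differ
  -- only in bracketing.
  have aux : ∀ {a₁ a₂ a₃ a₄ a₅ a₆ a₇ a₈ : A.obj ⟨x⟩ ⟶ A.obj ⟨t.obj (SimplexCategory.mk 0)⟩}
      (f₁ : a₁ ⟶ a₂) (f₂ : a₂ ⟶ a₃) (f₃ : a₃ ⟶ a₄) (f₄ : a₄ ⟶ a₅) (f₅ : a₅ ⟶ a₆) (f₆ : a₆ ⟶ a₇)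
      (f₇ : a₇ ⟶ a₈), (f₁ ≫ f₂) ≫ ((((f₃ ≫ f₄) ≫ f₅) ≫ f₆) ≫ f₇) =
        f₁ ≫ (f₂ ≫ f₃ ≫ f₄ ≫ f₅ ≫ f₆) ≫ f₇ := by
    intros
    simp only [Category.assoc]
  exact aux _ _ _ _ _ _ _

end
end FormalDescent

/-! ### Cofaces of finite ordinals and the décalage. -/

namespace FormalDescent
open CatSystem

instance (n : FinOrd) : Subsingleton (FinOrd.zero ⟶ n) :=
  ⟨fun _ _ => OrderHom.ext _ _ (funext fun i => Fin.elim0 i)⟩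

theorem j_map_bot : FinOrd.j.map bot = FinOrd.suc.map FinOrd.d :=
  OrderHom.ext _ _ (funext fun (i : Fin 1) => by fin_cases i; rfl)

theorem j_map_top : FinOrd.j.map top = FinOrd.d0.app FinOrd.one :=
  OrderHom.ext _ _ (funext fun (i : Fin 1) => by fin_cases i; rfl)

theorem j_map_vertex_zero : FinOrd.suc.map FinOrd.d ≫ FinOrd.suc.map (FinOrd.d0.app FinOrd.one) =
    FinOrd.j.map (vertex (n := SimplexCategory.mk 2) 0) :=
  OrderHom.ext _ _ (funext fun (i : Fin 1) => by fin_cases i; rfl)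

theorem j_map_vertex_one : FinOrd.suc.map FinOrd.d ≫ FinOrd.d0.app (FinOrd.suc.obj FinOrd.one) =
    FinOrd.j.map (vertex (n := SimplexCategory.mk 2) 1) :=
  OrderHom.ext _ _ (funext fun (i : Fin 1) => by fin_cases i; rfl)

theorem j_map_vertex_two : FinOrd.d0.app FinOrd.one ≫ FinOrd.suc.map (FinOrd.d0.app FinOrd.one) =
    FinOrd.j.map (vertex (n := SimplexCategory.mk 2) 2) :=
  OrderHom.ext _ _ (funext fun (i : Fin 1) => by fin_cases i; rfl)

section
variable {H : Type u} [Bicategory.{w, v} H] {A : LocallyDiscrete FinOrd ⥤ᵖ H}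

/-- The Beck-Chevalley condition for the décalage transformation makes gluing bijective. -/
theorem glueBijective_of_beckChevalley
    {l : ∀ b : LocallyDiscrete FinOrd, (FinOrd.suc.toPseudofunctor.comp A).obj b ⟶ A.obj b}
    {adj : ∀ b, Bicategory.Adjunction (l b) ((sucTrans A).app b)}
    (hA : ∀ {b c : LocallyDiscrete FinOrd} (f : b ⟶ c),
      SquareBeckChevalley (adj b) (adj c) ((sucTrans A).naturality f).inv) (m : FinOrd) (X : H) :
    (ofHom A X).GlueBijective (d := FinOrd.d0.app m) (homAdj (adj ⟨m⟩) X)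
      (FinOrd.suc.map (FinOrd.d0.app m)) (FinOrd.d0.app (FinOrd.suc.obj m))
      (FinOrd.d0.naturality (FinOrd.d0.app m)).symm :=
  glueBijective_ofHom A _ (adj ⟨m⟩) (adj ⟨FinOrd.suc.obj m⟩)
    ⟨congrArg Quiver.Hom.toLoc (FinOrd.d0.naturality (FinOrd.d0.app m))⟩
    (hA (FinOrd.d0.app m).toLoc) X

/-- If the décalage transformation satisfies the Beck-Chevalley condition, the Eilenberg-Moore
factorization of `A(d)` is equivalent to its descent factorization. -/
theorem isEquivalent_descentFactorization (hA : BeckChevalley (sucTrans A))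
    (K : RightPsKan jP (jP.comp A)) (hK : K.IsPointwise)
    {l : A.obj ⟨FinOrd.one⟩ ⟶ A.obj ⟨FinOrd.zero⟩}
    (adj : Bicategory.Adjunction l (A.map FinOrd.d.toLoc)) (E : EMObject adj) :
    E.factorization.IsEquivalent (descentFactorization A K) := by
  obtain ⟨L, adj', h⟩ := hA
  have : ∀ n, Subsingleton (FinOrd.zero ⟶ FinOrd.j.obj n) := fun n => inferInstance
  have H₁ : ∀ X, (ofHom A X).GlueBijective (d := FinOrd.d) (homAdj adj X)
      (FinOrd.suc.map FinOrd.d) (FinOrd.d0.app FinOrd.one) (Subsingleton.elim _ _) := fun X =>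
    -- The condition provides its own left adjoint of `A(d)`, while `adj` is arbitrary.
    (glueBijective_of_beckChevalley h FinOrd.zero X).of_adjunction (homAdj adj X)
  refine isEquivalent_of_glueBijective (t := FinOrd.j) (x := FinOrd.zero) (d := FinOrd.d) adj K hK
    (fun X => ?_) (fun X => ?_) E
  · have := H₁ X
    simp only [← j_map_bot, ← j_map_top] at this
    exact this
  -- The second square is the naturality square at `d⁰ : 1 ⟶ 2`; the composites of the cofaces are
  -- the three vertices of the 2-simplex.
  · have := (H₁ X).injective₂ (glueBijective_of_beckChevalley h FinOrd.one X) _ _ _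
      j_map_vertex_zero j_map_vertex_one j_map_vertex_two (Subsingleton.elim _ _)
      (Subsingleton.elim _ _)
    exact this

end
end FormalDescent

/-! ### Pseudonatural transformations whose components are equivalences. -/

namespace FormalDescent

section
variable {H : Type u} [Bicategory.{w, v} H]

theorem IsEquiv₁.isEquivalence_postcomp {x y : H} {f : x ⟶ y} (hf : IsEquiv₁ f) (X : H) :
    (postcomp X f).IsEquivalence := by
  obtain ⟨e, rfl⟩ := hf
  let i : postcomp X e.hom ⋙ postcomp X e.inv ≅ 𝟭 _ :=
    NatIso.ofComponents (fun g => α_ _ _ _ ≪≫ whiskerLeftIso g e.unit.symm ≪≫ ρ_ g)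
      fun {g g'} m => by
        change m ▷ e.hom ▷ e.inv ≫ (α_ _ _ _).hom ≫ g' ◁ e.unit.inv ≫ (ρ_ g').hom =
          ((α_ _ _ _).hom ≫ g ◁ e.unit.inv ≫ (ρ_ g).hom) ≫ m
        rw [associator_naturality_left_assoc, ← whisker_exchange_assoc, rightUnitor_naturality]
        simp only [Category.assoc]
  let j : postcomp X e.inv ⋙ postcomp X e.hom ≅ 𝟭 _ :=
    NatIso.ofComponents (fun g => α_ _ _ _ ≪≫ whiskerLeftIso g e.counit ≪≫ ρ_ g)
      fun {g g'} m => by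
        change m ▷ e.inv ▷ e.hom ≫ (α_ _ _ _).hom ≫ g' ◁ e.counit.hom ≫ (ρ_ g').hom =
          ((α_ _ _ _).hom ≫ g ◁ e.counit.hom ≫ (ρ_ g).hom) ≫ m
        rw [associator_naturality_left_assoc, ← whisker_exchange_assoc, rightUnitor_naturality]
        simp only [Category.assoc]
  exact (CategoryTheory.Equivalence.mk (postcomp X e.hom) (postcomp X e.inv) i.symm
    j).isEquivalence_functor

/-- The pasting of an invertible 2-cell with the pseudonaturality constraint of a transformation. -/
def pasteIso {sa fa fb ga gb : H} {αa : sa ⟶ fa} {Ff : fa ⟶ fb} {Gf : ga ⟶ gb} {ηa : fa ⟶ ga}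
    {ηb : fb ⟶ gb} {βa : sa ⟶ ga} (ηf : Ff ≫ ηb ≅ ηa ≫ Gf) (τa : αa ≫ ηa ≅ βa) :
    (αa ≫ Ff) ≫ ηb ≅ βa ≫ Gf :=
  α_ αa Ff ηb ≪≫ whiskerLeftIso αa ηf ≪≫ (α_ αa ηa Gf).symm ≪≫ whiskerRightIso τa Gf

theorem pasteIso_naturality {sa fa fb ga gb : H} {αa : sa ⟶ fa} {Ff Fg : fa ⟶ fb} {Gf Gg : ga ⟶ gb}
    {ηa : fa ⟶ ga} {ηb : fb ⟶ gb} {βa : sa ⟶ ga} (ηf : Ff ≫ ηb ≅ ηa ≫ Gf)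
    (ηg : Fg ≫ ηb ≅ ηa ≫ Gg) (τa : αa ≫ ηa ≅ βa) (φ : Ff ⟶ Fg) (ψ : Gf ⟶ Gg)
    (h : φ ▷ ηb ≫ ηg.hom = ηf.hom ≫ ηa ◁ ψ) :
    (αa ◁ φ) ▷ ηb ≫ (pasteIso ηg τa).hom = (pasteIso ηf τa).hom ≫ βa ◁ ψ := by
  calc
    _ = (α_ αa Ff ηb).hom ≫ αa ◁ (φ ▷ ηb ≫ ηg.hom) ≫ (α_ αa ηa Gg).inv ≫ τa.hom ▷ Gg := by
      simp [pasteIso]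
    _ = _ := by
      rw [h]
      simp only [pasteIso, Iso.trans_hom, whiskerLeftIso_hom, Iso.symm_hom, whiskerRightIso_hom,
        Bicategory.whiskerLeft_comp, Category.assoc]
      rw [← whisker_exchange, associator_inv_naturality_right_assoc]

variable {sa sb sc fa fb fc ga gb gc : H} {Sf : sa ⟶ sb} {Sg : sb ⟶ sc} {Sk : sa ⟶ sc}
  {Ff : fa ⟶ fb} {Fg : fb ⟶ fc} {Fk : fa ⟶ fc} {Gf : ga ⟶ gb} {Gg : gb ⟶ gc} {Gk : ga ⟶ gc}
  {αa : sa ⟶ fa} {αb : sb ⟶ fb} {αc : sc ⟶ fc} {ηa : fa ⟶ ga} {ηb : fb ⟶ gb} {ηc : fc ⟶ gc}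
  {βa : sa ⟶ ga} {βb : sb ⟶ gb} {βc : sc ⟶ gc}

/-- Interchange moves `qa` past the invertible constraint of `η`, which can then be cancelled. This
reflects the modification axiom. -/
theorem naturality_reflect {αa' : sa ⟶ fa} {αb' : sb ⟶ fb} (nf : Sf ≫ αb ≅ αa ≫ Ff)
    (nf' : Sf ≫ αb' ≅ αa' ≫ Ff) (ηf : Ff ≫ ηb ≅ ηa ≫ Gf) (qa : αa ⟶ αa') (qb : αb ⟶ αb')
    (h : Sf ◁ qb ▷ ηb ≫ (α_ Sf αb' ηb).inv ≫ nf'.hom ▷ ηb ≫ (α_ αa' Ff ηb).hom ≫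
      αa' ◁ ηf.hom ≫ (α_ αa' ηa Gf).inv = ((α_ Sf αb ηb).inv ≫ nf.hom ▷ ηb ≫ (α_ αa Ff ηb).hom ≫
        αa ◁ ηf.hom ≫ (α_ αa ηa Gf).inv) ≫ qa ▷ ηa ▷ Gf) :
    (Sf ◁ qb ≫ nf'.hom) ▷ ηb = (nf.hom ≫ qa ▷ Ff) ▷ ηb := by
  rw [← cancel_epi (α_ Sf αb ηb).inv, ← cancel_mono (α_ αa' Ff ηb).hom,
    ← cancel_mono (αa' ◁ ηf.hom), ← cancel_mono (α_ αa' ηa Gf).inv]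
  have e : qa ▷ Ff ▷ ηb ≫ (α_ αa' Ff ηb).hom ≫ αa' ◁ ηf.hom ≫ (α_ αa' ηa Gf).inv =
      (α_ αa Ff ηb).hom ≫ αa ◁ ηf.hom ≫ (α_ αa ηa Gf).inv ≫ qa ▷ ηa ▷ Gf := by
    rw [associator_naturality_left_assoc, ← whisker_exchange_assoc,
      associator_inv_naturality_left]
  simp only [Category.assoc] at h
  simp only [comp_whiskerRight, Category.assoc, e]
  rw [← h]
  simp

/-- This lemma and the next two reflect the axioms of a pseudonatural transformation: whiskering
with `η` is faithful, and after it the lifted constraints are expressed through those of `β`, for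
which the axioms hold. -/
theorem naturality_naturality_reflect [(postcomp sa ηb).Faithful] {Sg : sa ⟶ sb} {Fg : fa ⟶ fb}
    {Gg : ga ⟶ gb} (ηf : Ff ≫ ηb ≅ ηa ≫ Gf) (ηg : Fg ≫ ηb ≅ ηa ≫ Gg)
    (βf : Sf ≫ βb ⟶ βa ≫ Gf) (βg : Sg ≫ βb ⟶ βa ≫ Gg)
    (τa : αa ≫ ηa ≅ βa) (τb : αb ≫ ηb ≅ βb) (nf : Sf ≫ αb ⟶ αa ≫ Ff) (ng : Sg ≫ αb ⟶ αa ≫ Fg)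
    (hf : nf ▷ ηb ≫ (pasteIso ηf τa).hom = (α_ Sf αb ηb).hom ≫ Sf ◁ τb.hom ≫ βf)
    (hg : ng ▷ ηb ≫ (pasteIso ηg τa).hom = (α_ Sg αb ηb).hom ≫ Sg ◁ τb.hom ≫ βg)
    (s : Sf ⟶ Sg) (φ : Ff ⟶ Fg) (ψ : Gf ⟶ Gg) (hη : φ ▷ ηb ≫ ηg.hom = ηf.hom ≫ ηa ◁ ψ)
    (hβ : s ▷ βb ≫ βg = βf ≫ βa ◁ ψ) :
    s ▷ αb ≫ ng = nf ≫ αa ◁ φ := by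
  apply (postcomp sa ηb).map_injective
  change (s ▷ αb ≫ ng) ▷ ηb = (nf ≫ αa ◁ φ) ▷ ηb
  rw [← cancel_mono (pasteIso ηg τa).hom, comp_whiskerRight, comp_whiskerRight, Category.assoc,
    Category.assoc, pasteIso_naturality ηf ηg τa φ ψ hη, reassoc_of% hf, hg, ← hβ, associator_naturality_left_assoc, ← whisker_exchange_assoc]

theorem naturality_id_reflect [(postcomp sa ηa).Faithful] {Sf : sa ⟶ sa} {Ff : fa ⟶ fa}
    {Gf : ga ⟶ ga} (ηf : Ff ≫ ηa ≅ ηa ≫ Gf) (βf : Sf ≫ βa ⟶ βa ≫ Gf) (τa : αa ≫ ηa ≅ βa)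
    (nf : Sf ≫ αa ⟶ αa ≫ Ff)
    (hf : nf ▷ ηa ≫ (pasteIso ηf τa).hom = (α_ Sf αa ηa).hom ≫ Sf ◁ τa.hom ≫ βf)
    (s : Sf ⟶ 𝟙 sa) (φ : Ff ⟶ 𝟙 fa) (ψ : Gf ⟶ 𝟙 ga)
    (hη : ηf.hom ≫ ηa ◁ ψ = φ ▷ ηa ≫ (λ_ ηa).hom ≫ (ρ_ ηa).inv)
    (hβ : βf ≫ βa ◁ ψ = s ▷ βa ≫ (λ_ βa).hom ≫ (ρ_ βa).inv) :
    nf ≫ αa ◁ φ = s ▷ αa ≫ (λ_ αa).hom ≫ (ρ_ αa).inv := by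
  apply (postcomp sa ηa).map_injective
  change (nf ≫ αa ◁ φ) ▷ ηa = (s ▷ αa ≫ (λ_ αa).hom ≫ (ρ_ αa).inv) ▷ ηa
  rw [← cancel_mono (pasteIso (λ_ ηa ≪≫ (ρ_ ηa).symm) τa).hom, comp_whiskerRight, Category.assoc,
    pasteIso_naturality ηf _ τa φ ψ (by simpa using hη.symm), reassoc_of% hf, hβ,
    whisker_exchange_assoc]
  simp [pasteIso]

theorem naturality_comp_reflect [(postcomp sa ηc).Faithful]
    (ηf : Ff ≫ ηb ≅ ηa ≫ Gf) (ηg : Fg ≫ ηc ≅ ηb ≫ Gg) (ηk : Fk ≫ ηc ≅ ηa ≫ Gk)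
    (βf : Sf ≫ βb ⟶ βa ≫ Gf) (βg : Sg ≫ βc ⟶ βb ≫ Gg) (βk : Sk ≫ βc ⟶ βa ≫ Gk)
    (τa : αa ≫ ηa ≅ βa) (τb : αb ≫ ηb ≅ βb) (τc : αc ≫ ηc ≅ βc)
    (nf : Sf ≫ αb ⟶ αa ≫ Ff) (ng : Sg ≫ αc ⟶ αb ≫ Fg) (nk : Sk ≫ αc ⟶ αa ≫ Fk)
    (hf : nf ▷ ηb ≫ (pasteIso ηf τa).hom = (α_ Sf αb ηb).hom ≫ Sf ◁ τb.hom ≫ βf)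
    (hg : ng ▷ ηc ≫ (pasteIso ηg τb).hom = (α_ Sg αc ηc).hom ≫ Sg ◁ τc.hom ≫ βg)
    (hk : nk ▷ ηc ≫ (pasteIso ηk τa).hom = (α_ Sk αc ηc).hom ≫ Sk ◁ τc.hom ≫ βk)
    (s : Sk ⟶ Sf ≫ Sg) (φ : Fk ⟶ Ff ≫ Fg) (ψ : Gk ⟶ Gf ≫ Gg)
    (hη : ηk.hom ≫ ηa ◁ ψ = φ ▷ ηc ≫ (α_ Ff Fg ηc).hom ≫ Ff ◁ ηg.hom ≫ (α_ Ff ηb Gg).inv ≫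
      ηf.hom ▷ Gg ≫ (α_ ηa Gf Gg).hom)
    (hβ : βk ≫ βa ◁ ψ = s ▷ βc ≫ (α_ Sf Sg βc).hom ≫ Sf ◁ βg ≫ (α_ Sf βb Gg).inv ≫
      βf ▷ Gg ≫ (α_ βa Gf Gg).hom) :
    nk ≫ αa ◁ φ = s ▷ αc ≫ (α_ Sf Sg αc).hom ≫ Sf ◁ ng ≫ (α_ Sf αb Fg).inv ≫
      nf ▷ Fg ≫ (α_ αa Ff Fg).hom := by
  apply (postcomp sa ηc).map_injective
  change (nk ≫ αa ◁ φ) ▷ ηc = (s ▷ αc ≫ (α_ Sf Sg αc).hom ≫ Sf ◁ ng ≫ (α_ Sf αb Fg).inv ≫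
      nf ▷ Fg ≫ (α_ αa Ff Fg).hom) ▷ ηc
  let ηfg : (Ff ≫ Fg) ≫ ηc ≅ ηa ≫ Gf ≫ Gg := α_ Ff Fg ηc ≪≫ whiskerLeftIso Ff ηg ≪≫
    (α_ Ff ηb Gg).symm ≪≫ whiskerRightIso ηf Gg ≪≫ α_ ηa Gf Gg
  rw [← cancel_mono (pasteIso ηfg τa).hom, comp_whiskerRight, Category.assoc,
    pasteIso_naturality ηk ηfg τa φ ψ (by simpa [ηfg] using hη.symm), reassoc_of% hk, hβ,
    whisker_exchange_assoc]
  symm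
  calc
    _ = 𝟙 _ ⊗≫ s ▷ αc ▷ ηc ⊗≫ Sf ◁ ng ▷ ηc ⊗≫
        (nf ▷ (Fg ≫ ηc) ≫ (αa ≫ Ff) ◁ ηg.hom) ⊗≫ αa ◁ ηf.hom ▷ Gg ⊗≫ τa.hom ▷ Gf ▷ Gg ⊗≫
          𝟙 (βa ≫ Gf ≫ Gg) := by
      simp only [pasteIso, ηfg, Iso.trans_hom, whiskerLeftIso_hom, whiskerRightIso_hom,
        Iso.symm_hom, comp_whiskerLeft]
      bicategory
    _ = 𝟙 _ ⊗≫ s ▷ αc ▷ ηc ⊗≫ Sf ◁ ng ▷ ηc ⊗≫ (Sf ≫ αb) ◁ ηg.hom ⊗≫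
        (nf ▷ ηb ≫ (pasteIso ηf τa).hom) ▷ Gg ⊗≫ 𝟙 (βa ≫ Gf ≫ Gg) := by
      rw [← whisker_exchange]
      simp only [pasteIso, Iso.trans_hom, whiskerLeftIso_hom, whiskerRightIso_hom, Iso.symm_hom]
      bicategory
    _ = 𝟙 _ ⊗≫ s ▷ αc ▷ ηc ⊗≫ Sf ◁ (ng ▷ ηc ≫ (pasteIso ηg τb).hom) ⊗≫
        βf ▷ Gg ⊗≫ 𝟙 (βa ≫ Gf ≫ Gg) := by
      rw [hf]
      simp only [pasteIso, Iso.trans_hom, whiskerLeftIso_hom, whiskerRightIso_hom, Iso.symm_hom,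
        comp_whiskerLeft]
      bicategory
    _ = 𝟙 _ ⊗≫ (s ▷ (αc ≫ ηc) ≫ (Sf ≫ Sg) ◁ τc.hom) ⊗≫ Sf ◁ βg ⊗≫
        βf ▷ Gg ⊗≫ 𝟙 (βa ≫ Gf ≫ Gg) := by
      rw [hg, comp_whiskerLeft]
      bicategory
    _ = _ := by
      bicategory

end

section
variable {B : Type u₁} [Bicategory.{w₁, v₁} B] {H : Type u} [Bicategory.{w, v} H]
  {S F G : B ⥤ᵖ H}

/-- Essential surjectivity lifts the components of `β`, full faithfulness lifts its constraints
compatibly with the chosen isomorphisms, and faithfulness gives the axioms. -/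
theorem exists_postcomp_iso (η : F ⟶ G) (hη : ∀ a X, (postcomp X (η.app a)).IsEquivalence)
    (β : S ⟶ G) : ∃ α : S ⟶ F, Nonempty (α ≫ η ≅ β) := by
  have h : ∀ a, ∃ α : S.obj a ⟶ F.obj a, Nonempty (α ≫ η.app a ≅ β.app a) := fun a =>
    have := hη a (S.obj a)
    Functor.EssSurj.mem_essImage (F := postcomp (S.obj a) (η.app a)) (β.app a)
  choose α τ using h
  let τ a := (τ a).some
  have hn : ∀ {a b : B} (f : a ⟶ b), ∃ n : S.map f ≫ α b ≅ α a ≫ F.map f,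
      n.hom ▷ η.app b ≫ (pasteIso (η.naturality f) (τ a)).hom =
        (α_ _ _ _).hom ≫ S.map f ◁ (τ b).hom ≫ (β.naturality f).hom := by
    intro a b f
    have := hη b (S.obj a)
    let i : (S.map f ≫ α b) ≫ η.app b ≅ (α a ≫ F.map f) ≫ η.app b :=
      α_ _ _ _ ≪≫ whiskerLeftIso (S.map f) (τ b) ≪≫ β.naturality f ≪≫
        (pasteIso (η.naturality f) (τ a)).symm
    refine ⟨(postcomp (S.obj a) (η.app b)).preimageIso i, ?_⟩
    have h : ((postcomp (S.obj a) (η.app b)).preimageIso i).hom ▷ η.app b = i.hom :=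
      (postcomp (S.obj a) (η.app b)).map_preimage i.hom
    rw [h]
    simp [i]
  choose n hn using @hn
  let α' : S ⟶ F := {
    app := α
    naturality f := n f
    naturality_naturality {a b f g} θ :=
      have := hη b (S.obj a)
      naturality_naturality_reflect _ _ _ _ (τ a) (τ b) _ _ (hn f) (hn g) _ _ _
        (η.naturality_naturality θ) (β.naturality_naturality θ)
    naturality_id a :=
      have := hη a (S.obj a)
      naturality_id_reflect _ _ (τ a) _ (hn (𝟙 a)) _ _ _ (η.naturality_id a) (β.naturality_id a)
    naturality_comp {a b c} f g :=
      have := hη c (S.obj a)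
      naturality_comp_reflect _ _ _ _ _ _ (τ a) (τ b) (τ c) _ _ _ (hn f) (hn g) (hn (f ≫ g)) _ _ _
        (η.naturality_comp f g) (β.naturality_comp f g) }
  refine ⟨α', ⟨Pseudofunctor.StrongTrans.isoMk τ fun {a b} f => ?_⟩⟩
  have key : ∀ {p q r s' : S.obj a ⟶ G.obj b} (x : p ≅ q) (y : q ⟶ r) (z : p ⟶ s') (k : s' ⟶ r)
      (_ : z ≫ k = x.hom ≫ y), y = (x.inv ≫ z) ≫ k := by
    intro p q r s' x y z k h
    rw [Category.assoc, h, Iso.inv_hom_id_assoc]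
  have h := hn f
  simp only [pasteIso, Iso.trans_hom, whiskerRightIso_hom] at h
  rw [← Category.assoc, ← Category.assoc, ← Category.assoc] at h
  refine (key (α_ _ _ _) _ _ _ h).trans (congrArg (· ≫ _) ?_)
  simp only [Category.assoc]
  rfl

theorem postcomp_isEquivalence (η : F ⟶ G) (hη : ∀ a X, (postcomp X (η.app a)).IsEquivalence)
    (S : B ⥤ᵖ H) : (postcomp S η).IsEquivalence where
  faithful := ⟨fun {α β} m m' h => by
    ext a
    have := hη a (S.obj a)
    apply (postcomp (S.obj a) (η.app a)).map_injective
    exact congrArg (fun q => Pseudofunctor.StrongTrans.Modification.app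
      (Pseudofunctor.StrongTrans.Hom.as q) a) h⟩
  full := ⟨fun {α β} m => by
    have h : ∀ a, ∃ q : α.app a ⟶ β.app a, q ▷ η.app a = m.as.app a := fun a =>
      have := hη a (S.obj a)
      (postcomp (S.obj a) (η.app a)).map_surjective (m.as.app a)
    choose q hq using h
    refine ⟨⟨q, fun {a b} f => ?_⟩, ?_⟩
    · have := hη b (S.obj a)
      apply (postcomp (S.obj a) (η.app b)).map_injective
      have h := m.as.naturality f
      rw [← hq, ← hq] at h
      exact naturality_reflect (α.naturality f) (β.naturality f) (η.naturality f) (q a) (q b) h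
    · ext a
      exact hq a⟩
  essSurj := ⟨fun β => exists_postcomp_iso η hη β⟩

/-- A transformation whose components are equivalences is an equivalence. -/
theorem isEquiv₁_of_app (η : F ⟶ G) (hη : ∀ a, IsEquiv₁ (η.app a)) : IsEquiv₁ η :=
  isEquiv₁_of_postcomp η (postcomp_isEquivalence η fun a X => (hη a).isEquivalence_postcomp X)

end
end FormalDescent

/-! ### The universal arrow along a fully faithful functor, and the descent criteria. -/

namespace FormalDescent
open CatSystem

/-- A morphism at the initial stage extends to a morphism of coherent families. -/
theorem PseudoCone.exists_extension {I : Type u₁} [Category.{v₁} I] {J : Type u₂} [Category.{0} J]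
    {P : CatSystem.{w, v} J} {t : I ⥤ J} [t.Full] [t.Faithful] {m : I}
    {Z Z' : PseudoCone (t.obj m) t (P.restrict t)} (q : Z.obj m (𝟙 _) ⟶ Z'.obj m (𝟙 _)) :
    ∃ θ : ∀ (i : I) (s : t.obj m ⟶ t.obj i), Z.obj i s ⟶ Z'.obj i s,
      (∀ {i k : I} (g : i ⟶ k) (s : t.obj m ⟶ t.obj i) (s' : t.obj m ⟶ t.obj k)
        (h : s ≫ t.map g = s'), ((P.restrict t).map g).map (θ i s) ≫ (Z'.iso g s s' h).hom =
          (Z.iso g s s' h).hom ≫ θ k s') ∧ θ m (𝟙 _) = q := by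
  have hσ : ∀ {i : I} (s : t.obj m ⟶ t.obj i), 𝟙 _ ≫ t.map (t.preimage s) = s := fun s => by simp
  let θ (i : I) (s : t.obj m ⟶ t.obj i) : Z.obj i s ⟶ Z'.obj i s :=
    (Z.iso (t.preimage s) (𝟙 _) s (hσ s)).inv ≫ (P.map (t.map (t.preimage s))).map q ≫
      (Z'.iso (t.preimage s) (𝟙 _) s (hσ s)).hom
  have key : ∀ {i : I} (g : m ⟶ i) (s : t.obj m ⟶ t.obj i) (h : 𝟙 _ ≫ t.map g = s),
      (P.map (t.map g)).map q ≫ (Z'.iso g (𝟙 _) s h).hom = (Z.iso g (𝟙 _) s h).hom ≫ θ i s := by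
    intro i g s h
    obtain rfl : g = t.preimage s := t.map_injective (by simpa using h)
    -- Full faithfulness makes `(m, 𝟙)` initial among the indices, so the transition into each stage
    -- is unique and `θ` is forced.
    simp only [θ, Iso.hom_inv_id_assoc]
  have nat : ∀ {i k : I} (g : i ⟶ k) (s : t.obj m ⟶ t.obj i) (s' : t.obj m ⟶ t.obj k)
      (h : s ≫ t.map g = s'), (P.map (t.map g)).map (θ i s) ≫ (Z'.iso g s s' h).hom =
        (Z.iso g s s' h).hom ≫ θ k s' := by
    intro i k g s s' h
    have hg : 𝟙 _ ≫ t.map (t.preimage s ≫ g) = s' := by simpa using h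
    rw [← cancel_epi ((P.map (t.map g)).map (Z.iso (t.preimage s) (𝟙 _) s (hσ s)).hom),
      ← Functor.map_comp_assoc, ← key, Functor.map_comp,
      Z'.map_iso (t.preimage s) g _ rfl (𝟙 _) s s' (hσ s) h hg,
      Z.map_iso (t.preimage s) g _ rfl (𝟙 _) s s' (hσ s) h hg]
    simp only [Category.assoc, Iso.inv_hom_id, Category.comp_id, γ_hom_naturality_assoc, key,
      Iso.inv_hom_id_assoc]
  refine ⟨θ, nat, ?_⟩
  have : (P.map (t.map (𝟙 m))).Faithful := by
    rw [t.map_id]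
    infer_instance
  apply (P.map (t.map (𝟙 m))).map_injective
  have h : 𝟙 _ ≫ t.map (𝟙 m) = 𝟙 _ := by simp
  exact (cancel_mono _).1 ((nat (𝟙 m) (𝟙 _) (𝟙 _) h).trans (key (𝟙 m) (𝟙 _) h).symm)

section
variable {H : Type u} [Bicategory.{w, v} H]
  {I : Type u₁} [Category.{v₁} I] {J : Type u₂} [Category.{0} J] {t : I ⥤ J}
  {R A : LocallyDiscrete J ⥤ᵖ H} {κ : t.toPseudofunctor.comp R ⟶ t.toPseudofunctor.comp A} {X : H}

/-- The coherent family `A(s) a`. -/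
def mapCone {x : J} (a : X ⟶ A.obj ⟨x⟩) : PseudoCone x t ((ofHom A X).restrict t) where
  obj i s := a ≫ A.map s.toLoc
  iso f s s' h := (ofHom A X).γ s (t.map f) s' h a
  comp f g fg h s s' s'' hf hg hfg :=
    (ofHom A X).γ_assoc s (t.map f) (t.map g) s' (t.map fg) s'' hf (by rw [← h, t.map_comp]) hg hfg
      a

/-- The identification of `κ (R(id) z)` with `κ z`. -/
def imageConeIso (κ : t.toPseudofunctor.comp R ⟶ t.toPseudofunctor.comp A) {m : I}
    (z : X ⟶ R.obj ⟨t.obj m⟩) :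
    (imageCone κ z).obj m (𝟙 _) ≅ z ≫ κ.app ⟨m⟩ :=
  whiskerRightIso (whiskerLeftIso z (R.mapId ⟨t.obj m⟩) ≪≫ ρ_ z) (κ.app ⟨m⟩)

theorem imageConeIso_naturality {m : I} {z z' : X ⟶ R.obj ⟨t.obj m⟩} (η : z ⟶ z') :
    (η ▷ R.map (𝟙 (t.obj m)).toLoc) ▷ κ.app ⟨m⟩ ≫ (imageConeIso κ z').hom =
      (imageConeIso κ z).hom ≫ η ▷ κ.app ⟨m⟩ := by
  have h : η ▷ R.map (𝟙 (t.obj m)).toLoc ≫ z' ◁ (R.mapId ⟨t.obj m⟩).hom ≫ (ρ_ z').hom =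
      (z ◁ (R.mapId ⟨t.obj m⟩).hom ≫ (ρ_ z).hom) ≫ η := by
    refine (whisker_exchange_assoc η (R.mapId ⟨t.obj m⟩).hom (ρ_ z').hom).symm.trans ?_
    rw [rightUnitor_naturality, Category.assoc]
  exact (comp_whiskerRight _ _ _).symm.trans
    ((congrArg (· ▷ κ.app ⟨m⟩) h).trans (comp_whiskerRight _ _ _))

/-- Every map `t m ⟶ t i` comes from `m ⟶ i`, so the component at the identity determines the whole
modification of families. -/
theorem counit_hom_ext [t.Full] (hκ : IsRightKan (whiskerCounit κ (coyoneda X))) {m : I}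
    {z z' : X ⟶ R.obj ⟨t.obj m⟩} {η η' : z ⟶ z'} (h : η ▷ κ.app ⟨m⟩ = η' ▷ κ.app ⟨m⟩) :
    η = η' := by
  have h₁ : (η ▷ R.map (𝟙 (t.obj m)).toLoc) ▷ κ.app ⟨m⟩ =
      (η' ▷ R.map (𝟙 (t.obj m)).toLoc) ▷ κ.app ⟨m⟩ :=
    (Iso.cancel_iso_hom_right _ _ (imageConeIso κ z')).1 ((imageConeIso_naturality η).trans
      ((congrArg ((imageConeIso κ z).hom ≫ ·) h).trans (imageConeIso_naturality η').symm))
  refine imageCone_hom_ext hκ fun i s => ?_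
  have hs : 𝟙 _ ≫ t.map (t.preimage s) = s := by simp
  have h₂ := imageCone_naturality (κ := κ) η (t.preimage s) (𝟙 _) s hs
  have h₃ := imageCone_naturality (κ := κ) η' (t.preimage s) (𝟙 _) s hs
  exact (Iso.cancel_iso_hom_left _ _ _).1 (h₂.symm.trans
    ((congrArg (· ▷ A.map (t.map (t.preimage s)).toLoc ≫ _) h₁).trans h₃))

theorem counit_exists_hom [t.Full] [t.Faithful] (hκ : IsRightKan (whiskerCounit κ (coyoneda X)))
    {m : I} {z z' : X ⟶ R.obj ⟨t.obj m⟩} (g : z ≫ κ.app ⟨m⟩ ⟶ z' ≫ κ.app ⟨m⟩) :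
    ∃ η : z ⟶ z', η ▷ κ.app ⟨m⟩ = g := by
  obtain ⟨θ, hθ, hq⟩ := PseudoCone.exists_extension (P := ofHom A X) (Z := imageCone κ z)
    (Z' := imageCone κ z') ((imageConeIso κ z).hom ≫ g ≫ (imageConeIso κ z').inv)
  obtain ⟨η, hη⟩ := imageCone_exists_hom hκ θ hθ
  refine ⟨η, ?_⟩
  have h₁ := imageConeIso_naturality (κ := κ) η
  have h₂ := congrArg (· ≫ (imageConeIso κ z').hom) ((hη m (𝟙 _)).trans hq)
  have aux : ∀ {p q r s : X ⟶ A.obj ⟨t.obj m⟩} (i : p ≅ q) (g : q ⟶ r) (j : s ≅ r),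
      (i.hom ≫ g ≫ j.inv) ≫ j.hom = i.hom ≫ g := by
    intros
    simp
  exact (Iso.cancel_iso_hom_left (imageConeIso κ z) _ _).1
    (h₁.symm.trans (h₂.trans (aux (imageConeIso κ z) g (imageConeIso κ z'))))

/-- The universal arrow of a right pseudo-Kan extension along a fully faithful functor is an
equivalence. -/
theorem postcomp_counit_isEquivalence [t.Full] [t.Faithful]
    (hκ : IsRightKan (whiskerCounit κ (coyoneda X))) (m : I) :
    (postcomp X (κ.app ⟨m⟩)).IsEquivalence where
  faithful := ⟨fun h => counit_hom_ext hκ h⟩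
  full := ⟨fun g => counit_exists_hom hκ g⟩
  essSurj := ⟨fun a => by
    -- A 1-cell `a` spreads to the family of its images under `A`, and the 1-cell representing this
    -- family is sent by `κ` back to `a`.
    obtain ⟨z, τ, -⟩ := imageCone_exists_obj hκ (mapCone (t := t) (A := A) (x := t.obj m) a)
    exact ⟨z, ⟨(imageConeIso κ z).symm ≪≫ τ m (𝟙 _) ≪≫ whiskerLeftIso a (A.mapId ⟨t.obj m⟩) ≪≫
      ρ_ a⟩⟩⟩

end

instance : FinOrd.j.Faithful where
  map_injective h := SimplexCategory.Hom.ext _ _ h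

instance : FinOrd.j.Full where
  map_surjective f := ⟨SimplexCategory.Hom.mk f, rfl⟩

section
variable {H : Type u} [Bicategory.{w, v} H]

/-- Postcomposition with a composite. -/
def postcompComp (X : H) {x y z : H} (f : x ⟶ y) (g : y ⟶ z) :
    postcomp X (f ≫ g) ≅ postcomp X f ⋙ postcomp X g :=
  NatIso.ofComponents (fun h => (α_ h f g).symm) fun η => associator_inv_naturality_left η f g

theorem isEquiv₁_iff {x y : H} {f : x ⟶ y} :
    IsEquiv₁ f ↔ ∀ X : H, (postcomp X f).IsEquivalence :=
  ⟨fun h X => h.isEquivalence_postcomp X, isEquiv₁_of_postcomp f⟩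

variable {x y z : H} {f : x ⟶ y} {e : y ≌ z} {g : x ⟶ z}

theorem isEquiv₁_iff_of_iso (i : f ≫ e.hom ≅ g) : IsEquiv₁ f ↔ IsEquiv₁ g := by
  rw [isEquiv₁_iff, isEquiv₁_iff]
  refine forall_congr' fun X => ?_
  have := IsEquiv₁.isEquivalence_postcomp ⟨e, rfl⟩ X
  let k : postcomp X f ⋙ postcomp X e.hom ≅ postcomp X g :=
    (postcompComp X f e.hom).symm ≪≫ (postcomposing X _ _).mapIso i
  refine ⟨fun h => Functor.isEquivalence_of_iso k, fun h => ?_⟩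
  have := Functor.isEquivalence_of_iso k.symm
  exact Functor.isEquivalence_of_comp_right (postcomp X f) (postcomp X e.hom)

theorem full_faithful_iff_of_iso {C D E : Type*} [Category* C] [Category* D] [Category* E] {F : C ⥤ D}
    {G : D ⥤ E} {K : C ⥤ E} [G.IsEquivalence] (k : F ⋙ G ≅ K) :
    (F.Full ↔ K.Full) ∧ (F.Faithful ↔ K.Faithful) := by
  refine ⟨⟨fun h => Functor.Full.of_iso k, fun h => ?_⟩, ⟨fun h => Functor.Faithful.of_iso k,
    fun h => ?_⟩⟩
  · have := Functor.Full.of_iso k.symm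
    exact Functor.Full.of_comp_faithful F G
  · have := Functor.Faithful.of_iso k.symm
    exact Functor.Faithful.of_comp F G

theorem postcomp_iff_of_iso (i : f ≫ e.hom ≅ g) (X : H) :
    ((postcomp X f).Full ↔ (postcomp X g).Full) ∧
      ((postcomp X f).Faithful ↔ (postcomp X g).Faithful) :=
  have := IsEquiv₁.isEquivalence_postcomp ⟨e, rfl⟩ X
  full_faithful_iff_of_iso ((postcompComp X f e.hom).symm ≪≫ (postcomposing X _ _).mapIso i)

theorem isFaithful₁_iff_of_iso (i : f ≫ e.hom ≅ g) : IsFaithful₁ f ↔ IsFaithful₁ g :=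
  forall_congr' fun X => (postcomp_iff_of_iso i X).2

theorem isFullyFaithful₁_iff_of_iso (i : f ≫ e.hom ≅ g) : IsFullyFaithful₁ f ↔ IsFullyFaithful₁ g :=
  forall_congr' fun X => and_congr (postcomp_iff_of_iso i X).1 (postcomp_iff_of_iso i X).2

end

section
variable {H : Type u} [Bicategory.{w, v} H]

theorem IsEquiv₁.app {B : Type u₁} [Bicategory.{w₁, v₁} B] {F G : B ⥤ᵖ H} {η : F ⟶ G}
    (h : IsEquiv₁ η) (a : B) : IsEquiv₁ (η.app a) := by
  obtain ⟨e, rfl⟩ := h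
  exact ⟨Equivalence.mkOfAdjointifyCounit (appIso e.unit a) (appIso e.counit a), rfl⟩

variable {A : LocallyDiscrete FinOrd ⥤ᵖ H} (K : RightPsKan jP (jP.comp A))

/-- At a nonempty ordinal the comparison is a section, up to isomorphism, of a component of the
universal arrow. That component is an equivalence because `j` is fully faithful, so only the ordinal
`0` carries a condition. -/
theorem comparison_isEquiv₁ (hK : K.IsPointwise) (h : IsEquiv₁ (K.comparison.app ⟨FinOrd.zero⟩)) :
    IsEquiv₁ K.comparison := by
  refine isEquiv₁_of_app _ ?_
  rintro ⟨⟨_ | m⟩⟩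
  · exact h
  · obtain ⟨e, he⟩ : IsEquiv₁ (K.counit.app ⟨SimplexCategory.mk m⟩) :=
      isEquiv₁_of_postcomp _ fun X => postcomp_counit_isEquivalence (t := FinOrd.j) (hK X)
        (SimplexCategory.mk m)
    have i : K.comparison.app ⟨FinOrd.j.obj (SimplexCategory.mk m)⟩ ≫ e.hom ≅ 𝟙 _ :=
      whiskerLeftIso _ (eqToIso he) ≪≫ appIso K.triangle ⟨SimplexCategory.mk m⟩
    exact (isEquiv₁_iff_of_iso i).2 ⟨Equivalence.id _, rfl⟩

theorem exists_comparison_iso {K : RightPsKan jP (jP.comp A)} (hK : K.IsPointwise)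
    (hA : BeckChevalley (sucTrans A)) {l : A.obj ⟨FinOrd.one⟩ ⟶ A.obj ⟨FinOrd.zero⟩}
    {adj : Bicategory.Adjunction l (A.map FinOrd.d.toLoc)} (E : EMObject adj) :
    ∃ e : E.obj ≌ K.ran.obj ⟨FinOrd.zero⟩,
      Nonempty (E.comparison ≫ e.hom ≅ K.comparison.app ⟨FinOrd.zero⟩) := by
  obtain ⟨e, φ, -⟩ := isEquivalent_descentFactorization hA K hK adj E
  exact ⟨e, ⟨φ⟩⟩

/-- If the décalage transformation satisfies the Beck-Chevalley condition, effective descent,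
descent and almost descent are equivalent to monadicity, premonadicity and almost monadicity. -/
theorem descent_iff_monadic {K : RightPsKan jP (jP.comp A)} (hK : K.IsPointwise)
    (hA : BeckChevalley (sucTrans A)) {l : A.obj ⟨FinOrd.one⟩ ⟶ A.obj ⟨FinOrd.zero⟩}
    {adj : Bicategory.Adjunction l (A.map FinOrd.d.toLoc)} (E : EMObject adj) :
    (IsEffectiveDescent jP A ↔ IsMonadic (A.map FinOrd.d.toLoc)) ∧
    (IsDescent jP A ⟨FinOrd.zero⟩ ↔ IsPremonadic (A.map FinOrd.d.toLoc)) ∧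
    (IsAlmostDescent jP A ⟨FinOrd.zero⟩ ↔ IsAlmostMonadic (A.map FinOrd.d.toLoc)) := by
  refine ⟨⟨?_, ?_⟩, ⟨?_, ?_⟩, ⟨?_, ?_⟩⟩
  -- The descent and monadicity notions each assert the existence of their own extension or
  -- Eilenberg–Moore object. The equivalence of factorizations is therefore applied to the object
  -- given on one side and the fixed one on the other.
  · rintro ⟨K', hK', h⟩
    obtain ⟨e, ⟨φ⟩⟩ := exists_comparison_iso hK' hA E
    exact ⟨l, adj, E, (isEquiv₁_iff_of_iso φ).2 (h.app _)⟩
  · rintro ⟨l', adj', E', h⟩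
    obtain ⟨e, ⟨φ⟩⟩ := exists_comparison_iso hK hA E'
    exact ⟨K, hK, comparison_isEquiv₁ K hK ((isEquiv₁_iff_of_iso φ).1 h)⟩
  · rintro ⟨K', hK', h⟩
    obtain ⟨e, ⟨φ⟩⟩ := exists_comparison_iso hK' hA E
    exact ⟨l, adj, E, (isFullyFaithful₁_iff_of_iso φ).2 h⟩
  · rintro ⟨l', adj', E', h⟩
    obtain ⟨e, ⟨φ⟩⟩ := exists_comparison_iso hK hA E'
    exact ⟨K, hK, (isFullyFaithful₁_iff_of_iso φ).1 h⟩
  · rintro ⟨K', hK', h⟩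
    obtain ⟨e, ⟨φ⟩⟩ := exists_comparison_iso hK' hA E
    exact ⟨l, adj, E, (isFaithful₁_iff_of_iso φ).2 h⟩
  · rintro ⟨l', adj', E', h⟩
    obtain ⟨e, ⟨φ⟩⟩ := exists_comparison_iso hK hA E'
    exact ⟨K, hK, (isFaithful₁_iff_of_iso φ).1 h⟩

end
end FormalDescent

theorem mainTheorem8 :
    -- The formal theorem, for pseudofunctors on the category of finite ordinals.
    (∀ (H : Type u) [Bicategory.{w, v} H] (A : LocallyDiscrete FinOrd ⥤ᵖ H),
      FormalDescent.ShiftProperty A →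
      FormalDescent.BeckChevalley (FormalDescent.sucTrans A) →
      ∀ (K : FormalDescent.RightPsKan FormalDescent.jP (FormalDescent.jP.comp A)),
        K.IsPointwise →
      ∀ (l : A.obj ⟨FinOrd.one⟩ ⟶ A.obj ⟨FinOrd.zero⟩)
        (adj : Bicategory.Adjunction l (A.map FinOrd.d.toLoc))
        (E : FormalDescent.EMObject adj),
        E.factorization.IsEquivalent (FormalDescent.descentFactorization A K) ∧
        (FormalDescent.IsEffectiveDescent FormalDescent.jP A ↔
          FormalDescent.IsMonadic (A.map FinOrd.d.toLoc)) ∧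
        (FormalDescent.IsDescent FormalDescent.jP A ⟨FinOrd.zero⟩ ↔
          FormalDescent.IsPremonadic (A.map FinOrd.d.toLoc)) ∧
        (FormalDescent.IsAlmostDescent FormalDescent.jP A ⟨FinOrd.zero⟩ ↔
          FormalDescent.IsAlmostMonadic (A.map FinOrd.d.toLoc))) ∧
    -- The classical theorem, for pseudofunctors on the opposite of a category with pullbacks.
    (∀ (C : Type u₁) [Category.{v₁} C] [Limits.HasPullbacks C]
      (F : LocallyDiscrete Cᵒᵖ ⥤ᵖ Cat.{v₂, u₂}),
      FormalDescent.KernelPairBeckChevalley F →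
      ∀ {E B : C} (p : E ⟶ B) (sq : Limits.ChosenPullback p p)
        (sq₃ : Limits.ChosenPullback₃ sq sq sq)
        (L : F.obj ⟨Opposite.op E⟩ ⥤ F.obj ⟨Opposite.op B⟩)
        (adj : CategoryTheory.Adjunction L (F.map p.op.toLoc).toFunctor),
        (∃ (Φ : adj.toMonad.Algebra ≌ FormalDescent.Desc F sq sq₃)
          (φ : Monad.comparison adj ⋙ Φ.functor ≅ FormalDescent.toDesc F sq sq₃)
          (ψ : Φ.functor ⋙ FormalDescent.descForget F sq sq₃ ≅ adj.toMonad.forget),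
          ∀ M : F.obj ⟨Opposite.op B⟩,
            (FormalDescent.descForget F sq sq₃).map (φ.hom.app M) =
              ψ.hom.app ((Monad.comparison adj).obj M)) ∧
        ((FormalDescent.toDesc F sq sq₃).IsEquivalence ↔ (Monad.comparison adj).IsEquivalence) ∧
        ((FormalDescent.toDesc F sq sq₃).Full ∧ (FormalDescent.toDesc F sq sq₃).Faithful ↔
          (Monad.comparison adj).Full ∧ (Monad.comparison adj).Faithful) ∧
        ((FormalDescent.toDesc F sq sq₃).Faithful ↔ (Monad.comparison adj).Faithful)) := by
  refine ⟨?_, ?_⟩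
  · intro H _ A _ hA K hK l adj E
    exact ⟨FormalDescent.isEquivalent_descentFactorization hA K hK adj E,
      FormalDescent.descent_iff_monadic hK hA E⟩
  · intro C _ _ F hF E B p sq sq₃ L adj
    exact FormalDescent.benabou_roubaud sq sq₃ adj hF
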